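/- Let $G=(V,E)$ be an infinite, connected, locally finite graph with graph distance $d(\cdot,\cdot)$ and closed balls $B(x,r)=\{y\in V: d(x,y)\le \lfloor r\rfloor\}$. Let $d\ge 2$ be an integer, let $d'\ge d$ be real, and let $c_{\mathrm{reg}},C_{\mathrm{reg}},C_{\mathrm S_1}\in(0,\infty)$. Assume that for every $x\in V$: (i) (volume regularity) there is $N_1(x)<\infty$ such that $c_{\mathrm{reg}}\,n^d\le |B(x,n)|\le C_{\mathrm{reg}}\,n^d$ for all integers $n\ge N_1(x)$; (ii) (Sobolev inequality) there is $N_2(x)<\infty$ such that for all integers $n\ge N_2(x)$ and all $u:V\to\mathbb R$ with $\operatorname{supp}u\subset B(x,n)$, $$\|u\|_{d'/(d'-1),B(x,n)}\le C_{\mathrm S_1}\,\frac{n}{|B(x,n)|}\,\sum_{\{y,z\}\in E}|u(y)-u(z)| .$$ Here, for a finite non-empty $B\subset V$ and a compact interval $I$ of positive length, $$\|f\|_{p,B}=\Big(\tfrac1{|B|}\sum_{x\in B}|f(x)|^p\Big)^{1/p},\qquad \|u\|_{p,p',I\times B}=\Big(\tfrac1{|I|}\int_I\|u_t\|_{p,B}^{p'}\,dt\Big)^{1/p'},$$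 with $\|f\|_{\infty,B}=\max_B|f|$, $\|u\|_{p,\infty,I\times B}=\sup_{t\in I}\|u_t\|_{p,B}$, and norms taking values in $[0,\infty]$. Let $\omega=\{\omega_t(e)\in(0,\infty):e\in E,\ t\in\mathbb R\}$ be time-dependent weights, measurable in $t$ for each $e$, and set $\mu^\omega_t(x)=\sum_{y\sim x}\omega_t(\{x,y\})$ and $\nu^\omega_t(x)=\sum_{y\sim x}1/\omega_t(\{x,y\})$. For $s\le t$ let $p^\omega(s,x;t,y)$ be the heat kernel of the continuous-time random walk on $V$ with time-dependent generator $(\mathcal L^\omega_tf)(x)=\sum_{y\sim x}\omega_t(\{x,y\})(f(y)-f(x))$, that is, the probability that the walk started in $x$ at time $s$ is in $y$ at time $t$ after finitely many jumps. Let $p,p',q,q'\in[1,\infty]$ with $p'>1$ satisfy $$\frac1p\cdot\frac{p'}{p'-1}\cdot\frac{q'+1}{q'}+\frac1q<\frac2{d'}$$ (with $\frac{p'}{p'-1}=1$ if $p'=\infty$ and $\frac{q'+1}{q'}=1$ if $q'=\infty$). Then there exist a constant $\kappa'\in(0,\infty)$ depending only on $p,p',q,q',d'$, a constant $C_3\in(0,\infty)$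 depending only on $p,p',q,q',d'$ and on $d,c_{\mathrm{reg}},C_{\mathrm{reg}},C_{\mathrm S_1}$, and, for every $x_2\in V$, some $N_6(x_2)<\infty$ depending neither on $p,p',q,q'$ nor on $\omega$, such that for all weights $\omega$, all $x_1,x_2\in V$, all $s\ge0$, all $t>0$ with $\sqrt t\ge N_6(x_2)$, and all $y\in B(x_2,\tfrac12\sqrt t)$, $$p^\omega(s,x_1;s+t,y)\le C_3\Big(\|1\vee\mu^\omega\|_{p,p',Q}\,\|1\vee\nu^\omega\|_{q,q',Q}\Big)^{\kappa'}\,t^{-d/2},\qquad Q=[s,s+t]\times B(x_2,\sqrt t).$$ -/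

import Mathlib

open MeasureTheory Set
open scoped ENNReal

namespace DynRCM

variable {V : Type*}

/-- The closed ball `B(x,r) = {y : d(x,y) ≤ ⌊r⌋}` for the graph distance, as a set. -/
def ballSet (G : SimpleGraph V) (x : V) (r : ℝ) : Set V :=
  {y | G.edist x y ≤ (⌊r⌋₊ : ℕ∞)}

theorem ballSet_finite (G : SimpleGraph V) [G.LocallyFinite] (x : V) (r : ℝ) :
    (ballSet G x r).Finite := by
  have key : ∀ n : ℕ, {y | G.edist x y ≤ (n : ℕ∞)}.Finite := by
    intro n
    induction n with
    | zero =>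
      refine (Set.finite_singleton x).subset ?_
      intro y hy
      have h0 : G.edist x y = 0 := nonpos_iff_eq_zero.mp (by exact_mod_cast hy)
      exact Set.mem_singleton_iff.mpr (SimpleGraph.edist_eq_zero_iff.mp h0).symm
    | succ n ih =>
      refine ((ih.biUnion (fun z _ => (Set.toFinite (G.neighborSet z)))).union
        (Set.finite_singleton x)).subset ?_
      intro y hy
      have hy' : G.edist x y ≤ ((n + 1 : ℕ) : ℕ∞) := hy
      have hne : G.edist y x ≠ ⊤ := by
        rw [SimpleGraph.edist_comm]
        exact ne_top_of_le_ne_top (ENat.natCast_ne_top _) hy'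
      obtain ⟨p, hp⟩ := SimpleGraph.exists_walk_of_edist_ne_top hne
      cases p with
      | nil => exact Or.inr rfl
      | cons hadj q =>
        rename_i z
        left
        simp only [Set.mem_iUnion]
        refine ⟨z, ?_, hadj.symm⟩
        have hlen : ((q.length + 1 : ℕ) : ℕ∞) ≤ ((n + 1 : ℕ) : ℕ∞) := by
          rw [SimpleGraph.Walk.length_cons] at hp
          rw [hp, SimpleGraph.edist_comm]
          exact hy'
        have hq : q.length ≤ n := by
          have := ENat.natCast_le_natCast.mp hlen
          omega
        have h1 : G.edist z x ≤ q.length := SimpleGraph.edist_le q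
        have h2 : G.edist x z ≤ (q.length : ℕ∞) := by
          rw [SimpleGraph.edist_comm]; exact h1
        exact h2.trans (by exact_mod_cast hq)
  exact key _

/-- The closed ball `B(x,r) = {y : d(x,y) ≤ ⌊r⌋}` of a locally finite graph. -/
noncomputable def ball (G : SimpleGraph V) [G.LocallyFinite] (x : V) (r : ℝ) : Finset V :=
  (ballSet_finite G x r).toFinset

/-- The space-averaged norm `‖f‖_{p,B} = (|B|⁻¹ ∑_{x ∈ B} |f x|^p)^{1/p}`, the maximum of `|f|`
over `B` for `p = ∞`. -/
noncomputable def spaceNorm (B : Finset V) (p : ℝ≥0∞) (f : V → ℝ) : ℝ≥0∞ :=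
  if p = ∞ then ⨆ x ∈ B, ‖f x‖ₑ
  else ((∑ x ∈ B, ‖f x‖ₑ ^ p.toReal) / (B.card : ℝ≥0∞)) ^ (1 / p.toReal)

/-- The space-time-averaged norm `‖u‖_{p,p',I×B}` over `I = [a,b]`, that is
`(|I|⁻¹ ∫_I ‖u_t‖_{p,B}^{p'} dt)^{1/p'}` for `p' < ∞` and `sup_{t ∈ I} ‖u_t‖_{p,B}` for `p' = ∞`.
It takes the value `∞` when the integral diverges. -/
noncomputable def spaceTimeNorm (a b : ℝ) (B : Finset V) (p p' : ℝ≥0∞) (u : ℝ → V → ℝ) : ℝ≥0∞ :=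
  if p' = ∞ then ⨆ t ∈ Icc a b, spaceNorm B p (u t)
  else ((∫⁻ t in Icc a b, spaceNorm B p (u t) ^ p'.toReal) / ENNReal.ofReal (b - a))
    ^ (1 / p'.toReal)

/-- `|∇f(e)| = |f(e⁺) - f(e⁻)|`, which does not depend on the orientation of `e`. -/
def absGrad (f : V → ℝ) (e : Sym2 V) : ℝ :=
  Sym2.lift ⟨fun x y => |f x - f y|, fun x y => abs_sub_comm (f x) (f y)⟩ e

/-- Volume regularity of order `d` for large balls. -/
def VolumeRegularity (G : SimpleGraph V) [G.LocallyFinite] (d : ℕ) (creg Creg : ℝ) : Prop :=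
  ∀ x : V, ∃ N₁ : ℕ, ∀ n : ℕ, N₁ ≤ n →
    creg * (n : ℝ) ^ d ≤ ((ball G x n).card : ℝ) ∧ ((ball G x n).card : ℝ) ≤ Creg * (n : ℝ) ^ d

/-- The Sobolev inequality
`‖u‖_{d'/(d'-1),B(x,n)} ≤ C n / |B(x,n)| ‖∇u‖_{ℓ¹(E)}` for `supp u ⊆ B(x,n)`, on large balls. -/
def SobolevInequality (G : SimpleGraph V) [G.LocallyFinite] (d' CS : ℝ) : Prop :=
  ∀ x : V, ∃ N₂ : ℕ, ∀ n : ℕ, N₂ ≤ n → ∀ u : V → ℝ,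
    Function.support u ⊆ (ball G x n : Set V) →
      spaceNorm (ball G x n) (ENNReal.ofReal (d' / (d' - 1))) u ≤
        ENNReal.ofReal CS * ((n : ℝ≥0∞) / ((ball G x n).card : ℝ≥0∞)) *
          ∑' e : G.edgeSet, ‖absGrad u e‖ₑ

/-- Time-dependent positive weights `ω_t(e)`, measurable in `t` for every edge `e`. The values off
the edge set play no role. -/
structure IsWeight (G : SimpleGraph V) (ω : ℝ → Sym2 V → ℝ) : Prop where
  pos : ∀ t : ℝ, ∀ e ∈ G.edgeSet, 0 < ω t e
  measurable : ∀ e ∈ G.edgeSet, Measurable fun t => ω t e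

/-- `μ_t(x) = ∑_{y ∼ x} ω_t({x,y})`. -/
def mu (G : SimpleGraph V) [G.LocallyFinite] (ω : ℝ → Sym2 V → ℝ) (t : ℝ) (x : V) : ℝ :=
  ∑ y ∈ G.neighborFinset x, ω t s(x, y)

/-- `ν_t(x) = ∑_{y ∼ x} 1 / ω_t({x,y})`. -/
noncomputable def nu (G : SimpleGraph V) [G.LocallyFinite] (ω : ℝ → Sym2 V → ℝ) (t : ℝ) (x : V) :
    ℝ :=
  ∑ y ∈ G.neighborFinset x, 1 / ω t s(x, y)

/-- The probability `exp (-∫_s^t μ_u(x) du)` that the walk sitting at `x` at time `s` does not jump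
during `(s,t]`; it is `0` if the integral is infinite. -/
noncomputable def survival (G : SimpleGraph V) [G.LocallyFinite] (ω : ℝ → Sym2 V → ℝ) (x : V)
    (s t : ℝ) : ℝ≥0∞ :=
  EReal.exp (-((∫⁻ u in Ioc s t, ENNReal.ofReal (mu G ω u x) : ℝ≥0∞) : EReal))

open Classical in
/-- `P_{s,x}[X_t = y, X makes exactly n jumps in (s,t]]` for the walk `X` with generator
`(L_t f)(x) = ∑_{z ∼ x} ω_t({x,z}) (f z - f x)` started in `x` at time `s`: the first jump from `x`
happens at time `r` with density `exp (-∫_s^r μ_u(x) du) μ_r(x)`, and leads to a neighbour `z` with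
probability `ω_r({x,z}) / μ_r(x)`, after which the walk starts afresh from `z` at time `r`. -/
noncomputable def jumpKernel (G : SimpleGraph V) [G.LocallyFinite] (ω : ℝ → Sym2 V → ℝ)
    (t : ℝ) (y : V) : ℕ → ℝ → V → ℝ≥0∞
  | 0, s, x => if x = y then survival G ω x s t else 0
  | n + 1, s, x => ∫⁻ r in Ioc s t, survival G ω x s r *
      ∑ z ∈ G.neighborFinset x, ENNReal.ofReal (ω r s(x, z)) * jumpKernel G ω t y n r z

/-- The heat kernel `p(s,x;t,y) = P_{s,x}[X_t = y]` for `s ≤ t`, where the event is split according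
to the number of jumps in `(s,t]` (finite, as `X` has càdlàg paths in the discrete space `V`). -/
noncomputable def heatKernel (G : SimpleGraph V) [G.LocallyFinite] (ω : ℝ → Sym2 V → ℝ)
    (s : ℝ) (x : V) (t : ℝ) (y : V) : ℝ≥0∞ :=
  ∑' n : ℕ, jumpKernel G ω t y n s x

/-- The condition `1/p · p'/(p'-1) · (q'+1)/q' + 1/q < 2/d'` on `p, p', q, q' ∈ [1,∞]`, where
`p'/(p'-1) = (1 - 1/p')⁻¹` (equal to `1` if `p' = ∞`) requires `p' > 1`. -/
def ExponentCondition (p p' q q' : ℝ≥0∞) (d' : ℝ) : Prop :=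
  1 ≤ p ∧ 1 < p' ∧ 1 ≤ q ∧ 1 ≤ q' ∧
    p⁻¹ * (1 - p'⁻¹)⁻¹ * (1 + q'⁻¹) + q⁻¹ < ENNReal.ofReal (2 / d')

end DynRCM

namespace DynRCM

/-! ### Chain rule for indefinite integrals -/

section AbsolutelyContinuous

/-! As a function of its endpoint the kernel `u` solves the forward equation, takes values in [0,1]
and has total mass at most one at each time. A De Giorgi argument converts mass into height: a
solution with a peak of height M must exceed a fixed fraction of M on a large part of space-time,
and the mass bound forbids this unless M is of order 1/|B|, up to a power of the norms of the
weights.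

Let w_k be the positive part of `u` minus a barrier minus k, and θ_k(t) the spatial density of {w_k
> 0}. The energy inequality `IsWeight.excess_energy_le` bounds both sup_t ∑ w_k² and the Dirichlet
energy by the integral of 1 ∨ μ over {w_k > 0}; Hölder turns that integral into the norm of 1 ∨ μ
times a power of Z_k, the time mean of θ_k^a. At a higher level, θ_{k+δ} is controlled twice: by
Chebyshev from the supremum bound, and from the energy by Sobolev and Cauchy–Schwarz, at the cost of
the norm of 1 ∨ ν (`IsWeight.superlevel_le`). Interpolating in time gives a recursion Z_{k+δ} ≤
(…)^g Z_k^{1+η} (`BarrierSetup.lintegral_levelDensity_le`). Here η is a positive multiple of r(1 -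
1/p')(2/d' - 1/q) - 1/p with r = q'/(q'+1), so the exponent condition is exactly the superlinearity
of the recursion. Were Z_{M/4} small, Z_{M/2} would vanish, which contradicts the peak; and Markov's
inequality bounds Z_{M/4} by (4/(M|B|))^a. This is `BarrierSetup.peak_mul_card_le`.

Localization needs no cutoff functions or nested cylinders. Let φ be a weight vanishing on the
parabolic boundary of the cylinder and take a maximum point of φ^m `u`. On a subcylinder of size
comparable to φ around it, `u` is at most 2^m times its value M at that point, and a barrier which
reaches this height on the parabolic boundary makes the excess vanish there (`exists_barrierSetup`).
The peak bound reads M|B| ≤ C (A/φ²)^κ, where A is the product of the two norms, and m ≥ 2κ lets φ^m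
absorb φ^{-2κ}. If φ√t < 8 the subcylinder is too small for the graph, but then φ^m M ≤ (8/√t)^m
already suffices, since m ≥ d.

The kernel is defined through its jump expansion, so the forward equation has to be derived.
Decomposing at the last jump gives it in integrated form (`IsWeight.heatKernel_add_lintegral`), and
subtraction is legitimate once μ is integrable in time. Finiteness of the norms ensures this, and
infinite norms leave nothing to prove. -/

theorem _root_.AbsolutelyContinuousOnInterval.comp_lipschitzOnWith {f φ : ℝ → ℝ} {a b : ℝ}
    {K : NNReal} {S : Set ℝ} (hf : AbsolutelyContinuousOnInterval f a b)
    (hφ : LipschitzOnWith K φ S) (hS : ∀ x ∈ uIcc a b, f x ∈ S) :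
    AbsolutelyContinuousOnInterval (fun x => φ (f x)) a b := by
  rw [absolutelyContinuousOnInterval_iff] at hf ⊢
  intro ε hε
  obtain ⟨δ, hδ, h⟩ := hf (ε / (K + 1)) (by positivity)
  refine ⟨δ, hδ, fun E hE hlt => ?_⟩
  have h1 := h E hE hlt
  have hK : (0 : ℝ) < K + 1 := by positivity
  calc ∑ i ∈ Finset.range E.1, dist (φ (f (E.2 i).1)) (φ (f (E.2 i).2))
      ≤ ∑ i ∈ Finset.range E.1, (K + 1) * dist (f (E.2 i).1) (f (E.2 i).2) := by
        refine Finset.sum_le_sum fun i hi => ?_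
        have := hφ.dist_le_mul _ (hS _ (hE.1 i hi).1) _ (hS _ (hE.1 i hi).2)
        nlinarith [dist_nonneg (x := f (E.2 i).1) (y := f (E.2 i).2)]
    _ < ε := by
        rw [← Finset.mul_sum]
        rw [lt_div_iff₀ hK] at h1
        linarith

/-- The chain rule for a `C¹` function of an indefinite integral. -/
theorem integral_comp_mul_of_eq_integral {f g φ φ' : ℝ → ℝ} {a b : ℝ} (hab : a ≤ b)
    (hg : IntervalIntegrable g volume a b)
    (hf : ∀ x ∈ Icc a b, f x = f a + ∫ y in a..x, g y)
    (hφ : ∀ x, HasDerivAt φ (φ' x) x) (hφ' : Continuous φ') :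
    φ (f b) - φ (f a) = ∫ x in a..b, φ' (f x) * g x := by
  -- The primitive is absolutely continuous and bounded on the interval, so φ is Lipschitz on its
  -- range and φ ∘ F is absolutely continuous; the fundamental theorem then needs only an almost
  -- everywhere derivative.
  set F : ℝ → ℝ := fun x => f a + ∫ y in a..x, g y with hF
  have hFac : AbsolutelyContinuousOnInterval F a b := by
    have h1 := hg.absolutelyContinuousOnInterval_intervalIntegral (c := a) left_mem_uIcc
    have h2 : AbsolutelyContinuousOnInterval (fun _ : ℝ => f a) a b :=
      ((LipschitzWith.const (f a)).lipschitzOnWith (s := uIcc a b)).absolutelyContinuousOnInterval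
    exact h2.add h1
  obtain ⟨R, hR⟩ := hFac.exists_bound
  have hmem : ∀ x ∈ uIcc a b, F x ∈ Icc (-R) R := fun x hx => abs_le.1 (hR x hx)
  obtain ⟨C, hC⟩ := (isCompact_Icc (a := -R) (b := R)).exists_bound_of_continuousOn
    hφ'.continuousOn
  have hlip : LipschitzOnWith (Real.toNNReal C) φ (Icc (-R) R) := by
    refine (convex_Icc _ _).lipschitzOnWith_of_nnnorm_hasDerivWithin_le
      (fun x _ => (hφ x).hasDerivWithinAt) (fun x hx => ?_)
    rw [← NNReal.coe_le_coe]
    exact (hC x hx).trans (Real.le_coe_toNNReal C)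
  have hac := hFac.comp_lipschitzOnWith hlip hmem
  have hend : φ (F b) - φ (F a) = φ (f b) - φ (f a) := by
    simp only [hF, intervalIntegral.integral_same, add_zero]
    rw [← hf b ⟨hab, le_rfl⟩]
  rw [← hend, ← hac.integral_deriv_eq_sub]
  refine intervalIntegral.integral_congr_ae ?_
  filter_upwards [hg.ae_hasDerivAt_integral] with x hx hxm
  have hx' : x ∈ uIcc a b := uIoc_subset_uIcc hxm
  have h1 : HasDerivAt F (g x) x := (hx hx' a left_mem_uIcc).const_add (f a)
  have h2 := (hφ (F x)).comp x h1
  have : F x = f x := by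
    rw [uIoc_of_le hab] at hxm
    rw [hf x ⟨hxm.1.le, hxm.2⟩]
  rw [← this]
  exact h2.deriv

/-- Squaring removes the kink of the positive part, so the squared excess falls under the C¹ chain
rule. Only the origin needs an argument. -/
theorem hasDerivAt_half_sq_max (x : ℝ) :
    HasDerivAt (fun x : ℝ => (max x 0) ^ 2 / 2) (max x 0) x := by
  rcases lt_trichotomy x 0 with h | h | h
  · rw [max_eq_right h.le]
    refine (hasDerivAt_const x (0 : ℝ)).congr_of_eventuallyEq ?_
    filter_upwards [Iio_mem_nhds h] with y hy
    rw [max_eq_right (le_of_lt hy)]; norm_num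
  · subst h
    rw [hasDerivAt_iff_isLittleO_nhds_zero]
    simp only [zero_add, max_self, smul_zero, sub_zero]
    have h1 : (fun h : ℝ => h ^ 2) =o[nhds 0] fun h : ℝ => h := by
      simpa using Asymptotics.isLittleO_pow_id (𝕜 := ℝ) (n := 2) (by norm_num)
    refine (Asymptotics.IsBigO.of_bound 1 (Filter.Eventually.of_forall fun y => ?_)).trans_isLittleO
      h1
    simp only [Real.norm_eq_abs, abs_pow, sq_abs, one_mul]
    rcases le_total y 0 with hy | hy
    · rw [max_eq_right hy]; norm_num [sq_nonneg]
    · rw [max_eq_left hy, abs_of_nonneg (by nlinarith [sq_nonneg y])]; nlinarith [sq_nonneg y]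
  · rw [max_eq_left h.le]
    have h2 : HasDerivAt (fun x : ℝ => x ^ 2 / 2) x x := by
      have := (hasDerivAt_pow 2 x).div_const 2
      simpa using this
    refine h2.congr_of_eventuallyEq ?_
    filter_upwards [Ioi_mem_nhds h] with y hy
    rw [max_eq_left (le_of_lt hy)]

end AbsolutelyContinuous

/-! ### Exponential clocks with time-dependent rate -/

section Exponential

theorem exp_neg_coe_of_ne_top {v : ℝ≥0∞} (hv : v ≠ ∞) :
    EReal.exp (-(v : EReal)) = ENNReal.ofReal (Real.exp (-v.toReal)) := by
  lift v to NNReal using hv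
  rfl

theorem continuous_exp_neg_coe : Continuous fun v : ℝ≥0∞ => EReal.exp (-(v : EReal)) :=
  ENNReal.continuous_exp.comp (continuous_neg.comp continuous_coe_ennreal_ereal)

/-- The law of a clock with rate `f` and infinite horizon has total mass one. -/
theorem exp_neg_add_lintegral_of_finite {f : ℝ → ℝ≥0∞} (hf : Measurable f) (hf' : ∀ x, f x ≠ ∞)
    {s t : ℝ} (hst : s ≤ t) (hfin : ∫⁻ u in Ioc s t, f u ≠ ∞) :
    EReal.exp (-((∫⁻ u in Ioc s t, f u : ℝ≥0∞) : EReal)) +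
      ∫⁻ r in Ioc s t, EReal.exp (-((∫⁻ u in Ioc s r, f u : ℝ≥0∞) : EReal)) * f r = 1 := by
  have hint : IntervalIntegrable (fun u => (f u).toReal) volume s t := by
    rw [intervalIntegrable_iff_integrableOn_Ioc_of_le hst]
    exact integrable_toReal_of_lintegral_ne_top hf.aemeasurable hfin
  set F : ℝ → ℝ := fun x => ∫ y in s..x, (f y).toReal with hF
  have hFe : ∀ x ∈ Icc s t, (∫⁻ u in Ioc s x, f u).toReal = F x := by
    intro x hx
    rw [hF]
    simp only
    rw [intervalIntegral.integral_of_le hx.1, integral_toReal hf.aemeasurable]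
    exact Filter.Eventually.of_forall fun y => (hf' y).lt_top
  have hle : ∀ x ∈ Icc s t, ∫⁻ u in Ioc s x, f u ≠ ∞ := fun x hx =>
    ne_top_of_le_ne_top hfin (lintegral_mono_set (Ioc_subset_Ioc_right hx.2))
  have hE : ∀ x ∈ Icc s t, EReal.exp (-((∫⁻ u in Ioc s x, f u : ℝ≥0∞) : EReal)) =
      ENNReal.ofReal (Real.exp (-F x)) := fun x hx => by
    rw [exp_neg_coe_of_ne_top (hle x hx), hFe x hx]
  -- The jump density is the derivative of -exp(-F), so its integral telescopes against the survival
  -- probability.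
  have key := integral_comp_mul_of_eq_integral (f := F) (φ := fun x => - Real.exp (-x))
    (φ' := fun x => Real.exp (-x)) hst hint (fun x _ => by simp [hF])
    (fun x => by
      have h := ((hasDerivAt_neg x).exp).neg
      rwa [mul_neg_one, neg_neg] at h) (by fun_prop)
  have hFs : F s = 0 := by simp [hF]
  have hFcont : ContinuousOn F (uIcc s t) :=
    (hint.absolutelyContinuousOnInterval_intervalIntegral (c := s) left_mem_uIcc).continuousOn
  have hint2 : IntervalIntegrable (fun x => Real.exp (-F x) * (f x).toReal) volume s t :=
    hint.continuousOn_mul (by fun_prop)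
  have h2 : ∫⁻ r in Ioc s t, EReal.exp (-((∫⁻ u in Ioc s r, f u : ℝ≥0∞) : EReal)) * f r =
      ENNReal.ofReal (∫ x in s..t, Real.exp (-F x) * (f x).toReal) := by
    rw [intervalIntegral.integral_of_le hst, ofReal_integral_eq_lintegral_ofReal hint2.1]
    · refine setLIntegral_congr_fun measurableSet_Ioc fun x hx => ?_
      rw [hE x ⟨hx.1.le, hx.2⟩, ENNReal.ofReal_mul (Real.exp_pos _).le, ENNReal.ofReal_toReal (hf' x)]
    · exact Filter.Eventually.of_forall fun y => by simp only [Pi.zero_apply]; positivity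
  rw [h2, hE t ⟨hst, le_rfl⟩, ← key, hFs, ← ENNReal.ofReal_add (Real.exp_pos _).le]
  · simp
  · have : 0 ≤ F t := by
      rw [← hFe t ⟨hst, le_rfl⟩]; positivity
    simp [this]

/-- Truncating the rate at n makes it integrable, where equality holds; Fatou passes to the limit.
Only an inequality can survive: with a rate not integrable near s both terms vanish. -/
theorem exp_neg_add_lintegral_le {f : ℝ → ℝ≥0∞} (hf : Measurable f) (hf' : ∀ x, f x ≠ ∞)
    (s t : ℝ) :
    EReal.exp (-((∫⁻ u in Ioc s t, f u : ℝ≥0∞) : EReal)) +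
      ∫⁻ r in Ioc s t, EReal.exp (-((∫⁻ u in Ioc s r, f u : ℝ≥0∞) : EReal)) * f r ≤ 1 := by
  rcases lt_or_ge t s with hst | hst
  · simp [Ioc_eq_empty_of_le hst.le]
  set fn : ℕ → ℝ → ℝ≥0∞ := fun n x => min (f x) n with hfn
  have hmeas : ∀ n, Measurable (fn n) := fun n => hf.min measurable_const
  have hmono : Monotone fn := fun i j hij x => min_le_min le_rfl (by exact_mod_cast hij)
  have hlim : ∀ x, Filter.Tendsto (fun n => fn n x) Filter.atTop (nhds (f x)) := by
    intro x
    refine tendsto_const_nhds.congr' ?_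
    obtain ⟨N, hN⟩ := ENNReal.exists_nat_gt (hf' x)
    filter_upwards [Filter.eventually_ge_atTop N] with n hn
    rw [hfn]; simp only
    rw [min_eq_left (hN.le.trans (by exact_mod_cast hn))]
  have hLim : ∀ r, Filter.Tendsto (fun n => EReal.exp (-((∫⁻ u in Ioc s r, fn n u : ℝ≥0∞) : EReal)))
      Filter.atTop (nhds (EReal.exp (-((∫⁻ u in Ioc s r, f u : ℝ≥0∞) : EReal)))) := by
    intro r
    refine (continuous_exp_neg_coe.tendsto _).comp ?_
    exact lintegral_tendsto_of_tendsto_of_monotone (fun n => (hmeas n).aemeasurable)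
      (Filter.Eventually.of_forall fun x i j hij => hmono hij x)
      (Filter.Eventually.of_forall hlim)
  have hone : ∀ n, EReal.exp (-((∫⁻ u in Ioc s t, fn n u : ℝ≥0∞) : EReal)) +
      ∫⁻ r in Ioc s t, EReal.exp (-((∫⁻ u in Ioc s r, fn n u : ℝ≥0∞) : EReal)) * fn n r = 1 := by
    intro n
    refine exp_neg_add_lintegral_of_finite (hmeas n)
      (fun x => ne_top_of_le_ne_top (hf' x) (min_le_left _ _)) hst ?_
    refine ne_top_of_le_ne_top (b := ∫⁻ u in Ioc s t, (n : ℝ≥0∞)) ?_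
      (lintegral_mono fun x => min_le_right _ _)
    simp [ENNReal.mul_eq_top]
  have hcum : ∀ n, Measurable fun r => ∫⁻ u in Ioc s r, fn n u := by
    intro n
    refine Monotone.measurable fun a b hab => lintegral_mono_set (Ioc_subset_Ioc_right hab)
  have hfatou := lintegral_liminf_le (μ := volume.restrict (Ioc s t)) (u := Filter.atTop)
    (f := fun n r => EReal.exp (-((∫⁻ u in Ioc s r, fn n u : ℝ≥0∞) : EReal)) * fn n r)
    (fun n => (continuous_exp_neg_coe.measurable.comp (hcum n)).mul (hmeas n))
  have h1 : ∀ r, Filter.liminf (fun n => EReal.exp (-((∫⁻ u in Ioc s r, fn n u : ℝ≥0∞) : EReal))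
      * fn n r) Filter.atTop = EReal.exp (-((∫⁻ u in Ioc s r, f u : ℝ≥0∞) : EReal)) * f r := by
    intro r
    refine (ENNReal.Tendsto.mul (hLim r) (Or.inr (hf' r)) (hlim r) (Or.inr ?_)).liminf_eq
    rw [Ne, EReal.exp_eq_top_iff]
    simp
  simp only [h1] at hfatou
  have h2 : Filter.Tendsto (fun n => 1 - EReal.exp (-((∫⁻ u in Ioc s t, fn n u : ℝ≥0∞) : EReal)))
      Filter.atTop (nhds (1 - EReal.exp (-((∫⁻ u in Ioc s t, f u : ℝ≥0∞) : EReal)))) :=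
    ENNReal.Tendsto.sub tendsto_const_nhds (hLim t) (Or.inl ENNReal.one_ne_top)
  have hexp1 : ∀ v : ℝ≥0∞, EReal.exp (-(v : EReal)) ≤ 1 := by
    intro v
    rw [← EReal.exp_zero]
    refine EReal.exp_monotone ?_
    simpa using EReal.coe_ennreal_nonneg v
  have h3 : ∀ n, ∫⁻ r in Ioc s t, EReal.exp (-((∫⁻ u in Ioc s r, fn n u : ℝ≥0∞) : EReal)) * fn n r
      = 1 - EReal.exp (-((∫⁻ u in Ioc s t, fn n u : ℝ≥0∞) : EReal)) := by
    intro n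
    rw [← hone n]
    rw [ENNReal.add_sub_cancel_left]
    exact ne_top_of_le_ne_top ENNReal.one_ne_top (hexp1 _)
  simp only [h3] at hfatou
  rw [h2.liminf_eq] at hfatou
  calc _ ≤ _ + (1 - EReal.exp (-((∫⁻ u in Ioc s t, f u : ℝ≥0∞) : EReal))) := by gcongr
    _ = 1 := add_tsub_cancel_of_le (hexp1 _)

end Exponential

/-! ### The heat kernel and its forward equation -/

section Kernel

variable {V : Type*} {G : SimpleGraph V} {ω : ℝ → Sym2 V → ℝ}

/-- Tonelli's theorem on a triangle. -/
theorem lintegral_lintegral_triangle {F : ℝ → ℝ → ℝ≥0∞} (hF : Measurable (Function.uncurry F))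
    (s t : ℝ) : ∫⁻ r in Ioc s t, ∫⁻ v in Ioc r t, F r v =
      ∫⁻ v in Ioc s t, ∫⁻ r in Ioc s v, F r v := by
  have h1 : ∀ r ∈ Ioc s t, ∫⁻ v in Ioc r t, F r v =
      ∫⁻ v in Ioc s t, {p : ℝ × ℝ | p.1 < p.2}.indicator (Function.uncurry F) (r, v) := by
    intro r hr
    have : ∀ v, {p : ℝ × ℝ | p.1 < p.2}.indicator (Function.uncurry F) (r, v) =
        (Ioi r).indicator (F r) v := fun v => by
      by_cases h : r < v <;> simp [h]
    simp only [this]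
    rw [lintegral_indicator measurableSet_Ioi, Measure.restrict_restrict measurableSet_Ioi]
    congr 2
    ext v; simp only [mem_Ioc, mem_inter_iff, mem_Ioi]
    constructor
    · rintro ⟨h, h'⟩; exact ⟨h, hr.1.trans h, h'⟩
    · rintro ⟨h, _, h'⟩; exact ⟨h, h'⟩
  have h2 : ∀ v ∈ Ioc s t, ∫⁻ r in Ioc s v, F r v =
      ∫⁻ r in Ioc s t, {p : ℝ × ℝ | p.1 < p.2}.indicator (Function.uncurry F) (r, v) := by
    intro v hv
    have : ∀ r, {p : ℝ × ℝ | p.1 < p.2}.indicator (Function.uncurry F) (r, v) =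
        (Iio v).indicator (fun r => F r v) r := fun r => by
      by_cases h : r < v <;> simp [h]
    simp only [this]
    -- The strict triangle omits the endpoint r = v, a null set.
    rw [lintegral_indicator measurableSet_Iio, Measure.restrict_restrict measurableSet_Iio,
      ← Measure.restrict_congr_set (Ioo_ae_eq_Ioc (μ := volume) (a := s) (b := v))]
    congr 2
    ext r; simp only [mem_Ioc, mem_inter_iff, mem_Iio, mem_Ioo]
    constructor
    · rintro ⟨h, h'⟩; exact ⟨h', h, h'.le.trans hv.2⟩
    · rintro ⟨h, h', _⟩; exact ⟨h', h⟩
  rw [setLIntegral_congr_fun measurableSet_Ioc h1, setLIntegral_congr_fun measurableSet_Ioc h2]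
  refine lintegral_lintegral_swap (Measurable.aemeasurable ?_)
  exact hF.indicator (measurableSet_lt measurable_fst measurable_snd)

theorem measurable_setLIntegral_Ioc {α : Type*} [MeasurableSpace α] {a b : α → ℝ}
    {F : α → ℝ → ℝ≥0∞} (ha : Measurable a) (hb : Measurable b)
    (hF : Measurable (Function.uncurry F)) :
    Measurable fun x => ∫⁻ r in Ioc (a x) (b x), F x r := by
  have : ∀ x, ∫⁻ r in Ioc (a x) (b x), F x r =
      ∫⁻ r, {p : α × ℝ | a p.1 < p.2 ∧ p.2 ≤ b p.1}.indicator (Function.uncurry F) (x, r) := by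
    intro x
    rw [← lintegral_indicator measurableSet_Ioc]
    refine lintegral_congr fun r => ?_
    by_cases h : a x < r ∧ r ≤ b x <;> simp [indicator, h]
  simp only [this]
  refine Measurable.lintegral_prod_right' (f := {p : α × ℝ | a p.1 < p.2 ∧ p.2 ≤ b p.1}.indicator
    (Function.uncurry F)) (hF.indicator ?_)
  exact (measurableSet_lt (ha.comp measurable_fst) measurable_snd).inter
    (measurableSet_le measurable_snd (hb.comp measurable_fst))

theorem IsWeight.measurable_of_adj (hω : IsWeight G ω) {x y : V} (h : G.Adj x y) :
    Measurable fun t => ω t s(x, y) :=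
  hω.measurable _ (G.mem_edgeSet.2 h)

theorem IsWeight.pos_of_adj (hω : IsWeight G ω) {x y : V} (h : G.Adj x y) (t : ℝ) :
    0 < ω t s(x, y) :=
  hω.pos t _ (G.mem_edgeSet.2 h)

variable [G.LocallyFinite]

theorem IsWeight.measurable_mu (hω : IsWeight G ω) (x : V) : Measurable fun t => mu G ω t x :=
  Finset.measurable_fun_sum _ fun _ hy =>
    hω.measurable_of_adj ((G.mem_neighborFinset _ _).1 hy)

theorem IsWeight.measurable_nu (hω : IsWeight G ω) (x : V) : Measurable fun t => nu G ω t x :=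
  Finset.measurable_fun_sum _ fun _ hy =>
    measurable_const.div (hω.measurable_of_adj ((G.mem_neighborFinset _ _).1 hy))

theorem IsWeight.mu_nonneg (hω : IsWeight G ω) (t : ℝ) (x : V) : 0 ≤ mu G ω t x :=
  Finset.sum_nonneg fun _ hy => (hω.pos_of_adj ((G.mem_neighborFinset _ _).1 hy) t).le

theorem IsWeight.le_mu (hω : IsWeight G ω) {x y : V} (h : G.Adj x y) (t : ℝ) :
    ω t s(x, y) ≤ mu G ω t x :=
  Finset.single_le_sum (f := fun y => ω t s(x, y))
    (fun _ hy => (hω.pos_of_adj ((G.mem_neighborFinset _ _).1 hy) t).le)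
    ((G.mem_neighborFinset _ _).2 h)

theorem IsWeight.ofReal_mu (hω : IsWeight G ω) (t : ℝ) (x : V) :
    ENNReal.ofReal (mu G ω t x) = ∑ y ∈ G.neighborFinset x, ENNReal.ofReal (ω t s(x, y)) :=
  ENNReal.ofReal_sum_of_nonneg fun _ hy => (hω.pos_of_adj ((G.mem_neighborFinset _ _).1 hy) t).le

theorem IsWeight.measurable_survival (hω : IsWeight G ω) (x : V) :
    Measurable fun p : ℝ × ℝ => survival G ω x p.1 p.2 := by
  refine continuous_exp_neg_coe.measurable.comp ?_
  refine measurable_setLIntegral_Ioc measurable_fst measurable_snd ?_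
  exact (hω.measurable_mu x).ennreal_ofReal.comp measurable_snd

theorem IsWeight.measurable_jumpKernel (hω : IsWeight G ω) (y : V) (n : ℕ) (x : V) :
    Measurable fun p : ℝ × ℝ => jumpKernel G ω p.2 y n p.1 x := by
  induction n generalizing x with
  | zero =>
    simp only [jumpKernel]
    split_ifs
    · exact hω.measurable_survival x
    · exact measurable_const
  | succ n ih =>
    simp only [jumpKernel]
    refine measurable_setLIntegral_Ioc measurable_fst measurable_snd ?_
    have h1 : Measurable fun q : (ℝ × ℝ) × ℝ => (q.1.1, q.2) := by fun_prop
    have h2 : Measurable fun q : (ℝ × ℝ) × ℝ => (q.2, q.1.2) := by fun_prop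
    refine Measurable.mul ((hω.measurable_survival x).comp h1) ?_
    refine Finset.measurable_fun_sum _ fun z hz => Measurable.mul ?_ ((ih z).comp h2)
    exact ((hω.measurable_of_adj ((G.mem_neighborFinset _ _).1 hz)).ennreal_ofReal).comp
      measurable_snd

theorem IsWeight.survival_add_lintegral_le (hω : IsWeight G ω) (x : V) (s t : ℝ) :
    survival G ω x s t +
      ∫⁻ r in Ioc s t, survival G ω x s r * ENNReal.ofReal (mu G ω r x) ≤ 1 :=
  exp_neg_add_lintegral_le (hω.measurable_mu x).ennreal_ofReal (fun _ => ENNReal.ofReal_ne_top) s t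

theorem IsWeight.survival_add_lintegral (hω : IsWeight G ω) (x : V) {s t : ℝ} (hst : s ≤ t)
    (hfin : ∫⁻ u in Ioc s t, ENNReal.ofReal (mu G ω u x) ≠ ∞) :
    survival G ω x s t +
      ∫⁻ r in Ioc s t, survival G ω x s r * ENNReal.ofReal (mu G ω r x) = 1 :=
  exp_neg_add_lintegral_of_finite (hω.measurable_mu x).ennreal_ofReal
    (fun _ => ENNReal.ofReal_ne_top) hst hfin

/-- Decomposition of the walk at its last jump. -/
theorem IsWeight.jumpKernel_succ_eq_last (hω : IsWeight G ω) (t : ℝ) (y : V) (n : ℕ) (s : ℝ)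
    (x : V) : jumpKernel G ω t y (n + 1) s x =
      ∫⁻ r in Ioc s t, (∑ z ∈ G.neighborFinset y,
        jumpKernel G ω r z n s x * ENNReal.ofReal (ω r s(z, y))) * survival G ω y r t := by
  classical
  induction n generalizing s x with
  | zero =>
    rw [jumpKernel]
    refine lintegral_congr fun r => ?_
    simp only [jumpKernel, mul_ite, mul_zero, ite_mul, zero_mul, Finset.sum_ite_eq,
      Finset.sum_ite_eq', SimpleGraph.mem_neighborFinset, G.adj_comm y x]
    split_ifs
    · ring
    · simp
  | succ n ih =>
    rw [jumpKernel]
    -- With first jump at r and last jump at v, the induction hypothesis splits off v after the walk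
    -- restarts at r. Exchanging the two integrals over r < v and reassembling the first-jump
    -- expansion up to time v gives the claim.
    have hL : ∀ r, survival G ω x s r * ∑ z ∈ G.neighborFinset x, ENNReal.ofReal (ω r s(x, z)) *
        jumpKernel G ω t y (n + 1) r z = ∫⁻ v in Ioc r t, ∑ z ∈ G.neighborFinset x,
          ∑ z' ∈ G.neighborFinset y, survival G ω x s r * ENNReal.ofReal (ω r s(x, z)) *
            jumpKernel G ω v z' n r z * ENNReal.ofReal (ω v s(z', y)) * survival G ω y v t := by
      intro r
      have hm : ∀ z, ∀ z' ∈ G.neighborFinset y, Measurable fun v =>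
          jumpKernel G ω v z' n r z * ENNReal.ofReal (ω v s(z', y)) * survival G ω y v t := by
        intro z z' hz'
        refine Measurable.mul (Measurable.mul ?_ ?_) ?_
        · exact (hω.measurable_jumpKernel z' n z).comp (measurable_const.prodMk measurable_id)
        · exact (hω.measurable_of_adj ((G.mem_neighborFinset _ _).1 hz').symm).ennreal_ofReal
        · exact (hω.measurable_survival y).comp (measurable_id.prodMk measurable_const)
      rw [lintegral_finsetSum]
      · rw [Finset.mul_sum]
        refine Finset.sum_congr rfl fun z _ => ?_
        rw [ih, ← mul_assoc, ← lintegral_const_mul]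
        · refine lintegral_congr fun v => ?_
          rw [Finset.sum_mul, Finset.mul_sum]
          refine Finset.sum_congr rfl fun z' _ => ?_
          ring
        · simp only [Finset.sum_mul]
          exact Finset.measurable_fun_sum _ fun z' hz' => hm z z' hz'
      · intro z _
        refine Finset.measurable_fun_sum _ fun z' hz' => ?_
        have := (hm z z' hz').const_mul (survival G ω x s r * ENNReal.ofReal (ω r s(x, z)))
        simpa only [mul_assoc] using this
    simp only [hL]
    rw [lintegral_lintegral_triangle]
    · refine lintegral_congr fun v => ?_
      have hm : ∀ z ∈ G.neighborFinset x, ∀ z', Measurable fun r =>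
          survival G ω x s r * (ENNReal.ofReal (ω r s(x, z)) * jumpKernel G ω v z' n r z) := by
        intro z hz z'
        refine Measurable.mul ?_ (Measurable.mul ?_ ?_)
        · exact (hω.measurable_survival x).comp (measurable_const.prodMk measurable_id)
        · exact (hω.measurable_of_adj ((G.mem_neighborFinset _ _).1 hz)).ennreal_ofReal
        · exact (hω.measurable_jumpKernel z' n z).comp (measurable_id.prodMk measurable_const)
      have hm' : ∀ z', Measurable fun r => survival G ω x s r * ∑ z ∈ G.neighborFinset x,
          ENNReal.ofReal (ω r s(x, z)) * jumpKernel G ω v z' n r z := by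
        intro z'
        simp only [Finset.mul_sum]
        exact Finset.measurable_fun_sum _ fun z hz => hm z hz z'
      simp only [jumpKernel]
      rw [Finset.sum_mul]
      simp only [← lintegral_mul_const _ (hm' _)]
      simp only [← lintegral_mul_const _ ((hm' _).mul_const _)]
      rw [← lintegral_finsetSum]
      · refine lintegral_congr fun r => ?_
        rw [Finset.sum_comm]
        refine Finset.sum_congr rfl fun z' _ => ?_
        rw [Finset.mul_sum, Finset.sum_mul, Finset.sum_mul]
        refine Finset.sum_congr rfl fun z _ => ?_
        ring
      · intro z' _
        exact ((hm' z').mul_const _).mul_const _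
    · refine Finset.measurable_fun_sum _ fun z hz => Finset.measurable_fun_sum _ fun z' hz' => ?_
      refine Measurable.mul (Measurable.mul (Measurable.mul (Measurable.mul ?_ ?_) ?_) ?_) ?_
      · exact (hω.measurable_survival x).comp (measurable_const.prodMk measurable_fst)
      · exact (hω.measurable_of_adj ((G.mem_neighborFinset _ _).1 hz)).ennreal_ofReal.comp
          measurable_fst
      · exact (hω.measurable_jumpKernel z' n z)
      · exact (hω.measurable_of_adj ((G.mem_neighborFinset _ _).1 hz').symm).ennreal_ofReal.comp
          measurable_snd
      · exact (hω.measurable_survival y).comp (measurable_snd.prodMk measurable_const)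

theorem IsWeight.measurable_heatKernel (hω : IsWeight G ω) (s : ℝ) (x y : V) :
    Measurable fun t => heatKernel G ω s x t y :=
  Measurable.tsum fun n =>
    (hω.measurable_jumpKernel y n x).comp (measurable_const.prodMk measurable_id)

/-- Induction on the number of jumps: after the first jump the restarted walk has mass at most one,
so the total is at most the probability of staying plus that of jumping. Mass may be lost to
explosion, hence no equality. -/
theorem IsWeight.sum_sum_jumpKernel_le_one (hω : IsWeight G ω) (A : Finset V) (t : ℝ) (N : ℕ)
    (s : ℝ) (x : V) : ∑ y ∈ A, ∑ n ∈ Finset.range N, jumpKernel G ω t y n s x ≤ 1 := by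
  classical
  induction N generalizing s x with
  | zero => simp
  | succ N ih =>
    have hm : ∀ y n, Measurable fun r => survival G ω x s r * ∑ z ∈ G.neighborFinset x,
        ENNReal.ofReal (ω r s(x, z)) * jumpKernel G ω t y n r z := by
      intro y n
      refine Measurable.mul ?_ (Finset.measurable_fun_sum _ fun z hz => Measurable.mul ?_ ?_)
      · exact (hω.measurable_survival x).comp (measurable_const.prodMk measurable_id)
      · exact (hω.measurable_of_adj ((G.mem_neighborFinset _ _).1 hz)).ennreal_ofReal
      · exact (hω.measurable_jumpKernel y n z).comp (measurable_id.prodMk measurable_const)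
    simp only [Finset.sum_range_succ', Finset.sum_add_distrib]
    have h0 : ∑ y ∈ A, jumpKernel G ω t y 0 s x ≤ survival G ω x s t := by
      simp only [jumpKernel, Finset.sum_ite_eq]
      split_ifs <;> simp
    have h1 : ∑ y ∈ A, ∑ n ∈ Finset.range N, jumpKernel G ω t y (n + 1) s x ≤
        ∫⁻ r in Ioc s t, survival G ω x s r * ENNReal.ofReal (mu G ω r x) := by
      simp only [jumpKernel]
      simp only [← lintegral_finsetSum _ fun n _ => hm _ n]
      rw [← lintegral_finsetSum _ fun y _ => Finset.measurable_fun_sum _ fun n _ => hm y n]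
      refine lintegral_mono fun r => ?_
      simp only [← Finset.mul_sum]
      gcongr
      rw [hω.ofReal_mu]
      have : ∑ y ∈ A, ∑ n ∈ Finset.range N, ∑ z ∈ G.neighborFinset x,
          ENNReal.ofReal (ω r s(x, z)) * jumpKernel G ω t y n r z =
          ∑ z ∈ G.neighborFinset x, ENNReal.ofReal (ω r s(x, z)) *
            ∑ y ∈ A, ∑ n ∈ Finset.range N, jumpKernel G ω t y n r z := by
        simp only [Finset.mul_sum]
        rw [Finset.sum_comm (s := G.neighborFinset x)]
        refine Finset.sum_congr rfl fun y _ => ?_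
        rw [Finset.sum_comm]
      rw [this]
      refine Finset.sum_le_sum fun z _ => ?_
      exact mul_le_of_le_one_right' (ih r z)
    rw [add_comm]
    exact (add_le_add h0 h1).trans (hω.survival_add_lintegral_le x s t)

theorem IsWeight.sum_heatKernel_le_one (hω : IsWeight G ω) (A : Finset V) (s t : ℝ) (x : V) :
    ∑ y ∈ A, heatKernel G ω s x t y ≤ 1 := by
  have h : Filter.Tendsto (fun N => ∑ y ∈ A, ∑ n ∈ Finset.range N, jumpKernel G ω t y n s x)
      Filter.atTop (nhds (∑ y ∈ A, heatKernel G ω s x t y)) :=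
    tendsto_finsetSum _ fun y _ => ENNReal.tendsto_nat_tsum _
  exact le_of_tendsto' h fun N => hω.sum_sum_jumpKernel_le_one A t N s x

theorem IsWeight.heatKernel_le_one (hω : IsWeight G ω) (s t : ℝ) (x y : V) :
    heatKernel G ω s x t y ≤ 1 := by
  simpa using hω.sum_heatKernel_le_one {y} s t x

theorem IsWeight.heatKernel_eq_last (hω : IsWeight G ω) (t : ℝ) (y : V) (s : ℝ) (x : V) :
    heatKernel G ω s x t y = jumpKernel G ω t y 0 s x +
      ∫⁻ r in Ioc s t, (∑ z ∈ G.neighborFinset y,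
        heatKernel G ω s x r z * ENNReal.ofReal (ω r s(z, y))) * survival G ω y r t := by
  rw [heatKernel, tsum_eq_zero_add' ENNReal.summable]
  congr 1
  simp only [hω.jumpKernel_succ_eq_last]
  rw [← lintegral_tsum]
  · refine lintegral_congr fun r => ?_
    rw [ENNReal.tsum_mul_right, Summable.tsum_finsetSum fun _ _ => ENNReal.summable]
    simp only [ENNReal.tsum_mul_right, heatKernel]
  · intro n
    refine (Measurable.mul (Finset.measurable_fun_sum _ fun z hz => Measurable.mul ?_ ?_)
      ?_).aemeasurable
    · exact (hω.measurable_jumpKernel z n x).comp (measurable_const.prodMk measurable_id)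
    · exact (hω.measurable_of_adj ((G.mem_neighborFinset _ _).1 hz).symm).ennreal_ofReal
    · exact (hω.measurable_survival y).comp (measurable_id.prodMk measurable_const)

open Classical in
/-- The forward equation, in integrated form. -/
theorem IsWeight.heatKernel_add_lintegral (hω : IsWeight G ω) {s t : ℝ} (hst : s ≤ t) (x y : V)
    (hfin : ∫⁻ u in Ioc s t, ENNReal.ofReal (mu G ω u y) ≠ ∞) :
    heatKernel G ω s x t y +
        ∫⁻ v in Ioc s t, heatKernel G ω s x v y * ENNReal.ofReal (mu G ω v y) =
      (if x = y then 1 else 0) + ∫⁻ r in Ioc s t, ∑ z ∈ G.neighborFinset y,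
        heatKernel G ω s x r z * ENNReal.ofReal (ω r s(z, y)) := by
  set h : ℝ → ℝ≥0∞ := fun r => ∑ z ∈ G.neighborFinset y,
    heatKernel G ω s x r z * ENNReal.ofReal (ω r s(z, y)) with hh
  have hhm : Measurable h := Finset.measurable_fun_sum _ fun z hz =>
    (hω.measurable_heatKernel s x z).mul
      (hω.measurable_of_adj ((G.mem_neighborFinset _ _).1 hz).symm).ennreal_ofReal
  have hmu := (hω.measurable_mu y).ennreal_ofReal
  have hjm : Measurable fun v => jumpKernel G ω v y 0 s x :=
    (hω.measurable_jumpKernel y 0 x).comp (measurable_const.prodMk measurable_id)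
  have hu : ∀ v, heatKernel G ω s x v y = jumpKernel G ω v y 0 s x +
      ∫⁻ r in Ioc s v, h r * survival G ω y r v := fun v => hω.heatKernel_eq_last v y s x
  have hI : ∫⁻ v in Ioc s t, heatKernel G ω s x v y * ENNReal.ofReal (mu G ω v y) =
      (∫⁻ v in Ioc s t, jumpKernel G ω v y 0 s x * ENNReal.ofReal (mu G ω v y)) +
        ∫⁻ r in Ioc s t, h r * ∫⁻ v in Ioc r t, survival G ω y r v *
          ENNReal.ofReal (mu G ω v y) := by
    simp only [hu, add_mul]
    rw [lintegral_add_left (f := fun v => jumpKernel G ω v y 0 s x * ENNReal.ofReal (mu G ω v y))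
      (hjm.mul hmu)]
    congr 1
    have e1 : ∀ r, h r * ∫⁻ v in Ioc r t, survival G ω y r v * ENNReal.ofReal (mu G ω v y) =
        ∫⁻ v in Ioc r t, h r * (survival G ω y r v * ENNReal.ofReal (mu G ω v y)) := fun r => by
      rw [lintegral_const_mul]
      exact ((hω.measurable_survival y).comp (measurable_const.prodMk measurable_id)).mul hmu
    simp only [e1]
    rw [lintegral_lintegral_triangle]
    · refine lintegral_congr fun v => ?_
      rw [← lintegral_mul_const]
      · simp only [mul_assoc]
      · exact hhm.mul ((hω.measurable_survival y).comp (measurable_id.prodMk measurable_const))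
    · exact (hhm.comp measurable_fst).mul ((hω.measurable_survival y).mul
        (hmu.comp measurable_snd))
  have h0 : jumpKernel G ω t y 0 s x +
      ∫⁻ v in Ioc s t, jumpKernel G ω v y 0 s x * ENNReal.ofReal (mu G ω v y) =
        if x = y then 1 else 0 := by
    simp only [jumpKernel]
    split_ifs with hxy
    · subst hxy; exact hω.survival_add_lintegral x hst hfin
    · simp
  -- Mass arriving at y at time r either stays until t or leaves at some v in (r, t]; integrability
  -- of μ at y makes the two probabilities add up to one.
  have h1 : (∫⁻ r in Ioc s t, h r * survival G ω y r t) +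
      ∫⁻ r in Ioc s t, h r * ∫⁻ v in Ioc r t, survival G ω y r v * ENNReal.ofReal (mu G ω v y) =
        ∫⁻ r in Ioc s t, h r := by
    rw [← lintegral_add_left]
    · refine setLIntegral_congr_fun measurableSet_Ioc fun r hr => ?_
      rw [← mul_add, hω.survival_add_lintegral y hr.2, mul_one]
      exact ne_top_of_le_ne_top hfin (lintegral_mono_set (Ioc_subset_Ioc_left hr.1.le))
    · exact hhm.mul ((hω.measurable_survival y).comp (measurable_id.prodMk measurable_const))
  rw [hI, hu t, ← h0, ← h1]
  ring

/-- The heat kernel as a real function of its endpoint. -/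
noncomputable def realKernel (G : SimpleGraph V) [G.LocallyFinite] (ω : ℝ → Sym2 V → ℝ) (s : ℝ)
    (x y : V) (t : ℝ) : ℝ := (heatKernel G ω s x t y).toReal

theorem realKernel_nonneg (s : ℝ) (x y : V) (t : ℝ) : 0 ≤ realKernel G ω s x y t :=
  ENNReal.toReal_nonneg

theorem IsWeight.ofReal_realKernel (hω : IsWeight G ω) (s : ℝ) (x y : V) (t : ℝ) :
    ENNReal.ofReal (realKernel G ω s x y t) = heatKernel G ω s x t y :=
  ENNReal.ofReal_toReal (ne_top_of_le_ne_top ENNReal.one_ne_top (hω.heatKernel_le_one s t x y))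

theorem IsWeight.realKernel_le_one (hω : IsWeight G ω) (s : ℝ) (x y : V) (t : ℝ) :
    realKernel G ω s x y t ≤ 1 := by
  have := hω.heatKernel_le_one s t x y
  rw [← hω.ofReal_realKernel] at this
  exact ENNReal.ofReal_le_one.1 this

theorem IsWeight.sum_realKernel_le_one (hω : IsWeight G ω) (A : Finset V) (s : ℝ) (x : V) (t : ℝ) :
    ∑ y ∈ A, realKernel G ω s x y t ≤ 1 := by
  have := hω.sum_heatKernel_le_one A s t x
  simp only [← hω.ofReal_realKernel] at this
  rw [← ENNReal.ofReal_sum_of_nonneg fun _ _ => realKernel_nonneg _ _ _ _] at this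
  exact ENNReal.ofReal_le_one.1 this

theorem IsWeight.measurable_realKernel (hω : IsWeight G ω) (s : ℝ) (x y : V) :
    Measurable (realKernel G ω s x y) :=
  (hω.measurable_heatKernel s x y).ennreal_toReal

/-- The generator applied to a function `u` of space and time, evaluated at `x`. -/
def generator (G : SimpleGraph V) [G.LocallyFinite] (ω : ℝ → Sym2 V → ℝ) (u : V → ℝ → ℝ) (x : V)
    (t : ℝ) : ℝ := ∑ y ∈ G.neighborFinset x, ω t s(x, y) * (u y t - u x t)

/-- Differences of u are at most one in absolute value, so each summand is dominated by μ. -/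
theorem IsWeight.integrableOn_generator (hω : IsWeight G ω) {u : V → ℝ → ℝ}
    (hum : ∀ x, Measurable (u x)) (hu0 : ∀ x t, 0 ≤ u x t) (hu1 : ∀ x t, u x t ≤ 1) {y : V}
    {S : Set ℝ} (hmu : IntegrableOn (fun v => mu G ω v y) S) :
    IntegrableOn (generator G ω u y) S := by
  refine integrable_finsetSum _ fun z hz => ?_
  have hadj := (G.mem_neighborFinset _ _).1 hz
  refine hmu.mono' ?_ (Filter.Eventually.of_forall fun v => ?_)
  · exact ((hω.measurable_of_adj hadj).mul ((hum z).sub (hum y))).aestronglyMeasurable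
  · have h1 := hω.le_mu hadj v
    have h2 := hω.pos_of_adj hadj v
    rw [Real.norm_eq_abs, abs_mul, abs_of_pos h2]
    have h3 : |u z v - u y v| ≤ 1 := by
      rw [abs_le]; constructor <;> linarith [hu0 z v, hu1 z v, hu0 y v, hu1 y v]
    nlinarith

/-- Integrability of μ at y alone makes gain and loss in `IsWeight.heatKernel_add_lintegral` finite,
since the weight of each edge at y is at most μ there. They may then be subtracted; symmetry of the
edge weights turns their difference into the generator. -/
theorem IsWeight.realKernel_eq_add_integral (hω : IsWeight G ω) {s T : ℝ} (x y : V)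
    (hmu : IntegrableOn (fun v => mu G ω v y) (Ioc s T)) {a b : ℝ} (hsa : s ≤ a) (hab : a ≤ b)
    (hbT : b ≤ T) :
    realKernel G ω s x y b = realKernel G ω s x y a +
      ∫ v in a..b, generator G ω (fun y => realKernel G ω s x y) y v := by
  classical
  set u := fun y => realKernel G ω s x y with hu
  have hg := hω.integrableOn_generator (u := u) (fun z => hω.measurable_realKernel s x z)
    (fun z t => realKernel_nonneg s x z t) (fun z t => hω.realKernel_le_one s x z t) hmu
  have key : ∀ t ∈ Icc s T, u y t = (if x = y then 1 else 0) +
      ∫ v in s..t, generator G ω u y v := by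
    intro t ht
    have hmut : IntegrableOn (fun v => mu G ω v y) (Ioc s t) :=
      hmu.mono_set (Ioc_subset_Ioc_right ht.2)
    have hfin : ∫⁻ v in Ioc s t, ENNReal.ofReal (mu G ω v y) ≠ ∞ :=
      hmut.lintegral_lt_top.ne
    have h := hω.heatKernel_add_lintegral ht.1 x y hfin
    have i1 : IntegrableOn (fun v => u y v * mu G ω v y) (Ioc s t) := by
      refine hmut.mono' ?_ (Filter.Eventually.of_forall fun v => ?_)
      · exact ((hω.measurable_realKernel s x y).mul (hω.measurable_mu y)).aestronglyMeasurable
      · have := hω.mu_nonneg v y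
        rw [Real.norm_eq_abs, abs_mul, abs_of_nonneg (realKernel_nonneg s x y v), abs_of_nonneg this]
        exact mul_le_of_le_one_left this (hω.realKernel_le_one s x y v)
    have i2 : IntegrableOn (fun v => ∑ z ∈ G.neighborFinset y, u z v * ω v s(z, y)) (Ioc s t) := by
      refine integrable_finsetSum _ fun z hz => ?_
      have hadj := (G.mem_neighborFinset _ _).1 hz
      refine hmut.mono' ?_ (Filter.Eventually.of_forall fun v => ?_)
      · exact ((hω.measurable_realKernel s x z).mul
          (hω.measurable_of_adj hadj.symm)).aestronglyMeasurable
      · have h1 := hω.le_mu hadj v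
        have h2 := hω.pos_of_adj hadj v
        rw [Sym2.eq_swap, Real.norm_eq_abs, abs_mul, abs_of_pos h2,
          abs_of_nonneg (realKernel_nonneg s x z v)]
        nlinarith [hω.realKernel_le_one s x z v, realKernel_nonneg (G := G) (ω := ω) s x z v]
    have e1 : ∫⁻ v in Ioc s t, heatKernel G ω s x v y * ENNReal.ofReal (mu G ω v y) =
        ENNReal.ofReal (∫ v in Ioc s t, u y v * mu G ω v y) := by
      rw [ofReal_integral_eq_lintegral_ofReal i1]
      · refine lintegral_congr fun v => ?_
        rw [ENNReal.ofReal_mul (realKernel_nonneg s x y v), hω.ofReal_realKernel]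
      · exact Filter.Eventually.of_forall fun v =>
          mul_nonneg (realKernel_nonneg s x y v) (hω.mu_nonneg v y)
    have e2 : ∫⁻ v in Ioc s t, ∑ z ∈ G.neighborFinset y,
        heatKernel G ω s x v z * ENNReal.ofReal (ω v s(z, y)) =
        ENNReal.ofReal (∫ v in Ioc s t, ∑ z ∈ G.neighborFinset y, u z v * ω v s(z, y)) := by
      have hnn : ∀ v, ∀ z ∈ G.neighborFinset y, 0 ≤ u z v * ω v s(z, y) := fun v z hz =>
        mul_nonneg (realKernel_nonneg s x z v)
          (hω.pos_of_adj ((G.mem_neighborFinset _ _).1 hz).symm v).le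
      rw [ofReal_integral_eq_lintegral_ofReal i2]
      · refine lintegral_congr fun v => ?_
        rw [ENNReal.ofReal_sum_of_nonneg (hnn v)]
        refine Finset.sum_congr rfl fun z _ => ?_
        rw [ENNReal.ofReal_mul (realKernel_nonneg s x z v), hω.ofReal_realKernel]
      · exact Filter.Eventually.of_forall fun v => Finset.sum_nonneg (hnn v)
    rw [e1, e2, ← hω.ofReal_realKernel] at h
    have h' := congrArg ENNReal.toReal h
    have n1 : 0 ≤ ∫ v in Ioc s t, u y v * mu G ω v y :=
      integral_nonneg fun v => mul_nonneg (realKernel_nonneg s x y v) (hω.mu_nonneg v y)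
    have n2 : 0 ≤ ∫ v in Ioc s t, ∑ z ∈ G.neighborFinset y, u z v * ω v s(z, y) :=
      integral_nonneg fun v => Finset.sum_nonneg fun z hz =>
        mul_nonneg (realKernel_nonneg s x z v)
          (hω.pos_of_adj ((G.mem_neighborFinset _ _).1 hz).symm v).le
    rw [ENNReal.toReal_add ENNReal.ofReal_ne_top ENNReal.ofReal_ne_top,
      ENNReal.toReal_add (by split_ifs <;> simp) ENNReal.ofReal_ne_top,
      ENNReal.toReal_ofReal (realKernel_nonneg s x y t), ENNReal.toReal_ofReal n1,
      ENNReal.toReal_ofReal n2] at h'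
    have e3 : ∫ v in s..t, generator G ω u y v =
        (∫ v in Ioc s t, ∑ z ∈ G.neighborFinset y, u z v * ω v s(z, y)) -
          ∫ v in Ioc s t, u y v * mu G ω v y := by
      rw [intervalIntegral.integral_of_le ht.1, ← integral_sub i2 i1]
      refine integral_congr_ae (Filter.Eventually.of_forall fun v => ?_)
      simp only [generator, mu, Finset.mul_sum, ← Finset.sum_sub_distrib]
      refine Finset.sum_congr rfl fun z _ => ?_
      rw [Sym2.eq_swap]; ring
    rw [e3]
    have h3 : (if x = y then (1 : ℝ≥0∞) else 0).toReal = if x = y then 1 else 0 := by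
      split_ifs <;> simp
    rw [h3] at h'
    change u y t + _ = _ at h'
    linarith
  have hi : ∀ c d, s ≤ c → c ≤ d → d ≤ T → IntervalIntegrable (generator G ω u y) volume c d :=
    fun c d hc hcd hd => by
      rw [intervalIntegrable_iff_integrableOn_Ioc_of_le hcd]
      exact hg.mono_set (Ioc_subset_Ioc hc hd)
  have h1 := key a ⟨hsa, hab.trans hbT⟩
  have h2 := key b ⟨hsa.trans hab, hbT⟩
  have h3 := intervalIntegral.integral_add_adjacent_intervals (hi s a le_rfl hsa (hab.trans hbT))
    (hi a b hsa hab hbT)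
  change u y b = u y a + _
  rw [h1, h2, ← h3]; ring

end Kernel

/-! ### Energy inequality for the excess over a barrier -/

section Energy

variable {V : Type*} {G : SimpleGraph V} [G.LocallyFinite] {ω : ℝ → Sym2 V → ℝ}

open Classical in
/-- The excess `(f - β)₊` of `f` over the barrier `β`, restricted to `D`. -/
noncomputable def excess (D : Finset V) (f β : V → ℝ) (x : V) : ℝ :=
  if x ∈ D then max (f x - β x) 0 else 0

/-- The directed Dirichlet energy `∑_{x ∈ D} ∑_{y ∼ x} ω_t(x,y) (w x - w y)²`. -/
def energy (G : SimpleGraph V) [G.LocallyFinite] (ω : ℝ → Sym2 V → ℝ) (D : Finset V) (t : ℝ)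
    (w : V → ℝ) : ℝ := ∑ x ∈ D, ∑ y ∈ G.neighborFinset x, ω t s(x, y) * (w x - w y) ^ 2

theorem excess_nonneg (D : Finset V) (f β : V → ℝ) (x : V) : 0 ≤ excess D f β x := by
  unfold excess; split_ifs <;> simp

theorem excess_of_notMem {D : Finset V} {f β : V → ℝ} {x : V} (h : x ∉ D) :
    excess D f β x = 0 := if_neg h

theorem excess_of_mem {D : Finset V} {f β : V → ℝ} {x : V} (h : x ∈ D) :
    excess D f β x = max (f x - β x) 0 := if_pos h

/-- Caccioppoli's inequality at a fixed time: the generator tested against the excess over a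
barrier with `|β x - β y| ≤ L` along edges. -/
theorem IsWeight.sum_excess_mul_generator_le (hω : IsWeight G ω) {B D : Finset V} (hDB : D ⊆ B)
    (hnbr : ∀ x ∈ D, ∀ y, G.Adj x y → y ∈ B) (t : ℝ) {f β : V → ℝ} {L : ℝ}
    (hβ : ∀ x y, G.Adj x y → |β x - β y| ≤ L)
    (hout : ∀ x ∈ D, ∀ y, G.Adj x y → y ∉ D → f y ≤ β y) :
    ∑ x ∈ D, excess D f β x * ∑ y ∈ G.neighborFinset x, ω t s(x, y) * (f y - f x) ≤
      -(1 / 4) * energy G ω D t (excess D f β) +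
        L ^ 2 / 2 * ∑ x ∈ D with 0 < excess D f β x, mu G ω t x := by
  classical
  set w := excess D f β with hw
  set a : V → V → ℝ := fun x y => if G.Adj x y then ω t s(x, y) else 0 with ha
  set χ : V → ℝ := fun x => if 0 < w x then 1 else 0 with hχ
  have ha0 : ∀ x y, 0 ≤ a x y := fun x y => by
    simp only [ha]; split_ifs with h
    · exact (hω.pos_of_adj h t).le
    · exact le_rfl
  have hasymm : ∀ x y, a x y = a y x := fun x y => by
    simp only [ha, G.adj_comm x y, Sym2.eq_swap (a := x)]
  have hw0 : ∀ x, 0 ≤ w x := excess_nonneg D f β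
  have hsum : ∀ x ∈ D, ∀ F : V → ℝ, ∑ y ∈ G.neighborFinset x, ω t s(x, y) * F y =
      ∑ y ∈ B, a x y * F y := by
    intro x hx F
    rw [← Finset.sum_subset (s₁ := G.neighborFinset x) (s₂ := B) (f := fun y => a x y * F y)]
    · refine Finset.sum_congr rfl fun y hy => ?_
      simp only [ha, if_pos ((G.mem_neighborFinset _ _).1 hy)]
    · exact fun y hy => hnbr x hx y ((G.mem_neighborFinset _ _).1 hy)
    · intro y _ hy
      rw [G.mem_neighborFinset] at hy
      simp [ha, hy]
  have hsymm : ∀ F : V → V → ℝ, ∑ x ∈ B, ∑ y ∈ B, F x y =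
      ∑ x ∈ B, ∑ y ∈ B, (F x y + F y x) / 2 := by
    intro F
    have h1 : ∑ x ∈ B, ∑ y ∈ B, F y x = ∑ x ∈ B, ∑ y ∈ B, F x y := Finset.sum_comm
    have h2 : ∑ x ∈ B, ∑ y ∈ B, (F x y + F y x) / 2 =
        (∑ x ∈ B, ∑ y ∈ B, F x y + ∑ x ∈ B, ∑ y ∈ B, F y x) / 2 := by
      simp only [← Finset.sum_add_distrib, Finset.sum_div]
    rw [h2, h1]; ring
  have hleft : ∑ x ∈ D, w x * ∑ y ∈ G.neighborFinset x, ω t s(x, y) * (f y - f x) ≤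
      ∑ x ∈ B, ∑ y ∈ B, a x y * (w x * ((w y - w x) + (β y - β x))) := by
    rw [← Finset.sum_subset hDB (f := fun x => ∑ y ∈ B, a x y * (w x * ((w y - w x) + (β y - β x))))]
    · refine Finset.sum_le_sum fun x hx => ?_
      rw [hsum x hx fun y => f y - f x, Finset.mul_sum]
      refine Finset.sum_le_sum fun y _ => ?_
      by_cases hadj : G.Adj x y
      swap
      · simp [ha, hadj]
      -- Where w x > 0, f x = w x + β x exactly, while f y ≤ w y + β y always. For neighbours
      -- outside D this last bound is the outer boundary condition, so extending w by zero costs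
      -- nothing.
      have key : w x * (f y - f x) ≤ w x * ((w y - w x) + (β y - β x)) := by
        rcases (hw0 x).eq_or_lt with h0 | h0
        · simp [← h0]
        · refine mul_le_mul_of_nonneg_left ?_ h0.le
          have hx1 : w x = f x - β x := by
            rw [hw, excess_of_mem hx] at h0 ⊢
            rcases max_cases (f x - β x) 0 with h | h
            · exact h.1
            · rw [h.1] at h0; exact absurd h0 (lt_irrefl _)
          have hy1 : f y - β y ≤ w y := by
            by_cases hy : y ∈ D
            · rw [hw, excess_of_mem hy]; exact le_max_left _ _
            · have := hout x hx y hadj hy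
              linarith [hw0 y]
          linarith
      calc w x * (a x y * (f y - f x)) = a x y * (w x * (f y - f x)) := by ring
        _ ≤ _ := mul_le_mul_of_nonneg_left key (ha0 x y)
    · intro x _ hx
      simp [hw, excess_of_notMem hx]
  have hmid : ∑ x ∈ B, ∑ y ∈ B, a x y * (w x * ((w y - w x) + (β y - β x))) ≤
      ∑ x ∈ B, ∑ y ∈ B, (-(1 / 4) * (a x y * (w x - w y) ^ 2) + L ^ 2 / 2 * (a x y * χ x)) := by
    rw [hsymm, hsymm fun x y => -(1 / 4) * (a x y * (w x - w y) ^ 2) + L ^ 2 / 2 * (a x y * χ x)]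
    refine Finset.sum_le_sum fun x _ => Finset.sum_le_sum fun y _ => ?_
    simp only [hasymm y x]
    by_cases hadj : G.Adj x y
    swap
    · simp [ha, hadj]
    have hb : (β x - β y) ^ 2 ≤ L ^ 2 := by
      rw [← sq_abs]; exact pow_le_pow_left₀ (abs_nonneg _) (hβ x y hadj) 2
    -- Young's inequality is spent only on edges with an endpoint in {w > 0}. Half of the squared
    -- gradient is absorbed, which together with the symmetrization leaves the factor 1/4.
    have hsq : (w x - w y) * (β y - β x) ≤ (w x - w y) ^ 2 / 2 + L ^ 2 / 2 * (χ x + χ y) := by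
      have hχ0 : ∀ z, 0 ≤ χ z := fun z => by simp only [hχ]; split_ifs <;> norm_num
      by_cases h : 0 < w x ∨ 0 < w y
      · have h1 : 1 ≤ χ x + χ y := by
          rcases h with h | h
          · have : χ x = 1 := if_pos h
            linarith [hχ0 y]
          · have : χ y = 1 := if_pos h
            linarith [hχ0 x]
        nlinarith [sq_nonneg ((w x - w y) - (β y - β x)), sq_nonneg L]
      · push Not at h
        rw [le_antisymm h.1 (hw0 x), le_antisymm h.2 (hw0 y)]
        have := hχ0 x
        have := hχ0 y
        norm_num
        positivity
    have := mul_le_mul_of_nonneg_left hsq (ha0 x y)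
    nlinarith [this]
  refine hleft.trans (hmid.trans ?_)
  simp only [Finset.sum_add_distrib, ← Finset.mul_sum]
  have h1 : energy G ω D t w ≤ ∑ x ∈ B, ∑ y ∈ B, a x y * (w x - w y) ^ 2 := by
    rw [energy, Finset.sum_congr rfl fun x hx => hsum x hx fun y => (w x - w y) ^ 2]
    exact Finset.sum_le_sum_of_subset_of_nonneg hDB fun x _ _ =>
      Finset.sum_nonneg fun y _ => mul_nonneg (ha0 x y) (sq_nonneg _)
  have h2 : ∑ x ∈ B, ∑ y ∈ B, a x y * χ x = ∑ x ∈ D with 0 < w x, mu G ω t x := by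
    rw [Finset.sum_filter, ← Finset.sum_subset hDB]
    · refine Finset.sum_congr rfl fun x hx => ?_
      rw [← hsum x hx fun _ => χ x, ← Finset.sum_mul]
      simp only [hχ, mul_ite, mul_one, mul_zero]; rfl
    · intro x _ hx
      simp [hχ, hw, excess_of_notMem hx]
  rw [h2]
  linarith

theorem measurable_excess {D : Finset V} {u β : V → ℝ → ℝ} (hu : ∀ x, Measurable (u x))
    (hβ : ∀ x, Measurable (β x)) (x : V) :
    Measurable fun t => excess D (fun x => u x t) (fun x => β x t) x := by
  unfold excess
  split_ifs
  · exact ((hu x).sub (hβ x)).max measurable_const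
  · exact measurable_const

theorem IsWeight.measurable_energy (hω : IsWeight G ω) (D : Finset V) {w : V → ℝ → ℝ}
    (hw : ∀ x, Measurable (w x)) : Measurable fun t => energy G ω D t fun x => w x t :=
  Finset.measurable_fun_sum _ fun x _ => Finset.measurable_fun_sum _ fun y hy =>
    (hω.measurable_of_adj ((G.mem_neighborFinset _ _).1 hy)).mul (((hw x).sub (hw y)).pow_const 2)

theorem IsWeight.energy_nonneg (hω : IsWeight G ω) (D : Finset V) (t : ℝ) (w : V → ℝ) :
    0 ≤ energy G ω D t w :=
  Finset.sum_nonneg fun _ _ => Finset.sum_nonneg fun _ hy =>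
    mul_nonneg (hω.pos_of_adj ((G.mem_neighborFinset _ _).1 hy) t).le (sq_nonneg _)

/-- The parabolic energy inequality for the excess of a solution over the barrier
`b x + c (τ₀ - t)`, started from zero excess. -/
theorem IsWeight.excess_energy_le (hω : IsWeight G ω) {B D : Finset V} (hDB : D ⊆ B)
    (hnbr : ∀ x ∈ D, ∀ y, G.Adj x y → y ∈ B) {u : V → ℝ → ℝ} (hum : ∀ x, Measurable (u x))
    (hu0 : ∀ x t, 0 ≤ u x t) (hu1 : ∀ x t, u x t ≤ 1) {τ₁ τ₀ : ℝ}
    (hmu : ∀ x ∈ D, IntegrableOn (fun v => mu G ω v x) (Ioc τ₁ τ₀))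
    (hsol : ∀ x ∈ D, ∀ t ∈ Icc τ₁ τ₀, u x t = u x τ₁ + ∫ v in τ₁..t, generator G ω u x v)
    {b : V → ℝ} {c L H : ℝ} (hc : 0 ≤ c) (hb : ∀ x y, G.Adj x y → |b x - b y| ≤ L)
    {w : V → ℝ → ℝ}
    (hw : w = fun x t => excess D (fun x => u x t) (fun x => b x + c * (τ₀ - t)) x)
    (hout : ∀ x ∈ D, ∀ y, G.Adj x y → y ∉ D → ∀ t ∈ Icc τ₁ τ₀, u y t ≤ b y + c * (τ₀ - t))
    (hwH : ∀ x, ∀ t ∈ Icc τ₁ τ₀, w x t ≤ H) (hstart : ∀ x, w x τ₁ = 0)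
    {t : ℝ} (ht : t ∈ Icc τ₁ τ₀) :
    ENNReal.ofReal (∑ x ∈ D, w x t ^ 2) ≤ 2 * (ENNReal.ofReal (L ^ 2 / 2 + c * H) *
        ∫⁻ v in Ioc τ₁ τ₀, ∑ x ∈ D with 0 < w x v, ENNReal.ofReal (max 1 (mu G ω v x))) ∧
      ∫⁻ v in Ioc τ₁ t, ENNReal.ofReal (energy G ω D v fun x => w x v) ≤
        4 * (ENNReal.ofReal (L ^ 2 / 2 + c * H) *
        ∫⁻ v in Ioc τ₁ τ₀, ∑ x ∈ D with 0 < w x v, ENNReal.ofReal (max 1 (mu G ω v x))) := by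
  classical
  have hτ : τ₁ ≤ τ₀ := ht.1.trans ht.2
  have hwm : ∀ x, Measurable (w x) := fun x => by
    rw [hw]; exact measurable_excess hum (β := fun x t => b x + c * (τ₀ - t)) (by fun_prop) x
  have hw0 : ∀ x t, 0 ≤ w x t := fun x t => by rw [hw]; exact excess_nonneg _ _ _ _
  have hH0 : ∀ x : V, 0 ≤ H := fun x => (hw0 x τ₁).trans (hwH x τ₁ ⟨le_rfl, hτ⟩)
  have hgen : ∀ x ∈ D, IntegrableOn (generator G ω u x) (Ioc τ₁ τ₀) := fun x hx =>
    hω.integrableOn_generator hum hu0 hu1 (hmu x hx)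
  have hii : ∀ {F : ℝ → ℝ}, IntegrableOn F (Ioc τ₁ τ₀) → IntervalIntegrable F volume τ₁ t :=
    fun hF => (intervalIntegrable_iff_integrableOn_Ioc_of_le ht.1).2
      (hF.mono_set (Ioc_subset_Ioc_right ht.2))
  have hconst : IntegrableOn (fun _ : ℝ => c) (Ioc τ₁ τ₀) := integrableOn_const (by simp)
  have hone : IntegrableOn (fun _ : ℝ => (1 : ℝ)) (Ioc τ₁ τ₀) := integrableOn_const (by simp)
  have hbd : ∀ x, ∀ v ∈ Ioc τ₁ τ₀, w x v ≤ H := fun x v hv => hwH x v ⟨hv.1.le, hv.2⟩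
  -- the two integrands
  have hE : IntegrableOn (fun v => energy G ω D v fun x => w x v) (Ioc τ₁ τ₀) := by
    refine integrable_finsetSum _ fun x hx => integrable_finsetSum _ fun y hy => ?_
    have hadj := (G.mem_neighborFinset _ _).1 hy
    refine ((hmu x hx).const_mul (H ^ 2)).mono' ?_ ?_
    · exact ((hω.measurable_of_adj hadj).mul
        (((hwm x).sub (hwm y)).pow_const 2)).aestronglyMeasurable
    · refine (ae_restrict_iff' measurableSet_Ioc).2 (Filter.Eventually.of_forall fun v hv => ?_)
      have h1 := hω.le_mu hadj v
      have h2 := hω.pos_of_adj hadj v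
      rw [Real.norm_eq_abs, abs_of_nonneg (mul_nonneg h2.le (sq_nonneg _)), mul_comm]
      refine mul_le_mul ?_ h1 h2.le (sq_nonneg _)
      exact sq_le_sq' (by linarith [hw0 x v, hbd y v hv]) (by linarith [hw0 y v, hbd x v hv])
  have hR : IntegrableOn (fun v => ∑ x ∈ D with 0 < w x v, max 1 (mu G ω v x)) (Ioc τ₁ τ₀) := by
    simp only [Finset.sum_filter]
    refine integrable_finsetSum _ fun x hx => ?_
    have : (fun v => if 0 < w x v then max 1 (mu G ω v x) else 0) =
        {v | 0 < w x v}.indicator fun v => max 1 (mu G ω v x) := by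
      ext v; simp [indicator]
    rw [this]
    exact (hone.sup (hmu x hx)).indicator (measurableSet_lt measurable_const (hwm x))
  have hwg : ∀ x ∈ D, IntegrableOn (fun v => w x v * (generator G ω u x v + c)) (Ioc τ₁ τ₀) := by
    intro x hx
    refine Integrable.bdd_mul (c := H) ((hgen x hx).add hconst) (hwm x).aestronglyMeasurable ?_
    refine (ae_restrict_iff' measurableSet_Ioc).2 (Filter.Eventually.of_forall fun v hv => ?_)
    rw [Real.norm_eq_abs, abs_of_nonneg (hw0 x v)]
    exact hbd x v hv
  have hchain : ∀ x ∈ D, w x t ^ 2 / 2 = ∫ v in τ₁..t, w x v * (generator G ω u x v + c) := by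
    intro x hx
    set F : ℝ → ℝ := fun v => u x v - (b x + c * (τ₀ - v)) with hF
    have hwF : ∀ v, w x v = max (F v) 0 := fun v => by rw [hw]; exact excess_of_mem hx
    have h := integral_comp_mul_of_eq_integral (f := F) (g := fun v => generator G ω u x v + c)
      (φ := fun x : ℝ => (max x 0) ^ 2 / 2) (φ' := fun x => max x 0) ht.1
      (hii ((hgen x hx).add hconst)) (fun v hv => by
        have hvI : v ∈ Icc τ₁ τ₀ := ⟨hv.1, hv.2.trans ht.2⟩
        have hi : IntervalIntegrable (generator G ω u x) volume τ₁ v :=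
          (intervalIntegrable_iff_integrableOn_Ioc_of_le hv.1).2
            ((hgen x hx).mono_set (Ioc_subset_Ioc_right hvI.2))
        rw [intervalIntegral.integral_add hi intervalIntegrable_const, hF]
        simp only [intervalIntegral.integral_const, smul_eq_mul]
        rw [hsol x hx v hvI]; ring) hasDerivAt_half_sq_max (by fun_prop)
    simp only [← hwF] at h
    rw [← h, hstart]; norm_num
  have hmain : ∑ x ∈ D, w x t ^ 2 / 2 +
      1 / 4 * ∫ v in τ₁..t, energy G ω D v (fun x => w x v) ≤
        (L ^ 2 / 2 + c * H) * ∫ v in τ₁..t, ∑ x ∈ D with 0 < w x v, max 1 (mu G ω v x) := by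
    rw [Finset.sum_congr rfl hchain, ← intervalIntegral.integral_finsetSum fun x hx => hii (hwg x hx),
      ← intervalIntegral.integral_const_mul, ← intervalIntegral.integral_const_mul,
      ← intervalIntegral.integral_add (hii (integrable_finsetSum _ hwg)) (hii (hE.const_mul _))]
    refine intervalIntegral.integral_mono_on ht.1
      (hii ((integrable_finsetSum _ hwg).add (hE.const_mul _))) (hii (hR.const_mul _)) ?_
    intro v hv
    have hvI : v ∈ Icc τ₁ τ₀ := ⟨hv.1, hv.2.trans ht.2⟩
    have h := hω.sum_excess_mul_generator_le hDB hnbr v (f := fun x => u x v)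
      (β := fun x => b x + c * (τ₀ - v)) (L := L) (fun x y hxy => by simpa using hb x y hxy)
      (fun x hx y hxy hy => hout x hx y hxy hy v hvI)
    have hwv : (fun x => w x v) = excess D (fun x => u x v) (fun x => b x + c * (τ₀ - v)) := by
      rw [hw]
    simp only [← hwv] at h
    -- The slope c of the barrier in time contributes a source c·w, again supported where w > 0. It
    -- joins the gradient term because μ and 1 are both below 1 ∨ μ.
    have h2 : ∑ x ∈ D, w x v * c ≤ ∑ x ∈ D with 0 < w x v, c * H := by
      rw [Finset.sum_filter]
      refine Finset.sum_le_sum fun x _ => ?_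
      split_ifs with h0
      · rw [mul_comm]; exact mul_le_mul_of_nonneg_left (hwH x v hvI) hc
      · rw [le_antisymm (not_lt.1 h0) (hw0 x v)]; simp
    have h3 : ∑ x ∈ D with 0 < w x v, (L ^ 2 / 2 * mu G ω v x + c * H) ≤
        (L ^ 2 / 2 + c * H) * ∑ x ∈ D with 0 < w x v, max 1 (mu G ω v x) := by
      rw [Finset.mul_sum]
      refine Finset.sum_le_sum fun x _ => ?_
      have e1 := le_max_left 1 (mu G ω v x)
      have e2 := le_max_right 1 (mu G ω v x)
      nlinarith [mul_nonneg hc (hH0 x), sq_nonneg L]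
    rw [Finset.sum_add_distrib, ← Finset.mul_sum] at h3
    simp only [mul_add, Finset.sum_add_distrib]
    simp only [generator]
    linarith
  have hsq : 0 ≤ ∑ x ∈ D, w x t ^ 2 / 2 := Finset.sum_nonneg fun x _ => by positivity
  have hEn : 0 ≤ ∫ v in τ₁..t, energy G ω D v (fun x => w x v) :=
    intervalIntegral.integral_nonneg ht.1 fun v _ => hω.energy_nonneg D v _
  have hRE : (L ^ 2 / 2 + c * H) * ∫ v in τ₁..t, ∑ x ∈ D with 0 < w x v, max 1 (mu G ω v x) ≤
      (L ^ 2 / 2 + c * H) * ∫ v in τ₁..τ₀, ∑ x ∈ D with 0 < w x v, max 1 (mu G ω v x) := by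
    rcases D.eq_empty_or_nonempty with rfl | ⟨x, hx⟩
    · simp
    refine mul_le_mul_of_nonneg_left ?_ (by have := hH0 x; positivity)
    rw [intervalIntegral.integral_of_le ht.1, intervalIntegral.integral_of_le hτ]
    refine setIntegral_mono_set hR (Filter.Eventually.of_forall fun v => ?_)
      (Ioc_subset_Ioc_right ht.2).eventuallyLE
    exact Finset.sum_nonneg fun x _ => zero_le_one.trans (le_max_left _ _)
  have hconv : ENNReal.ofReal ((L ^ 2 / 2 + c * H) *
      ∫ v in τ₁..τ₀, ∑ x ∈ D with 0 < w x v, max 1 (mu G ω v x)) ≤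
      ENNReal.ofReal (L ^ 2 / 2 + c * H) *
        ∫⁻ v in Ioc τ₁ τ₀, ∑ x ∈ D with 0 < w x v, ENNReal.ofReal (max 1 (mu G ω v x)) := by
    rw [ENNReal.ofReal_mul' (intervalIntegral.integral_nonneg hτ fun v _ =>
      Finset.sum_nonneg fun x _ => zero_le_one.trans (le_max_left _ _)),
      intervalIntegral.integral_of_le hτ, ofReal_integral_eq_lintegral_ofReal hR
        (Filter.Eventually.of_forall fun v =>
          Finset.sum_nonneg fun x _ => zero_le_one.trans (le_max_left _ _))]
    gcongr with v
    rw [ENNReal.ofReal_sum_of_nonneg fun x _ => zero_le_one.trans (le_max_left _ _)]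
  constructor
  · refine le_trans ?_ (mul_le_mul_right hconv 2)
    rw [show (2 : ℝ≥0∞) = ENNReal.ofReal 2 by simp, ← ENNReal.ofReal_mul (by norm_num)]
    refine ENNReal.ofReal_le_ofReal ?_
    rw [← Finset.sum_div] at hmain hsq
    linarith
  · refine le_trans ?_ (mul_le_mul_right hconv 4)
    rw [show (4 : ℝ≥0∞) = ENNReal.ofReal 4 by simp, ← ENNReal.ofReal_mul (by norm_num),
      ← ofReal_integral_eq_lintegral_ofReal (hE.mono_set (Ioc_subset_Ioc_right ht.2))
        (Filter.Eventually.of_forall fun v => hω.energy_nonneg D v _),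
      ← intervalIntegral.integral_of_le ht.1]
    refine ENNReal.ofReal_le_ofReal ?_
    linarith

end Energy

/-! ### Averaged norms and normalized time -/

section Norms

variable {V : Type*}

theorem spaceNorm_ofReal (B : Finset V) {p : ℝ} (hp : 0 ≤ p) (f : V → ℝ) :
    spaceNorm B (ENNReal.ofReal p) f =
      ((∑ x ∈ B, ‖f x‖ₑ ^ p) / (B.card : ℝ≥0∞)) ^ (1 / p) := by
  rw [spaceNorm, if_neg ENNReal.ofReal_ne_top, ENNReal.toReal_ofReal hp]

/-- Hölder's inequality for the normalized sum over a subset. -/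
theorem sum_div_card_le_spaceNorm_mul {B S : Finset V} (hS : S ⊆ B) (hB : B.Nonempty) {p : ℝ}
    (hp : 1 < p) (f : V → ℝ) :
    (∑ x ∈ S, ‖f x‖ₑ) / (B.card : ℝ≥0∞) ≤ spaceNorm B (ENNReal.ofReal p) f *
      ((S.card : ℝ≥0∞) / B.card) ^ (1 - 1 / p) := by
  have hp0 : 0 < p := by linarith
  have hconj : p.HolderConjugate (Real.conjExponent p) := Real.HolderConjugate.conjExponent hp
  have hq : 1 / Real.conjExponent p = 1 - 1 / p := by
    simpa [one_div] using hconj.one_sub_inv.symm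
  have h0 : (0 : ℝ) ≤ 1 - 1 / p := by rw [← hq]; exact one_div_nonneg.2 hconj.symm.nonneg
  have h := ENNReal.inner_le_Lp_mul_Lq S (fun x => ‖f x‖ₑ) (fun _ => 1) hconj
  simp only [mul_one, ENNReal.one_rpow, Finset.sum_const, nsmul_eq_mul, hq] at h
  rw [spaceNorm_ofReal B hp0.le, ENNReal.div_rpow_of_nonneg _ _ (by positivity),
    ENNReal.div_rpow_of_nonneg _ _ h0]
  have hc0 : (B.card : ℝ≥0∞) ≠ 0 := by simpa using hB.ne_empty
  have hct : (B.card : ℝ≥0∞) ≠ ∞ := ENNReal.natCast_ne_top _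
  have hcard : (B.card : ℝ≥0∞)⁻¹ =
      ((B.card : ℝ≥0∞) ^ (1 / p))⁻¹ * ((B.card : ℝ≥0∞) ^ (1 - 1 / p))⁻¹ := by
    rw [← ENNReal.mul_inv (Or.inr (ENNReal.rpow_ne_top_of_nonneg h0 hct))
      (Or.inr (by simp [hc0, hct])),
      ← ENNReal.rpow_add _ _ hc0 hct]
    simp
  simp only [div_eq_mul_inv, hcard] at h ⊢
  calc (∑ x ∈ S, ‖f x‖ₑ) * _ ≤ ((∑ x ∈ B, ‖f x‖ₑ ^ p) ^ (1 * p⁻¹) *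
        (S.card : ℝ≥0∞) ^ (1 - 1 * p⁻¹)) * _ := by
        gcongr
        refine h.trans ?_
        gcongr
    _ = _ := by ring

/-- The normalized Lebesgue measure on `[s, s + t]`. -/
noncomputable def meanTime (s t : ℝ) : Measure ℝ :=
  (ENNReal.ofReal t)⁻¹ • volume.restrict (Icc s (s + t))

theorem meanTime_univ {s t : ℝ} (ht : 0 < t) : meanTime s t univ = 1 := by
  simp only [meanTime, Measure.smul_apply, Measure.restrict_apply MeasurableSet.univ, univ_inter,
    Real.volume_Icc, add_sub_cancel_left, smul_eq_mul]
  exact ENNReal.inv_mul_cancel (by simpa using ht) ENNReal.ofReal_ne_top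

theorem lintegral_Icc_eq_mul_meanTime {s t : ℝ} (ht : 0 < t) (F : ℝ → ℝ≥0∞) :
    ∫⁻ v in Icc s (s + t), F v = ENNReal.ofReal t * ∫⁻ v, F v ∂meanTime s t := by
  rw [meanTime, lintegral_smul_measure, smul_eq_mul, ← mul_assoc,
    ENNReal.mul_inv_cancel (by simpa using ht) ENNReal.ofReal_ne_top, one_mul]

theorem spaceTimeNorm_ofReal {s t : ℝ} (ht : 0 < t) (B : Finset V) (p : ℝ≥0∞) {p' : ℝ}
    (hp' : 0 ≤ p') (f : ℝ → V → ℝ) :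
    spaceTimeNorm s (s + t) B p (ENNReal.ofReal p') f =
      (∫⁻ v, spaceNorm B p (f v) ^ p' ∂meanTime s t) ^ (1 / p') := by
  rw [spaceTimeNorm, if_neg ENNReal.ofReal_ne_top, ENNReal.toReal_ofReal hp',
    lintegral_Icc_eq_mul_meanTime ht, add_sub_cancel_left, mul_comm, ENNReal.mul_div_cancel_right
    (by simpa using ht) ENNReal.ofReal_ne_top]

theorem measurable_spaceNorm (B : Finset V) (p : ℝ≥0∞) {f : ℝ → V → ℝ}
    (hf : ∀ x ∈ B, Measurable fun t => f t x) : Measurable fun t => spaceNorm B p (f t) := by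
  unfold spaceNorm
  split_ifs
  · exact Measurable.biSup (B : Set V) B.countable_toSet fun x hx => (hf x hx).enorm
  · exact ((Finset.measurable_fun_sum _ fun x hx => (hf x hx).enorm.pow_const _).div_const
      _).pow_const _

end Norms

/-! ### Sobolev inequality on superlevel sets -/

section Sobolev

variable {V : Type*} {G : SimpleGraph V} [G.LocallyFinite] {ω : ℝ → Sym2 V → ℝ}

/-- An edge with nonzero gradient has an endpoint in S and can be oriented to start there, which
injects such edges into the directed sum. Keeping the sum on S is what later yields a power of the
measure of {w > 0}. -/
theorem tsum_absGrad_le {S : Finset V} {w : V → ℝ} (hw : ∀ x, x ∉ S → w x = 0) :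
    ∑' e : G.edgeSet, ‖absGrad w e‖ₑ ≤
      ENNReal.ofReal (∑ x ∈ S, ∑ y ∈ G.neighborFinset x, |w x - w y|) := by
  classical
  set g : V × V → ℝ≥0∞ := fun z =>
    if z.1 ∈ S ∧ G.Adj z.1 z.2 then ‖w z.1 - w z.2‖ₑ else 0 with hg
  have hex : ∀ e : G.edgeSet, ∃ z : V × V, s(z.1, z.2) = (e : Sym2 V) ∧ ‖absGrad w e‖ₑ ≤ g z := by
    rintro ⟨e, he⟩
    induction e using Sym2.ind with | _ x y => ?_
    have hadj : G.Adj x y := he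
    have hgr : ‖absGrad w s(x, y)‖ₑ = ‖w x - w y‖ₑ := by
      change ‖|w x - w y|‖ₑ = _
      rw [Real.enorm_eq_ofReal_abs, abs_abs, Real.enorm_eq_ofReal_abs]
    by_cases hx : x ∈ S
    · exact ⟨(x, y), rfl, by simp only [hg, hx, hadj, and_self, if_true, hgr, le_refl]⟩
    by_cases hy : y ∈ S
    · refine ⟨(y, x), Sym2.eq_swap, ?_⟩
      simp only [hg, hy, hadj.symm, and_self, if_true, hgr]
      rw [enorm_sub_rev]
    · refine ⟨(x, y), rfl, ?_⟩
      simp only [hgr, hw x hx, hw y hy, sub_self, enorm_zero, zero_le]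
  choose i hi1 hi2 using hex
  have hinj : Function.Injective i := fun e e' h => Subtype.ext (by rw [← hi1 e, ← hi1 e', h])
  calc ∑' e : G.edgeSet, ‖absGrad w e‖ₑ ≤ ∑' e, g (i e) := ENNReal.tsum_le_tsum hi2
    _ ≤ ∑' z, g z := ENNReal.tsum_comp_le_tsum_of_injective hinj g
    _ = ∑ x ∈ S, ∑ y ∈ G.neighborFinset x, g (x, y) := by
        rw [ENNReal.tsum_prod', tsum_eq_sum (s := S)]
        · refine Finset.sum_congr rfl fun x _ => tsum_eq_sum fun y hy => ?_
          rw [G.mem_neighborFinset] at hy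
          simp [hg, hy]
        · intro x hx
          simp [hg, hx]
    _ = _ := by
        rw [ENNReal.ofReal_sum_of_nonneg fun x _ => Finset.sum_nonneg fun y _ => abs_nonneg _]
        refine Finset.sum_congr rfl fun x hx => ?_
        rw [ENNReal.ofReal_sum_of_nonneg fun y _ => abs_nonneg _]
        refine Finset.sum_congr rfl fun y hy => ?_
        simp only [hg, hx, (G.mem_neighborFinset _ _).1 hy, and_self, if_true]
        rw [Real.enorm_eq_ofReal_abs]

/-- Cauchy–Schwarz after splitting each gradient into the factors ω^{-1/2} and ω^{1/2}|∇w|. -/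
theorem IsWeight.sq_sum_grad_le (hω : IsWeight G ω) (S : Finset V) (t : ℝ) (w : V → ℝ) :
    (∑ x ∈ S, ∑ y ∈ G.neighborFinset x, |w x - w y|) ^ 2 ≤
      (∑ x ∈ S, nu G ω t x) * energy G ω S t w := by
  simp only [nu, energy, Finset.sum_sigma']
  refine Finset.sum_sq_le_sum_mul_sum_of_sq_le_mul _ ?_ ?_ ?_
  · rintro ⟨x, y⟩ h
    have := hω.pos_of_adj ((G.mem_neighborFinset _ _).1 (Finset.mem_sigma.1 h).2) t
    positivity
  · rintro ⟨x, y⟩ h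
    have := hω.pos_of_adj ((G.mem_neighborFinset _ _).1 (Finset.mem_sigma.1 h).2) t
    positivity
  · rintro ⟨x, y⟩ h
    have := hω.pos_of_adj ((G.mem_neighborFinset _ _).1 (Finset.mem_sigma.1 h).2) t
    simp only [sq_abs]
    exact le_of_eq (by field_simp)

/-- The Sobolev inequality at scale `N` on the fixed finite set `B`. -/
def SobolevOn (G : SimpleGraph V) (B : Finset V) (N : ℕ) (d' CS : ℝ) : Prop :=
  ∀ u : V → ℝ, Function.support u ⊆ (B : Set V) →
    spaceNorm B (ENNReal.ofReal (d' / (d' - 1))) u ≤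
      ENNReal.ofReal CS * ((N : ℝ≥0∞) / (B.card : ℝ≥0∞)) * ∑' e : G.edgeSet, ‖absGrad u e‖ₑ

/-- The Sobolev inequality compares the measures of two superlevel sets of `w`. -/
theorem IsWeight.superlevel_le (hω : IsWeight G ω) {B D S₀ S₁ : Finset V} (hB : B.Nonempty)
    {N : ℕ} {d' CS : ℝ} (hd' : 2 ≤ d') (hSob : SobolevOn G B N d' CS) (t : ℝ)
    {w : V → ℝ} (hS₀D : S₀ ⊆ D) (hDB : D ⊆ B) (hw : ∀ x, x ∉ S₀ → w x = 0) {δ : ℝ} (hδ : 0 < δ)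
    (hS₁B : S₁ ⊆ B) (hS₁ : ∀ x ∈ S₁, δ ≤ w x) {q : ℝ} (hq : 1 < q) :
    ENNReal.ofReal δ ^ 2 * ((S₁.card : ℝ≥0∞) / B.card) ^ (2 - 2 / d') ≤
      (ENNReal.ofReal CS * N) ^ 2 * spaceNorm B (ENNReal.ofReal q) (fun x => max 1 (nu G ω t x)) *
        ((S₀.card : ℝ≥0∞) / B.card) ^ (1 - 1 / q) *
        (ENNReal.ofReal (energy G ω D t w) / B.card) := by
  have hc0 : (B.card : ℝ≥0∞) ≠ 0 := by simpa using hB.ne_empty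
  have hct : (B.card : ℝ≥0∞) ≠ ∞ := ENNReal.natCast_ne_top _
  set P := d' / (d' - 1) with hP
  have hP0 : 0 < P := div_pos (by linarith) (by linarith)
  have hnu0 : ∀ x, 0 ≤ nu G ω t x := fun x => Finset.sum_nonneg fun y hy => by
    have := hω.pos_of_adj ((G.mem_neighborFinset _ _).1 hy) t
    positivity
  have hsupp : Function.support w ⊆ (B : Set V) := fun x hx => by
    by_contra h
    exact hx (hw x fun h' => h (hDB (hS₀D h')))
  have h1 : ENNReal.ofReal δ * ((S₁.card : ℝ≥0∞) / B.card) ^ (1 / P) ≤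
      spaceNorm B (ENNReal.ofReal P) w := by
    rw [spaceNorm_ofReal B hP0.le]
    calc ENNReal.ofReal δ * ((S₁.card : ℝ≥0∞) / B.card) ^ (1 / P)
        = ((∑ x ∈ S₁, ENNReal.ofReal δ ^ P) / B.card) ^ (1 / P) := by
          rw [Finset.sum_const, nsmul_eq_mul, mul_comm (S₁.card : ℝ≥0∞), mul_div_assoc,
            ENNReal.mul_rpow_of_nonneg _ _ (by positivity), ← ENNReal.rpow_mul,
            mul_one_div_cancel hP0.ne', ENNReal.rpow_one]
      _ ≤ _ := by
          gcongr
          refine (Finset.sum_le_sum fun x hx => ?_).trans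
            (Finset.sum_le_sum_of_subset hS₁B)
          gcongr
          rw [Real.enorm_eq_ofReal (hδ.le.trans (hS₁ x hx))]
          exact ENNReal.ofReal_le_ofReal (hS₁ x hx)
  have h2 := h1.trans ((hSob w hsupp).trans (mul_le_mul_right (tsum_absGrad_le (G := G) hw) _))
  have h3 : ENNReal.ofReal (∑ x ∈ S₀, ∑ y ∈ G.neighborFinset x, |w x - w y|) ^ 2 ≤
      (∑ x ∈ S₀, ‖max 1 (nu G ω t x)‖ₑ) * ENNReal.ofReal (energy G ω D t w) := by
    have e1 : ∑ x ∈ S₀, ‖max 1 (nu G ω t x)‖ₑ =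
        ENNReal.ofReal (∑ x ∈ S₀, max 1 (nu G ω t x)) := by
      rw [ENNReal.ofReal_sum_of_nonneg fun x _ => zero_le_one.trans (le_max_left _ _)]
      exact Finset.sum_congr rfl fun x _ =>
        Real.enorm_eq_ofReal (zero_le_one.trans (le_max_left _ _))
    rw [e1, ← ENNReal.ofReal_mul (Finset.sum_nonneg fun x _ =>
      zero_le_one.trans (le_max_left _ _)), ← ENNReal.ofReal_pow (Finset.sum_nonneg fun x _ =>
      Finset.sum_nonneg fun y _ => abs_nonneg _)]
    refine ENNReal.ofReal_le_ofReal ((hω.sq_sum_grad_le S₀ t w).trans ?_)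
    refine mul_le_mul (Finset.sum_le_sum fun x _ => le_max_right _ _) ?_
      (hω.energy_nonneg _ _ _) (Finset.sum_nonneg fun x _ => zero_le_one.trans (le_max_left _ _))
    exact Finset.sum_le_sum_of_subset_of_nonneg hS₀D fun x _ _ => Finset.sum_nonneg fun y hy =>
      mul_nonneg (hω.pos_of_adj ((G.mem_neighborFinset _ _).1 hy) t).le (sq_nonneg _)
  have h4 := sum_div_card_le_spaceNorm_mul (hS₀D.trans hDB) hB hq fun x => max 1 (nu G ω t x)
  have hexp : 2 - 2 / d' = 1 / P * (2 : ℕ) := by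
    rw [hP]; have : d' ≠ 0 := by linarith
    have : d' - 1 ≠ 0 := by linarith
    field_simp; push_cast; ring
  calc ENNReal.ofReal δ ^ 2 * ((S₁.card : ℝ≥0∞) / B.card) ^ (2 - 2 / d')
      = (ENNReal.ofReal δ * ((S₁.card : ℝ≥0∞) / B.card) ^ (1 / P)) ^ 2 := by
        rw [mul_pow, hexp, ENNReal.rpow_mul, ENNReal.rpow_natCast]
    _ ≤ (ENNReal.ofReal CS * (N / B.card) *
        ENNReal.ofReal (∑ x ∈ S₀, ∑ y ∈ G.neighborFinset x, |w x - w y|)) ^ 2 := by gcongr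
    _ ≤ (ENNReal.ofReal CS * (N / B.card)) ^ 2 *
        ((∑ x ∈ S₀, ‖max 1 (nu G ω t x)‖ₑ) * ENNReal.ofReal (energy G ω D t w)) := by
        rw [mul_pow]; gcongr
    _ = (ENNReal.ofReal CS * N) ^ 2 * ((∑ x ∈ S₀, ‖max 1 (nu G ω t x)‖ₑ) / B.card) *
        (ENNReal.ofReal (energy G ω D t w) / B.card) := by
        simp only [div_eq_mul_inv]; ring
    _ ≤ _ := by
        rw [mul_assoc ((ENNReal.ofReal CS * N) ^ 2) (spaceNorm _ _ _)]
        gcongr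

end Sobolev

/-! ### Abstract De Giorgi step and fast geometric convergence -/

section Iteration

/-- One step of the De Giorgi iteration for measures of superlevel sets. -/
theorem lintegral_density_le {m : Measure ℝ} {θ₀ θ₁ N E : ℝ → ℝ≥0∞} (hθ₀ : Measurable θ₀)
    (hN : Measurable N) (hE : Measurable E) {K Gb J : ℝ≥0∞} {κ c a σ r e q' : ℝ}
    (hq' : 0 < q') (hr : r * (1 + 1 / q') = 1) (hr0 : 0 < r) (hσ0 : 0 < σ) (hσ1 : σ < 1)
    (hκ : 0 ≤ κ) (he : 0 ≤ e) (hae : a = κ * (σ * r) + e) (hσ : (1 - c) * (σ * r) = a * (1 - σ))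
    (hstar : ∀ t, θ₁ t ^ κ ≤ K * N t * θ₀ t ^ (1 - c) * E t) (hbd : ∀ t, θ₁ t ≤ Gb)
    (hJ : ∫⁻ t, E t ∂m ≤ J) :
    ∫⁻ t, θ₁ t ^ a ∂m ≤ K ^ (σ * r) * Gb ^ e * (∫⁻ t, N t ^ q' ∂m) ^ (σ * r / q') * J ^ (σ * r) *
      (∫⁻ t, θ₀ t ^ a ∂m) ^ (1 - σ) := by
  have hsr : 0 < σ * r := mul_pos hσ0 hr0
  -- The exponent a is split as κσr + e: the first part is estimated by the Sobolev bound `hstar`,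
  -- the second by the uniform bound `hbd`.
  have hpt : ∀ t, θ₁ t ^ a ≤ K ^ (σ * r) * Gb ^ e *
      ((N t ^ q') ^ (σ * r / q') * (E t) ^ (σ * r) * (θ₀ t ^ a) ^ (1 - σ)) := by
    intro t
    calc θ₁ t ^ a = (θ₁ t ^ κ) ^ (σ * r) * θ₁ t ^ e := by
          rw [hae, ENNReal.rpow_add_of_nonneg _ _ (by positivity) he, ENNReal.rpow_mul]
      _ ≤ (K * N t * θ₀ t ^ (1 - c) * E t) ^ (σ * r) * Gb ^ e := by
          gcongr
          · exact hstar t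
          · exact hbd t
      _ = _ := by
          rw [ENNReal.mul_rpow_of_nonneg _ _ hsr.le, ENNReal.mul_rpow_of_nonneg _ _ hsr.le,
            ENNReal.mul_rpow_of_nonneg _ _ hsr.le, ← ENNReal.rpow_mul, ← ENNReal.rpow_mul,
            ← ENNReal.rpow_mul, mul_div_cancel₀ _ hq'.ne', hσ]
          ring
  have hm1 : Measurable fun t => N t ^ q' := hN.pow_const _
  have hm2 : Measurable fun t => θ₀ t ^ a := hθ₀.pow_const _
  -- Three-factor Hölder in time; the weights σr/q', σr and 1 - σ add up to one because r(1 + 1/q')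
  -- = 1.
  have hH := ENNReal.lintegral_prod_norm_pow_le (μ := m) (Finset.univ : Finset (Fin 3))
    (f := ![fun t => N t ^ q', E, fun t => θ₀ t ^ a])
    (p := ![σ * r / q', σ * r, 1 - σ]) (by
      intro i _; fin_cases i
      exacts [hm1.aemeasurable, hE.aemeasurable, hm2.aemeasurable])
    (by
      simp only [Fin.sum_univ_three, Matrix.cons_val_zero, Matrix.cons_val_one, Matrix.cons_val]
      have : σ * r / q' + σ * r = σ * (r * (1 + 1 / q')) := by field_simp; ring
      rw [this, hr]; ring)
    (by
      intro i _; fin_cases i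
      · exact div_nonneg hsr.le hq'.le
      · exact hsr.le
      · exact sub_nonneg.2 hσ1.le)
  simp only [Fin.prod_univ_three, Matrix.cons_val_zero, Matrix.cons_val_one, Matrix.cons_val] at hH
  calc ∫⁻ t, θ₁ t ^ a ∂m ≤ ∫⁻ t, K ^ (σ * r) * Gb ^ e *
      ((N t ^ q') ^ (σ * r / q') * (E t) ^ (σ * r) * (θ₀ t ^ a) ^ (1 - σ)) ∂m := lintegral_mono hpt
    _ = K ^ (σ * r) * Gb ^ e *
      ∫⁻ t, (N t ^ q') ^ (σ * r / q') * (E t) ^ (σ * r) * (θ₀ t ^ a) ^ (1 - σ) ∂m :=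
        lintegral_const_mul _ (((hm1.pow_const _).mul (hE.pow_const _)).mul (hm2.pow_const _))
    _ ≤ K ^ (σ * r) * Gb ^ e * ((∫⁻ t, N t ^ q' ∂m) ^ (σ * r / q') * (∫⁻ t, E t ∂m) ^ (σ * r) *
      (∫⁻ t, θ₀ t ^ a ∂m) ^ (1 - σ)) := by gcongr
    _ ≤ K ^ (σ * r) * Gb ^ e * ((∫⁻ t, N t ^ q' ∂m) ^ (σ * r / q') * J ^ (σ * r) *
      (∫⁻ t, θ₀ t ^ a ∂m) ^ (1 - σ)) := by gcongr
    _ = _ := by ring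

/-- Fast geometric convergence. -/
theorem tendsto_zero_of_superlinear_recursion {z : ℕ → ℝ} {Λ β h : ℝ} (hz : ∀ j, 0 ≤ z j)
    (hΛ : 0 ≤ Λ) (hβ : 1 < β) (hh : 0 < h)
    (hrec : ∀ j, z (j + 1) ≤ Λ * β ^ j * z j ^ (1 + h))
    (hsmall : Λ * z 0 ^ h ≤ β ^ (-(1 / h))) : Filter.Tendsto z Filter.atTop (nhds 0) := by
  have hβ0 : 0 < β := by linarith
  set ρ : ℝ := β ^ (-(1 / h)) with hρ
  have hρ0 : 0 < ρ := Real.rpow_pos_of_pos hβ0 _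
  have hρ1 : ρ < 1 := Real.rpow_lt_one_of_one_lt_of_neg hβ (by simpa using hh)
  have hρh : ρ ^ h = β⁻¹ := by
    rw [hρ, ← Real.rpow_mul hβ0.le, neg_mul, one_div_mul_cancel hh.ne', Real.rpow_neg_one]
  -- Since ρ^h = 1/β, geometric decay at rate ρ cancels the growth β^j exactly, and the smallness of
  -- z 0 supplies one further factor ρ.
  have hdec : ∀ j, z j ≤ z 0 * ρ ^ j := by
    intro j
    induction j with
    | zero => simp
    | succ j ih =>
      have h1 : z j ^ h ≤ z 0 ^ h * (β⁻¹) ^ j := by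
        rw [← hρh, ← Real.rpow_natCast, ← Real.rpow_mul hρ0.le, mul_comm h, Real.rpow_mul hρ0.le,
          Real.rpow_natCast, ← Real.mul_rpow (hz 0) (by positivity)]
        exact Real.rpow_le_rpow (hz j) ih hh.le
      calc z (j + 1) ≤ Λ * β ^ j * z j ^ (1 + h) := hrec j
        _ = Λ * β ^ j * (z j * z j ^ h) := by
            rw [Real.rpow_add_of_nonneg (hz j) zero_le_one hh.le, Real.rpow_one]
        _ ≤ Λ * β ^ j * (z j * (z 0 ^ h * (β⁻¹) ^ j)) := by
            gcongr; exact hz j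
        _ = (Λ * z 0 ^ h) * z j := by
            rw [inv_pow]; field_simp
        _ ≤ ρ * (z 0 * ρ ^ j) := mul_le_mul hsmall ih (hz j) hρ0.le
        _ = z 0 * ρ ^ (j + 1) := by ring
  refine squeeze_zero hz hdec ?_
  simpa using (tendsto_pow_atTop_nhds_zero_of_lt_one hρ0.le hρ1).const_mul (z 0)

end Iteration

/-! ### De Giorgi recursion between two levels -/

section DeGiorgi

variable {V : Type*}

/-- The excess of `u` over the barrier `b x + k + c (τ₀ - t)` at level `k`. -/
noncomputable def levelExcess (D : Finset V) (u : V → ℝ → ℝ) (b : V → ℝ) (c τ₀ k : ℝ) (x : V)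
    (t : ℝ) : ℝ := excess D (fun x => u x t) (fun x => b x + k + c * (τ₀ - t)) x

open Classical in
/-- The density in `B` of the set where the excess at level `k` is positive, as a function of
time in `(τ₁, τ₀]`. -/
noncomputable def levelDensity (B D : Finset V) (u : V → ℝ → ℝ) (b : V → ℝ) (c τ₁ τ₀ k : ℝ) :
    ℝ → ℝ≥0∞ :=
  (Ioc τ₁ τ₀).indicator fun t =>
    ((D.filter fun x => 0 < levelExcess D u b c τ₀ k x t).card : ℝ≥0∞) / B.card

/-- Exponents for the De Giorgi iteration: `a` is the exponent of the density in the iterated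
quantity, `σ` and `r` are the interpolation weights, `g` is the degree of the recursion in the
coefficients and `(1 - 1 / p') * g - σ` is its superlinear gain. -/
structure IterationExponents (p p' q q' d' a σ r e g : ℝ) : Prop where
  two_le : 2 ≤ d'
  one_lt_p : 1 < p
  one_lt_p' : 1 < p'
  one_lt_q : 1 < q
  q'_pos : 0 < q'
  a_pos : 0 < a
  a_mul : a * (1 - 1 / p') = 1 - 1 / p
  r_mul : r * (1 + 1 / q') = 1
  r_pos : 0 < r
  σ_pos : 0 < σ
  σ_lt_one : σ < 1
  e_nonneg : 0 ≤ e
  a_eq : a = (2 - 2 / d') * (σ * r) + e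
  σ_eq : (1 - 1 / q) * (σ * r) = a * (1 - σ)
  g_eq : g = σ * r + e
  gain_pos : σ < (1 - 1 / p') * g

/-- A solution `u` on `D × [τ₁, τ₀]` below a barrier: `u ≤ H` on the cylinder, and `u` does not
exceed `b x + c (τ₀ - t)` at the initial time and on the outer boundary of `D`. -/
structure BarrierSetup (G : SimpleGraph V) [G.LocallyFinite] (ω : ℝ → Sym2 V → ℝ) (B D : Finset V)
    (u : V → ℝ → ℝ) (b : V → ℝ) (s t τ₁ τ₀ c L H : ℝ) : Prop where
  weight : IsWeight G ω
  nonempty : B.Nonempty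
  subset : D ⊆ B
  nbr : ∀ x ∈ D, ∀ y, G.Adj x y → y ∈ B
  meas : ∀ x, Measurable (u x)
  nonneg : ∀ x t, 0 ≤ u x t
  le_one : ∀ x t, u x t ≤ 1
  intMu : ∀ x ∈ D, IntegrableOn (fun v => mu G ω v x) (Ioc τ₁ τ₀)
  sol : ∀ x ∈ D, ∀ t ∈ Icc τ₁ τ₀, u x t = u x τ₁ + ∫ v in τ₁..t, generator G ω u x v
  c_nonneg : 0 ≤ c
  grad : ∀ x y, G.Adj x y → |b x - b y| ≤ L
  b_nonneg : ∀ x, 0 ≤ b x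
  H_nonneg : 0 ≤ H
  le_H : ∀ x ∈ D, ∀ t ∈ Icc τ₁ τ₀, u x t ≤ H
  out : ∀ x ∈ D, ∀ y, G.Adj x y → y ∉ D → ∀ t ∈ Icc τ₁ τ₀, u y t ≤ b y + c * (τ₀ - t)
  start : ∀ x ∈ D, u x τ₁ ≤ b x + c * (τ₀ - τ₁)
  s_le : s ≤ τ₁
  le : τ₁ ≤ τ₀
  le_end : τ₀ ≤ s + t
  t_pos : 0 < t

theorem indicator_apply_le_of_mem {S : Set ℝ} {f : ℝ → ℝ≥0∞} {v : ℝ} {y : ℝ≥0∞}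
    (h : v ∈ S → f v ≤ y) : S.indicator f v ≤ y := by
  by_cases hv : v ∈ S
  · rw [indicator_of_mem hv]; exact h hv
  · rw [indicator_of_notMem hv]; exact zero_le

variable {G : SimpleGraph V} [G.LocallyFinite] {ω : ℝ → Sym2 V → ℝ} {B D : Finset V}
  {u : V → ℝ → ℝ} {b : V → ℝ} {s t τ₁ τ₀ c L H : ℝ}

theorem BarrierSetup.Ioc_subset (h : BarrierSetup G ω B D u b s t τ₁ τ₀ c L H) :
    Ioc τ₁ τ₀ ⊆ Icc s (s + t) := fun _ hv => ⟨h.s_le.trans hv.1.le, hv.2.trans h.le_end⟩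

theorem BarrierSetup.measurable_levelExcess (h : BarrierSetup G ω B D u b s t τ₁ τ₀ c L H) (k : ℝ)
    (x : V) : Measurable (levelExcess D u b c τ₀ k x) :=
  measurable_excess h.meas (β := fun x t => b x + k + c * (τ₀ - t)) (by fun_prop) x

theorem BarrierSetup.measurable_levelDensity (h : BarrierSetup G ω B D u b s t τ₁ τ₀ c L H)
    (k : ℝ) : Measurable (levelDensity B D u b c τ₁ τ₀ k) := by
  classical
  refine Measurable.indicator ?_ measurableSet_Ioc
  simp only [Finset.card_filter, Nat.cast_sum, Nat.cast_ite, Nat.cast_one, Nat.cast_zero]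
  refine (Finset.measurable_fun_sum _ fun x _ => ?_).div_const _
  exact Measurable.ite (measurableSet_lt measurable_const (h.measurable_levelExcess k x))
    measurable_const measurable_const

theorem BarrierSetup.levelDensity_le_one (h : BarrierSetup G ω B D u b s t τ₁ τ₀ c L H) (k v : ℝ) :
    levelDensity B D u b c τ₁ τ₀ k v ≤ 1 := by
  classical
  unfold levelDensity
  refine indicator_apply_le_of_mem fun _ => ENNReal.div_le_of_le_mul ?_
  rw [one_mul]
  exact_mod_cast Finset.card_le_card ((Finset.filter_subset _ _).trans h.subset)

theorem lintegral_indicator_Ioc_meanTime (ht : 0 < t) (hsub : Ioc τ₁ τ₀ ⊆ Icc s (s + t))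
    (F : ℝ → ℝ≥0∞) :
    ∫⁻ v in Ioc τ₁ τ₀, F v =
      ENNReal.ofReal t * ∫⁻ v, (Ioc τ₁ τ₀).indicator F v ∂meanTime s t := by
  rw [← lintegral_Icc_eq_mul_meanTime ht, lintegral_indicator measurableSet_Ioc,
    Measure.restrict_restrict measurableSet_Ioc, inter_eq_self_of_subset_left hsub]

/-- Hölder's inequality for the mass of `1 ∨ μ` above level `k`. -/
theorem BarrierSetup.lintegral_mu_le (h : BarrierSetup G ω B D u b s t τ₁ τ₀ c L H) {p p' a : ℝ}
    (hp : 1 < p) (hp' : 1 < p') (ha : a * (1 - 1 / p') = 1 - 1 / p) (k : ℝ) :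
    ∫⁻ v in Ioc τ₁ τ₀, ∑ x ∈ D with 0 < levelExcess D u b c τ₀ k x v,
        ENNReal.ofReal (max 1 (mu G ω v x)) ≤
      ENNReal.ofReal t * B.card * (spaceTimeNorm s (s + t) B (ENNReal.ofReal p)
          (ENNReal.ofReal p') (fun v x => max 1 (mu G ω v x)) *
        (∫⁻ v, levelDensity B D u b c τ₁ τ₀ k v ^ a ∂meanTime s t) ^ (1 - 1 / p')) := by
  classical
  have hc0 : (B.card : ℝ≥0∞) ≠ 0 := by simpa using h.nonempty.ne_empty
  have hct : (B.card : ℝ≥0∞) ≠ ∞ := ENNReal.natCast_ne_top _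
  have hp0 : 0 < p' := by linarith
  have hb0 : 0 < 1 - 1 / p' := by rw [sub_pos, div_lt_one hp0]; exact hp'
  set θ := levelDensity B D u b c τ₁ τ₀ k with hθ
  set N : ℝ → ℝ≥0∞ := fun v => spaceNorm B (ENNReal.ofReal p) fun x => max 1 (mu G ω v x) with hN
  have hNm : Measurable N := measurable_spaceNorm B _ fun x _ =>
    measurable_const.max (h.weight.measurable_mu x)
  have hθm : Measurable θ := h.measurable_levelDensity k
  rw [lintegral_indicator_Ioc_meanTime h.t_pos h.Ioc_subset, mul_assoc,
    spaceTimeNorm_ofReal h.t_pos B _ hp0.le]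
  gcongr
  -- Hölder in space leaves the density to the power 1 - 1/p. The exponent a is chosen so that this
  -- is (θ^a)^{1 - 1/p'}, ready for Hölder in time.
  have hpt : ∀ v, (Ioc τ₁ τ₀).indicator (fun v => ∑ x ∈ D with 0 < levelExcess D u b c τ₀ k x v,
      ENNReal.ofReal (max 1 (mu G ω v x))) v ≤
        B.card * ((N v ^ p') ^ (1 / p') * (θ v ^ a) ^ (1 - 1 / p')) := by
    intro v
    refine indicator_apply_le_of_mem fun hv => ?_
    have hS := sum_div_card_le_spaceNorm_mul (S := D.filter fun x => 0 < levelExcess D u b c τ₀ k x v)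
      ((Finset.filter_subset _ _).trans h.subset) h.nonempty hp fun x => max 1 (mu G ω v x)
    rw [ENNReal.div_le_iff hc0 hct] at hS
    simp only [Real.enorm_eq_ofReal (zero_le_one.trans (le_max_left (1 : ℝ) _))] at hS
    rw [← ENNReal.rpow_mul, ← ENNReal.rpow_mul, mul_one_div_cancel hp0.ne', ENNReal.rpow_one, ha,
      mul_comm, hθ, levelDensity, indicator_of_mem hv]
    exact hS
  refine (lintegral_mono hpt).trans ?_
  rw [lintegral_const_mul' _ _ hct]
  gcongr
  exact ENNReal.lintegral_mul_norm_pow_le (hNm.pow_const _).aemeasurable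
    (hθm.pow_const _).aemeasurable (by positivity) hb0.le (by ring)

/-- Raising the barrier by a constant k ≥ 0 preserves its gradient and its boundary conditions, so
the energy inequality applies at every level with the same L, c and H. -/
theorem BarrierSetup.levelExcess_energy_le (h : BarrierSetup G ω B D u b s t τ₁ τ₀ c L H)
    {p p' a : ℝ} (hp : 1 < p) (hp' : 1 < p') (ha : a * (1 - 1 / p') = 1 - 1 / p) {k : ℝ}
    (hk : 0 ≤ k) {Y : ℝ≥0∞}
    (hY : Y = spaceTimeNorm s (s + t) B (ENNReal.ofReal p) (ENNReal.ofReal p')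
        (fun v x => max 1 (mu G ω v x)) *
        (∫⁻ v, levelDensity B D u b c τ₁ τ₀ k v ^ a ∂meanTime s t) ^ (1 - 1 / p')) :
    (∀ v ∈ Icc τ₁ τ₀, ENNReal.ofReal (∑ x ∈ D, levelExcess D u b c τ₀ k x v ^ 2) ≤
      2 * (ENNReal.ofReal (L ^ 2 / 2 + c * H) * (ENNReal.ofReal t * B.card * Y))) ∧
    ∫⁻ v in Ioc τ₁ τ₀, ENNReal.ofReal (energy G ω D v fun x => levelExcess D u b c τ₀ k x v) ≤
      4 * (ENNReal.ofReal (L ^ 2 / 2 + c * H) * (ENNReal.ofReal t * B.card * Y)) := by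
  classical
  have hI := h.lintegral_mu_le hp hp' ha k
  rw [← hY] at hI
  have key := fun v (hv : v ∈ Icc τ₁ τ₀) => h.weight.excess_energy_le h.subset h.nbr h.meas h.nonneg
    h.le_one h.intMu h.sol (b := fun x => b x + k) (L := L) (H := H) h.c_nonneg
    (fun x y hxy => by simpa using h.grad x y hxy)
    (w := levelExcess D u b c τ₀ k) rfl
    (fun x hx y hxy hy v hv => by linarith [h.out x hx y hxy hy v hv])
    (fun x v hv => by
      unfold levelExcess excess
      split_ifs with hx
      · refine max_le ?_ h.H_nonneg
        have := mul_nonneg h.c_nonneg (sub_nonneg.2 hv.2)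
        linarith [h.le_H x hx v hv, h.b_nonneg x]
      · exact h.H_nonneg)
    (fun x => by
      unfold levelExcess excess
      split_ifs with hx
      · exact max_eq_right (by linarith [h.start x hx])
      · rfl) hv
  refine ⟨fun v hv => (key v hv).1.trans ?_, (key τ₀ ⟨h.le, le_rfl⟩).2.trans ?_⟩
  · gcongr
  · gcongr

/-- The De Giorgi recursion between two levels. -/
theorem BarrierSetup.lintegral_levelDensity_le (h : BarrierSetup G ω B D u b s t τ₁ τ₀ c L H)
    {N : ℕ} {d' CS : ℝ} (hCS : 0 < CS) (hSob : SobolevOn G B N d' CS)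
    (hN : (N : ℝ) ^ 2 ≤ t) {p p' q q' a σ r e g : ℝ}
    (hx : IterationExponents p p' q q' d' a σ r e g) {k δ : ℝ} (hk : 0 ≤ k) (hδ : 0 < δ)
    (hA : 1 ≤ spaceTimeNorm s (s + t) B (ENNReal.ofReal q) (ENNReal.ofReal q')
      (fun v x => max 1 (nu G ω v x))) :
    ∫⁻ v, levelDensity B D u b c τ₁ τ₀ (k + δ) v ^ a ∂meanTime s t ≤
      (ENNReal.ofReal (4 * max 1 (CS ^ 2) * ((L ^ 2 / 2 + c * H) * t / δ ^ 2)) *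
        (spaceTimeNorm s (s + t) B (ENNReal.ofReal p) (ENNReal.ofReal p')
          (fun v x => max 1 (mu G ω v x)) *
        spaceTimeNorm s (s + t) B (ENNReal.ofReal q) (ENNReal.ofReal q')
          (fun v x => max 1 (nu G ω v x)))) ^ g *
      (∫⁻ v, levelDensity B D u b c τ₁ τ₀ k v ^ a ∂meanTime s t) ^
        ((1 - 1 / p') * g + (1 - σ)) := by
  classical
  obtain ⟨hd', hp, hp', hq, hq', ha0, ha, hr, hr0, hσ0, hσ1, he, hae, hσ, hg, hh⟩ := hx
  have hc0 : (B.card : ℝ≥0∞) ≠ 0 := by simpa using h.nonempty.ne_empty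
  have hct : (B.card : ℝ≥0∞) ≠ ∞ := ENNReal.natCast_ne_top _
  have ht := h.t_pos
  have ht0 : ENNReal.ofReal t ≠ 0 := by simpa using ht
  set Aμ := spaceTimeNorm s (s + t) B (ENNReal.ofReal p) (ENNReal.ofReal p')
    (fun v x => max 1 (mu G ω v x)) with hAμ
  set Aν := spaceTimeNorm s (s + t) B (ENNReal.ofReal q) (ENNReal.ofReal q')
    (fun v x => max 1 (nu G ω v x)) with hAν
  set Z := ∫⁻ v, levelDensity B D u b c τ₁ τ₀ k v ^ a ∂meanTime s t with hZ
  set Y : ℝ≥0∞ := Aμ * Z ^ (1 - 1 / p') with hY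
  set Γ := L ^ 2 / 2 + c * H with hΓ
  have hΓ0 : 0 ≤ Γ := by have := mul_nonneg h.c_nonneg h.H_nonneg; positivity
  set w := levelExcess D u b c τ₀ k with hw
  obtain ⟨hsup, hen⟩ := h.levelExcess_energy_le hp hp' ha hk hY
  have hδ2 : ENNReal.ofReal (δ ^ 2) ≠ 0 := by simpa using hδ.ne'
  have hlevel : ∀ x v, 0 < levelExcess D u b c τ₀ (k + δ) x v → x ∈ D ∧ δ ≤ w x v := by
    intro x v hx
    unfold levelExcess excess at hx
    split_ifs at hx with hxD
    · refine ⟨hxD, ?_⟩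
      rw [hw]; unfold levelExcess
      rw [excess_of_mem hxD]
      refine le_max_of_le_left ?_
      rcases lt_max_iff.1 hx with h' | h'
      · linarith
      · exact absurd h' (lt_irrefl _)
    · exact absurd hx (lt_irrefl _)
  -- Chebyshev: above level k + δ the excess at level k is at least δ, and its squares have a sum
  -- bounded uniformly in time.
  have hdens : ∀ v, levelDensity B D u b c τ₁ τ₀ (k + δ) v ≤
      ENNReal.ofReal (2 * (Γ * t / δ ^ 2)) * Y := by
    intro v
    unfold levelDensity
    refine indicator_apply_le_of_mem fun hv => ?_
    have h1 : ENNReal.ofReal (δ ^ 2) *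
        ((D.filter fun x => 0 < levelExcess D u b c τ₀ (k + δ) x v).card : ℝ≥0∞) ≤
        ENNReal.ofReal (∑ x ∈ D, w x v ^ 2) := by
      rw [ENNReal.ofReal_sum_of_nonneg fun x _ => sq_nonneg _, mul_comm, ← nsmul_eq_mul,
        ← Finset.sum_const]
      refine (Finset.sum_le_sum fun x hx => ?_).trans
        (Finset.sum_le_sum_of_subset (Finset.filter_subset _ _))
      exact ENNReal.ofReal_le_ofReal (pow_le_pow_left₀ hδ.le
        (hlevel x v (Finset.mem_filter.1 hx).2).2 2)
    rw [ENNReal.div_le_iff hc0 hct, ← ENNReal.mul_le_mul_iff_right hδ2 ENNReal.ofReal_ne_top]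
    refine h1.trans ((hsup v ⟨hv.1.le, hv.2⟩).trans_eq ?_)
    have e1 : Γ * t = δ ^ 2 * (Γ * t / δ ^ 2) := by field_simp
    have e2 : ENNReal.ofReal Γ * ENNReal.ofReal t =
        ENNReal.ofReal (δ ^ 2) * ENNReal.ofReal (Γ * t / δ ^ 2) := by
      rw [← ENNReal.ofReal_mul hΓ0, e1, ENNReal.ofReal_mul (by positivity), ← e1]
    rw [ENNReal.ofReal_mul zero_le_two, ENNReal.ofReal_ofNat]
    calc 2 * (ENNReal.ofReal Γ * (ENNReal.ofReal t * B.card * Y))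
        = 2 * (ENNReal.ofReal Γ * ENNReal.ofReal t) * B.card * Y := by ring
      _ = _ := by rw [e2]; ring
  set E : ℝ → ℝ≥0∞ := (Ioc τ₁ τ₀).indicator fun v =>
    ENNReal.ofReal (energy G ω D v fun x => w x v) / B.card with hE
  have hEm0 : Measurable fun v => ENNReal.ofReal (energy G ω D v fun x => w x v) :=
    (h.weight.measurable_energy D fun x => h.measurable_levelExcess k x).ennreal_ofReal
  have hEm : Measurable E := (hEm0.div_const _).indicator measurableSet_Ioc
  have hJ : ∫⁻ v, E v ∂meanTime s t ≤ ENNReal.ofReal (4 * Γ) * Y := by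
    rw [← ENNReal.mul_le_mul_iff_right ht0 ENNReal.ofReal_ne_top, hE,
      ← lintegral_indicator_Ioc_meanTime ht h.Ioc_subset]
    simp only [div_eq_mul_inv]
    rw [lintegral_mul_const _ hEm0, ← div_eq_mul_inv, ENNReal.div_le_iff hc0 hct]
    refine hen.trans_eq ?_
    rw [ENNReal.ofReal_mul zero_le_four, ENNReal.ofReal_ofNat]
    ring
  have hκ : 0 < 2 - 2 / d' := by
    have : 2 / d' ≤ 1 := (div_le_one (by linarith)).2 hd'
    linarith
  -- The Sobolev radius N enters only through N² ≤ t, which matches the factor t from normalized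
  -- time: this is the parabolic scaling.
  have hstar : ∀ v, levelDensity B D u b c τ₁ τ₀ (k + δ) v ^ (2 - 2 / d') ≤
      ENNReal.ofReal (CS ^ 2 * t / δ ^ 2) *
        spaceNorm B (ENNReal.ofReal q) (fun x => max 1 (nu G ω v x)) *
        levelDensity B D u b c τ₁ τ₀ k v ^ (1 - 1 / q) * E v := by
    intro v
    by_cases hv : v ∈ Ioc τ₁ τ₀
    swap
    · rw [levelDensity, indicator_of_notMem hv, ENNReal.zero_rpow_of_pos hκ]
      exact zero_le
    · have h1 := h.weight.superlevel_le (S₀ := D.filter fun x => 0 < w x v)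
        (S₁ := D.filter fun x => 0 < levelExcess D u b c τ₀ (k + δ) x v) h.nonempty hd' hSob v
        (w := fun x => w x v) (Finset.filter_subset _ _) h.subset
        (fun x hx => by
          by_cases hxD : x ∈ D
          · refine le_antisymm (not_lt.1 fun h' => hx (Finset.mem_filter.2 ⟨hxD, h'⟩)) ?_
            exact excess_nonneg _ _ _ _
          · exact excess_of_notMem hxD) hδ ((Finset.filter_subset _ _).trans h.subset)
        (fun x hx => (hlevel x v (Finset.mem_filter.1 hx).2).2) hq
      rw [hE, levelDensity, levelDensity, indicator_of_mem hv, indicator_of_mem hv,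
        indicator_of_mem hv, ← ENNReal.mul_le_mul_iff_right hδ2 ENNReal.ofReal_ne_top]
      rw [← ENNReal.ofReal_pow hδ.le] at h1
      refine h1.trans ?_
      have e1 : (ENNReal.ofReal CS * N) ^ 2 ≤
          ENNReal.ofReal (δ ^ 2) * ENNReal.ofReal (CS ^ 2 * t / δ ^ 2) := by
        rw [← ENNReal.ofReal_mul (by positivity), mul_div_cancel₀ _ (by positivity),
          ← ENNReal.ofReal_natCast, ← ENNReal.ofReal_mul hCS.le,
          ← ENNReal.ofReal_pow (by positivity)]
        refine ENNReal.ofReal_le_ofReal ?_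
        rw [mul_pow]; gcongr
      simp only [← mul_assoc]
      gcongr
  have hstep := lintegral_density_le (m := meanTime s t) (h.measurable_levelDensity k)
    (θ₁ := levelDensity B D u b c τ₁ τ₀ (k + δ))
    (measurable_spaceNorm B (ENNReal.ofReal q) (f := fun v x => max 1 (nu G ω v x)) fun x _ =>
      measurable_const.max (h.weight.measurable_nu x)) hEm hq' hr hr0 hσ0 hσ1 hκ.le he hae hσ
    hstar hdens hJ
  refine hstep.trans ?_
  have hsr : 0 < σ * r := mul_pos hσ0 hr0
  have hg0 : 0 ≤ g := by rw [hg]; positivity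
  have hp0 : 0 < 1 - 1 / p' := by
    rw [sub_pos, div_lt_one (by linarith)]; exact hp'
  have hAνe : (∫⁻ v, spaceNorm B (ENNReal.ofReal q) (fun x => max 1 (nu G ω v x)) ^ q' ∂meanTime s t)
      ^ (σ * r / q') = Aν ^ (σ * r) := by
    rw [hAν, spaceTimeNorm_ofReal ht B _ hq'.le, ← ENNReal.rpow_mul]
    congr 1; field_simp
  rw [hAνe]
  set ξ := Γ * t / δ ^ 2 with hξ
  have hξ0 : 0 ≤ ξ := by positivity
  set C₁ := max 1 (CS ^ 2) with hC₁
  have hC1 : 1 ≤ C₁ := le_max_left _ _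
  have hKJ : ENNReal.ofReal (CS ^ 2 * t / δ ^ 2) * (ENNReal.ofReal (4 * Γ) * Y) ≤
      ENNReal.ofReal (4 * C₁ * ξ) * Y := by
    rw [← mul_assoc, ← ENNReal.ofReal_mul (by positivity)]
    refine mul_le_mul_left (ENNReal.ofReal_le_ofReal ?_) Y
    calc CS ^ 2 * t / δ ^ 2 * (4 * Γ) = 4 * CS ^ 2 * ξ := by rw [hξ]; ring
      _ ≤ 4 * C₁ * ξ := by gcongr; exact le_max_right _ _
  have hGb : ENNReal.ofReal (2 * ξ) * Y ≤ ENNReal.ofReal (4 * C₁ * ξ) * Y := by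
    gcongr; linarith
  calc _ = (ENNReal.ofReal (CS ^ 2 * t / δ ^ 2) * (ENNReal.ofReal (4 * Γ) * Y)) ^ (σ * r) *
        (ENNReal.ofReal (2 * ξ) * Y) ^ e * Aν ^ (σ * r) * Z ^ (1 - σ) := by
        rw [ENNReal.mul_rpow_of_nonneg _ (ENNReal.ofReal (4 * Γ) * Y) hsr.le]; ring
    _ ≤ (ENNReal.ofReal (4 * C₁ * ξ) * Y) ^ (σ * r) * (ENNReal.ofReal (4 * C₁ * ξ) * Y) ^ e *
        Aν ^ g * Z ^ (1 - σ) := by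
        gcongr ?_ * ?_ * ?_ * _
        · gcongr
        · gcongr
        -- The power of the ν norm is raised from σr to g, which the bound `1 ≤ Aν` permits, so that
        -- both norms appear as a product.
        · exact ENNReal.rpow_le_rpow_of_exponent_le hA (by rw [hg]; linarith)
    _ = (ENNReal.ofReal (4 * C₁ * ξ) * (Aμ * Aν)) ^ g * ((Z ^ (1 - 1 / p')) ^ g * Z ^ (1 - σ)) := by
        rw [← ENNReal.rpow_add_of_nonneg _ _ hsr.le he, ← hg, hY]
        simp only [ENNReal.mul_rpow_of_nonneg _ _ hg0]
        ring
    _ = _ := by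
        rw [← ENNReal.rpow_mul, ← ENNReal.rpow_add_of_nonneg _ _ (by positivity)
          (sub_nonneg.2 hσ1.le)]

end DeGiorgi

/-! ### Choice of the interpolation exponents -/

section Exponents

/-- The interpolation exponents of the De Giorgi iteration. -/
theorem exists_iteration_exponents {p p' q q' d' : ℝ} (hp : 1 < p) (hp' : 1 < p') (hq : 1 < q)
    (hq' : 0 < q') (hd' : 2 ≤ d')
    (hcond : 1 / p * (1 - 1 / p')⁻¹ * (1 + 1 / q') + 1 / q < 2 / d') :
    ∃ a σ r e g : ℝ, IterationExponents p p' q q' d' a σ r e g := by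
  suffices ∃ a σ r e g : ℝ, 0 < a ∧ a * (1 - 1 / p') = 1 - 1 / p ∧ r * (1 + 1 / q') = 1 ∧ 0 < r ∧
      0 < σ ∧ σ < 1 ∧ 0 ≤ e ∧ a = (2 - 2 / d') * (σ * r) + e ∧
      (1 - 1 / q) * (σ * r) = a * (1 - σ) ∧ g = σ * r + e ∧ σ < (1 - 1 / p') * g by
    obtain ⟨a, σ, r, e, g, h⟩ := this
    exact ⟨a, σ, r, e, g, hd', hp, hp', hq, hq', h.1, h.2.1, h.2.2.1, h.2.2.2.1, h.2.2.2.2.1,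
      h.2.2.2.2.2.1, h.2.2.2.2.2.2.1, h.2.2.2.2.2.2.2.1, h.2.2.2.2.2.2.2.2.1,
      h.2.2.2.2.2.2.2.2.2.1, h.2.2.2.2.2.2.2.2.2.2⟩
  have hα : 1 / p < 1 := (div_lt_one (by linarith)).2 hp
  have hα0 : 0 < 1 / p := by positivity
  have hb : 1 / p' < 1 := (div_lt_one (by linarith)).2 hp'
  have hb0 : 0 < 1 / p' := by positivity
  have hc : 1 / q < 1 := (div_lt_one (by linarith)).2 hq
  have hε0 : 0 < 1 / q' := by positivity
  have hD : 2 / d' ≤ 1 := (div_le_one (by linarith)).2 hd'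
  generalize 1 / p = α at *
  generalize 1 / q = c at *
  generalize 1 / q' = ε at *
  generalize 2 / d' = D at *
  obtain ⟨β, hβ⟩ : ∃ β, β = 1 - 1 / p' := ⟨_, rfl⟩
  have hβ0 : 0 < β := by rw [hβ]; linarith
  have hβ1 : β < 1 := by rw [hβ]; linarith
  rw [← hβ] at hcond ⊢
  set r := 1 / (1 + ε) with hr
  have hr0 : 0 < r := by positivity
  have hr1 : r ≤ 1 := (div_le_one (by linarith)).2 (by linarith)
  have hrε : r * (1 + ε) = 1 := by rw [hr]; field_simp
  -- The exponent condition multiplied by rβ, in the form in which it controls the gain.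
  have hkey : α < r * β * (D - c) := by
    have h1 : α * β⁻¹ * (1 + ε) * (r * β) < (D - c) * (r * β) :=
      mul_lt_mul_of_pos_right (by linarith) (by positivity)
    have h2 : α * β⁻¹ * (1 + ε) * (r * β) = α := by
      calc α * β⁻¹ * (1 + ε) * (r * β) = α * (r * (1 + ε)) * (β⁻¹ * β) := by ring
        _ = α := by rw [hrε, inv_mul_cancel₀ hβ0.ne']; ring
    linarith
  set a := (1 - α) / β with ha
  have ha0 : 0 < a := div_pos (by linarith) hβ0
  have haβ : a * β = 1 - α := by rw [ha]; field_simp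
  have hden : 0 < a + r * (1 - c) := by
    have := mul_pos hr0 (sub_pos.2 hc); linarith
  -- Forced by (1 - c)σr = a(1 - σ), the matching of powers of the lower-level density.
  set σ := a / (a + r * (1 - c)) with hσ
  have hσ0 : 0 < σ := div_pos ha0 hden
  have hσeq : σ * (a + r * (1 - c)) = a := by rw [hσ]; field_simp
  have hσ1 : σ < 1 := by
    rw [hσ, div_lt_one hden]
    have := mul_pos hr0 (sub_pos.2 hc); linarith
  -- Equivalent to e ≥ 0, since e = σ(a - r(1 + c - D)).
  have hage : r * (1 + c - D) ≤ a := by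
    have h1 : r * (1 + c - D) * β ≤ a * β := by
      rw [haβ]; nlinarith [mul_le_mul hr1 hβ1.le hβ0.le zero_le_one]
    exact le_of_mul_le_mul_right h1 hβ0
  refine ⟨a, σ, r, a - (2 - D) * (σ * r), σ * r + (a - (2 - D) * (σ * r)), ha0, haβ, hrε, hr0, hσ0,
    hσ1, ?_, by ring, by linarith, rfl, ?_⟩
  · have := mul_le_mul_of_nonneg_left hage hσ0.le
    nlinarith
  -- This product is precisely the gain βg - σ.
  · have h2 : 0 < σ * (r * β * (D - c) - α) := mul_pos hσ0 (by linarith)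
    have h3 : σ * (a * β + r * β * (1 - c)) = a * β := by
      calc _ = σ * (a + r * (1 - c)) * β := by ring
        _ = _ := by rw [hσeq]
    rw [haβ] at h3
    nlinarith

end Exponents

/-! ### From total mass to the height of a peak -/

section Peak

variable {V : Type*} {G : SimpleGraph V} [G.LocallyFinite] {ω : ℝ → Sym2 V → ℝ} {B D : Finset V}
  {u : V → ℝ → ℝ} {b : V → ℝ} {s t τ₁ τ₀ c L H : ℝ}

theorem levelDensity_anti {k k' : ℝ} (hkk' : k ≤ k') (v : ℝ) :
    levelDensity B D u b c τ₁ τ₀ k' v ≤ levelDensity B D u b c τ₁ τ₀ k v := by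
  classical
  unfold levelDensity
  refine indicator_le_indicator ?_
  refine ENNReal.div_le_div_right (Nat.cast_le.2 (Finset.card_le_card fun x hx => ?_)) _
  obtain ⟨hxD, hx0⟩ := Finset.mem_filter.1 hx
  refine Finset.mem_filter.2 ⟨hxD, hx0.trans_le ?_⟩
  unfold levelExcess
  rw [excess_of_mem hxD, excess_of_mem hxD]
  gcongr

/-- Markov's inequality: positive excess at level k forces u > k because the barrier is nonnegative.
-/
theorem BarrierSetup.levelDensity_le (h : BarrierSetup G ω B D u b s t τ₁ τ₀ c L H)
    (hmass : ∀ v, ∑ x ∈ B, u x v ≤ 1) {k : ℝ} (hk : 0 < k) (v : ℝ) :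
    levelDensity B D u b c τ₁ τ₀ k v ≤ ENNReal.ofReal (k * B.card)⁻¹ := by
  classical
  have hcard : (0 : ℝ) < B.card := by exact_mod_cast h.nonempty.card_pos
  unfold levelDensity
  refine indicator_apply_le_of_mem fun hv => ?_
  set S := D.filter fun x => 0 < levelExcess D u b c τ₀ k x v with hS
  have h1 : (S.card : ℝ) * k ≤ 1 := by
    rw [← nsmul_eq_mul, ← Finset.sum_const]
    refine le_trans ((Finset.sum_le_sum fun x hx => ?_).trans
      (Finset.sum_le_sum_of_subset_of_nonneg ((Finset.filter_subset _ _).trans h.subset)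
        fun x _ _ => h.nonneg x v)) (hmass v)
    obtain ⟨hxD, hx0⟩ := Finset.mem_filter.1 hx
    unfold levelExcess at hx0
    rw [excess_of_mem hxD] at hx0
    rcases lt_max_iff.1 hx0 with h' | h'
    · have := mul_nonneg h.c_nonneg (sub_nonneg.2 hv.2)
      have := h.b_nonneg x
      linarith
    · exact absurd h' (lt_irrefl _)
  rw [← ENNReal.ofReal_natCast, ← ENNReal.ofReal_natCast, ← ENNReal.ofReal_div_of_pos hcard]
  refine ENNReal.ofReal_le_ofReal ?_
  rw [div_le_iff₀ hcard, mul_inv, mul_assoc, inv_mul_cancel₀ hcard.ne', mul_one]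
  rwa [← one_div, le_div_iff₀ hk]

/-- Solves for y when the smallness condition of the iteration fails; y will be M|B|/4 and z the
initial iterate, bounded through the mass. -/
theorem le_of_lt_mul_rpow {W g h a y z : ℝ} (hW : 0 ≤ W) (hh : 0 < h) (ha : 0 < a)
    (hy : 0 < y) (hz : 0 ≤ z) (hzy : z ≤ y⁻¹ ^ a)
    (hlt : ((4 : ℝ) ^ g) ^ (-(1 / h)) < W ^ g * z ^ h) :
    y ≤ (W * 4 ^ (1 / h)) ^ (g / (a * h)) := by
  have hah : 0 < a * h := mul_pos ha hh
  have hyah : 0 < y ^ (a * h) := Real.rpow_pos_of_pos hy _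
  have h1 : ((4 : ℝ) ^ g) ^ (-(1 / h)) < W ^ g * (y ^ (a * h))⁻¹ := by
    refine hlt.trans_le (mul_le_mul_of_nonneg_left ?_ (Real.rpow_nonneg hW g))
    calc z ^ h ≤ ((y⁻¹) ^ a) ^ h := Real.rpow_le_rpow hz hzy hh.le
      _ = _ := by rw [← Real.rpow_mul (inv_nonneg.2 hy.le), Real.inv_rpow hy.le]
  have h2 : y ^ (a * h) ≤ (W * 4 ^ (1 / h)) ^ g := by
    rw [← div_eq_mul_inv, lt_div_iff₀ hyah, Real.rpow_neg (by positivity),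
      inv_mul_lt_iff₀ (by positivity)] at h1
    refine h1.le.trans_eq ?_
    rw [← Real.rpow_mul (by norm_num), mul_comm g, Real.rpow_mul (by norm_num),
      Real.mul_rpow hW (by positivity), mul_comm]
  have := Real.rpow_le_rpow hyah.le h2 (z := 1 / (a * h)) (by positivity)
  rw [← Real.rpow_mul hy.le, mul_one_div_cancel hah.ne', Real.rpow_one,
    ← Real.rpow_mul (by positivity), mul_one_div] at this
  exact this

/-- The De Giorgi recursion along the levels `M / 2 - M / 4 * 2⁻ʲ`. -/
theorem BarrierSetup.toReal_recursion (h : BarrierSetup G ω B D u b s t τ₁ τ₀ c L H)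
    {N : ℕ} {d' CS : ℝ} (hCS : 0 < CS) (hSob : SobolevOn G B N d' CS)
    (hN : (N : ℝ) ^ 2 ≤ t) {p p' q q' a σ r e g : ℝ}
    (hx : IterationExponents p p' q q' d' a σ r e g)
    {Aμ Aν : ℝ≥0∞} (hAμ : Aμ = spaceTimeNorm s (s + t) B (ENNReal.ofReal p) (ENNReal.ofReal p')
      (fun v x => max 1 (mu G ω v x)))
    (hAν : Aν = spaceTimeNorm s (s + t) B (ENNReal.ofReal q) (ENNReal.ofReal q')
      (fun v x => max 1 (nu G ω v x)))
    (hAt : Aμ * Aν ≠ ∞) (hAν1 : 1 ≤ Aν) {Z : ℝ → ℝ≥0∞}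
    (hZ : ∀ k, Z k = ∫⁻ v, levelDensity B D u b c τ₁ τ₀ k v ^ a ∂meanTime s t)
    (hZt : ∀ k, Z k ≠ ∞) {M X : ℝ} (hM : 0 < M) (hX : 0 ≤ X)
    (hΓ : (L ^ 2 / 2 + c * H) * t ≤ X * M ^ 2) (j : ℕ) :
    (Z (M / 2 - M / 4 * (1 / 2) ^ (j + 1))).toReal ≤
      (256 * max 1 (CS ^ 2) * X * (Aμ * Aν).toReal) ^ g * ((4 : ℝ) ^ g) ^ j *
        (Z (M / 2 - M / 4 * (1 / 2) ^ j)).toReal ^ (1 + ((1 - 1 / p') * g - σ)) := by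
  have hsr : 0 < σ * r := mul_pos hx.σ_pos hx.r_pos
  have hg0 : 0 < g := by rw [hx.g_eq]; linarith [hx.e_nonneg]
  have hh := hx.gain_pos
  set k : ℝ := M / 2 - M / 4 * (1 / 2) ^ j with hk
  -- The gap to the next level. Its inverse square is 64·4^j/M², whence the constant 256 = 4·64 and
  -- the ratio 4^g.
  set δ : ℝ := M / 8 * (1 / 2) ^ j with hδ
  have hδ0 : 0 < δ := by positivity
  have hk0 : 0 ≤ k := by
    have : ((1 : ℝ) / 2) ^ j ≤ 1 := pow_le_one₀ (by norm_num) (by norm_num)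
    rw [hk]; nlinarith
  have hkδ : M / 2 - M / 4 * (1 / 2) ^ (j + 1) = k + δ := by rw [hk, hδ, pow_succ]; ring
  have hstep := h.lintegral_levelDensity_le hCS hSob hN hx hk0 hδ0 (by rw [← hAν]; exact hAν1)
  rw [← hAμ, ← hAν, ← hZ, ← hZ] at hstep
  set C₁ := max 1 (CS ^ 2) with hC₁
  have hC1 : 0 ≤ C₁ := zero_le_one.trans (le_max_left _ _)
  set A := (Aμ * Aν).toReal with hA
  have hA0 : 0 ≤ A := ENNReal.toReal_nonneg
  set Γt := (L ^ 2 / 2 + c * H) * t with hΓt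
  have hΓ0 : 0 ≤ Γt := by
    have := mul_nonneg h.c_nonneg h.H_nonneg
    have := h.t_pos
    positivity
  have he1 : (1 - 1 / p') * g + (1 - σ) = 1 + ((1 - 1 / p') * g - σ) := by ring
  rw [he1] at hstep
  have hfin : (ENNReal.ofReal (4 * C₁ * (Γt / δ ^ 2)) * (Aμ * Aν)) ^ g *
      Z k ^ (1 + ((1 - 1 / p') * g - σ)) ≠ ∞ :=
    ENNReal.mul_ne_top (ENNReal.rpow_ne_top_of_nonneg hg0.le
      (ENNReal.mul_ne_top ENNReal.ofReal_ne_top hAt))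
      (ENNReal.rpow_ne_top_of_nonneg (by linarith) (hZt _))
  have hstep' := ENNReal.toReal_mono hfin hstep
  rw [ENNReal.toReal_mul, ← ENNReal.toReal_rpow, ← ENNReal.toReal_rpow, ENNReal.toReal_mul,
    ENNReal.toReal_ofReal (by positivity), ← hA] at hstep'
  rw [hkδ]
  refine hstep'.trans (mul_le_mul_of_nonneg_right ?_ (Real.rpow_nonneg ENNReal.toReal_nonneg _))
  have hW : 0 ≤ 256 * C₁ * X * A := by positivity
  have hΛj : (256 * C₁ * X * A) ^ g * ((4 : ℝ) ^ g) ^ j = (256 * C₁ * X * A * 4 ^ j) ^ g := by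
    rw [Real.mul_rpow hW (by positivity), ← Real.rpow_natCast, ← Real.rpow_natCast,
      ← Real.rpow_mul (by norm_num), ← Real.rpow_mul (by norm_num), mul_comm g]
  rw [hΛj]
  refine Real.rpow_le_rpow (by positivity) ?_ hg0.le
  have hX2 : Γt / δ ^ 2 ≤ 64 * X * 4 ^ j := by
    rw [div_le_iff₀ (by positivity)]
    refine hΓ.trans_eq ?_
    have : ((1 : ℝ) / 2) ^ j * (1 / 2) ^ j * 4 ^ j = 1 := by
      rw [← mul_pow, ← mul_pow]; norm_num
    calc X * M ^ 2 = X * M ^ 2 * (((1 : ℝ) / 2) ^ j * (1 / 2) ^ j * 4 ^ j) := by rw [this, mul_one]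
      _ = _ := by rw [hδ]; ring
  calc 4 * C₁ * (Γt / δ ^ 2) * A ≤ 4 * C₁ * (64 * X * 4 ^ j) * A := by gcongr
    _ = _ := by ring

/-- A peak of height `M` above the barrier is controlled by the total mass of `u`. -/
theorem BarrierSetup.peak_mul_card_le (h : BarrierSetup G ω B D u b s t τ₁ τ₀ c L H)
    {N : ℕ} {d' CS : ℝ} (hCS : 0 < CS) (hSob : SobolevOn G B N d' CS)
    (hN : (N : ℝ) ^ 2 ≤ t) {p p' q q' a σ r e g : ℝ}
    (hx : IterationExponents p p' q q' d' a σ r e g)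
    {Aμ Aν : ℝ≥0∞} (hAμ : Aμ = spaceTimeNorm s (s + t) B (ENNReal.ofReal p) (ENNReal.ofReal p')
      (fun v x => max 1 (mu G ω v x)))
    (hAν : Aν = spaceTimeNorm s (s + t) B (ENNReal.ofReal q) (ENNReal.ofReal q')
      (fun v x => max 1 (nu G ω v x)))
    (hAt : Aμ * Aν ≠ ∞) (hAν1 : 1 ≤ Aν)
    (hmass : ∀ v, ∑ x ∈ B, u x v ≤ 1) {x₀ : V} (hx₀ : x₀ ∈ D) (hb₀ : b x₀ = 0) {M X : ℝ}
    (hM : 0 < M) (hM' : u x₀ τ₀ = M) (hX : 0 ≤ X) (hΓ : (L ^ 2 / 2 + c * H) * t ≤ X * M ^ 2) :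
    M * B.card ≤ 4 * (256 * max 1 (CS ^ 2) * X * (Aμ * Aν).toReal *
      4 ^ (1 / ((1 - 1 / p') * g - σ))) ^ (g / (a * ((1 - 1 / p') * g - σ))) := by
  classical
  have hcard : (0 : ℝ) < B.card := by exact_mod_cast h.nonempty.card_pos
  have hsr : 0 < σ * r := mul_pos hx.σ_pos hx.r_pos
  have hg0 : 0 < g := by rw [hx.g_eq]; linarith [hx.e_nonneg]
  have hp' := hx.one_lt_p'
  have ha0 := hx.a_pos
  have hh := hx.gain_pos
  have hp0 : 0 < 1 - 1 / p' := by
    rw [sub_pos, div_lt_one (by linarith)]; exact hp'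
  set Z : ℝ → ℝ≥0∞ := fun k => ∫⁻ v, levelDensity B D u b c τ₁ τ₀ k v ^ a ∂meanTime s t with hZ
  have hZ1 : ∀ k, Z k ≤ 1 := fun k => by
    calc Z k ≤ ∫⁻ _, 1 ∂meanTime s t :=
          lintegral_mono fun v => ENNReal.rpow_le_one (h.levelDensity_le_one k v) ha0.le
      _ = 1 := by rw [lintegral_one, meanTime_univ h.t_pos]
  have hZt : ∀ k, Z k ≠ ∞ := fun k => ne_top_of_le_ne_top ENNReal.one_ne_top (hZ1 k)
  have hZanti : ∀ k k', k ≤ k' → Z k' ≤ Z k := fun k k' hkk' =>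
    lintegral_mono fun v => ENNReal.rpow_le_rpow (levelDensity_anti hkk' v) ha0.le
  have hrec := h.toReal_recursion hCS hSob hN hx hAμ hAν hAt hAν1 (Z := Z) (fun k => rfl) hZt hM hX hΓ
  have hhx0 : 0 < (1 - 1 / p') * g - σ := by linarith
  have hW : 0 ≤ 256 * max 1 (CS ^ 2) * X * (Aμ * Aν).toReal :=
    mul_nonneg (by positivity) ENNReal.toReal_nonneg
  generalize 256 * max 1 (CS ^ 2) * X * (Aμ * Aν).toReal = W at *
  generalize (1 - 1 / p') * g - σ = η at *
  set z : ℕ → ℝ := fun j => (Z (M / 2 - M / 4 * (1 / 2) ^ j)).toReal with hz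
  -- If the iteration started small, the levels would rise to M/2 with the iterates tending to zero.
  -- The energy bound would then annihilate the excess at level M/2 at the final time, although it
  -- equals M/2 at the peak.
  have hnot : ((4 : ℝ) ^ g) ^ (-(1 / η)) < W ^ g * z 0 ^ η := by
    by_contra hsmall
    have hlim := tendsto_zero_of_superlinear_recursion (z := z) (fun j => ENNReal.toReal_nonneg)
      (Real.rpow_nonneg hW g) (Real.one_lt_rpow (by norm_num) hg0) hhx0 hrec (not_lt.1 hsmall)
    have hZ0 : Z (M / 2) = 0 := by
      have h1 : (Z (M / 2)).toReal ≤ 0 := ge_of_tendsto' hlim fun j =>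
        ENNReal.toReal_mono (hZt _) (hZanti _ _ (by
          have : 0 ≤ M / 4 * (1 / 2) ^ j := by positivity
          linarith))
      exact ((ENNReal.toReal_eq_zero_iff _).1 (le_antisymm h1 ENNReal.toReal_nonneg)).resolve_right
        (hZt _)
    have hend := (h.levelExcess_energy_le hx.one_lt_p hp' hx.a_mul (k := M / 2) (by positivity) rfl).1 τ₀
      ⟨h.le, le_rfl⟩
    change _ ≤ 2 * (_ * (_ * (_ * (Z (M / 2)) ^ _))) at hend
    rw [hZ0, ENNReal.zero_rpow_of_pos hp0] at hend
    simp only [mul_zero, nonpos_iff_eq_zero, ENNReal.ofReal_eq_zero] at hend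
    have h3 := Finset.single_le_sum (f := fun x => levelExcess D u b c τ₀ (M / 2) x τ₀ ^ 2)
      (fun x _ => sq_nonneg _) hx₀
    have h4 : levelExcess D u b c τ₀ (M / 2) x₀ τ₀ = M / 2 := by
      unfold levelExcess
      rw [excess_of_mem hx₀, hM', hb₀, max_eq_left] <;> linarith
    simp only [h4] at h3
    have := pow_pos (half_pos hM) 2
    linarith
  have hz0 : z 0 ≤ (M * B.card / 4)⁻¹ ^ a := by
    have hlev : M / 2 - M / 4 * (1 / 2) ^ 0 = M / 4 := by ring
    have hcomm : M / 4 * B.card = M * B.card / 4 := by ring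
    have hy0 : 0 ≤ (M * B.card / 4)⁻¹ := by positivity
    have h2 : Z (M / 2 - M / 4 * (1 / 2) ^ 0) ≤ ENNReal.ofReal ((M * B.card / 4)⁻¹ ^ a) := by
      rw [hlev]
      calc Z (M / 4) ≤ ∫⁻ _, ENNReal.ofReal (M * B.card / 4)⁻¹ ^ a ∂meanTime s t :=
            lintegral_mono fun v => ENNReal.rpow_le_rpow
              (hcomm ▸ h.levelDensity_le hmass (k := M / 4) (by positivity) v) ha0.le
        _ = _ := by
            rw [lintegral_const, meanTime_univ h.t_pos, mul_one,
              ENNReal.ofReal_rpow_of_nonneg hy0 ha0.le]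
    exact ENNReal.toReal_le_of_le_ofReal (Real.rpow_nonneg hy0 _) h2
  have h3 := le_of_lt_mul_rpow hW hhx0 ha0 (y := M * B.card / 4) (by positivity)
    ENNReal.toReal_nonneg hz0 hnot
  linarith

end Peak

/-! ### Localization at a maximum of the weighted kernel -/

section Local

variable {V : Type*} {G : SimpleGraph V} [G.LocallyFinite] {ω : ℝ → Sym2 V → ℝ}

theorem mem_ball_iff (hG : G.Connected) {x y : V} {r : ℝ} :
    y ∈ ball G x r ↔ G.dist x y ≤ ⌊r⌋₊ := by
  rw [ball, Set.Finite.mem_toFinset, ballSet, mem_ofPred_eq,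
    ← (hG.preconnected x y).coe_dist_eq_edist]
  exact ENat.natCast_le_natCast

/-- The forward equation exhibits the kernel as an indefinite integral; this continuity makes the
maximum over time attained. -/
theorem continuousOn_realKernel (hω : IsWeight G ω) {s T : ℝ} (hsT : s ≤ T) (x y : V)
    (hmu : IntegrableOn (fun v => mu G ω v y) (Ioc s T)) :
    ContinuousOn (realKernel G ω s x y) (Icc s T) := by
  have hg := hω.integrableOn_generator (u := fun y => realKernel G ω s x y)
    (fun z => hω.measurable_realKernel s x z)
    (fun z t => realKernel_nonneg s x z t) (fun z t => hω.realKernel_le_one s x z t) hmu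
  have hii := (intervalIntegrable_iff_integrableOn_Ioc_of_le hsT).2 hg
  have hc := (hii.absolutelyContinuousOnInterval_intervalIntegral
    (c := s) left_mem_uIcc).continuousOn
  rw [uIcc_of_le hsT] at hc
  refine (continuousOn_const (c := realKernel G ω s x y s)|>.add hc).congr fun t ht => ?_
  exact hω.realKernel_eq_add_integral x y hmu le_rfl ht.1 ht.2

/-- A weight vanishing on the parabolic boundary of `[s, s + t] × B(x₂, √t)`. -/
noncomputable def boundaryWeight (G : SimpleGraph V) (x₂ : V) (s t : ℝ) (x : V) (τ : ℝ) : ℝ :=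
  max 0 (min (1 - G.dist x₂ x / √t) ((τ - s) / t))

theorem exists_isMax_boundaryWeight (hω : IsWeight G ω) {s t : ℝ} (ht : 0 < t) (x₁ x₂ : V)
    {B : Finset V} (hB : B.Nonempty)
    (hmu : ∀ x ∈ B, IntegrableOn (fun v => mu G ω v x) (Ioc s (s + t))) (m : ℕ) :
    ∃ x₀ ∈ B, ∃ τ₀ ∈ Icc s (s + t), ∀ x ∈ B, ∀ τ ∈ Icc s (s + t),
      boundaryWeight G x₂ s t x τ ^ m * realKernel G ω s x₁ x τ ≤
        boundaryWeight G x₂ s t x₀ τ₀ ^ m * realKernel G ω s x₁ x₀ τ₀ := by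
  have hsT : s ≤ s + t := by linarith
  have hmax : ∀ x ∈ B, ∃ τ ∈ Icc s (s + t), ∀ τ' ∈ Icc s (s + t),
      boundaryWeight G x₂ s t x τ' ^ m * realKernel G ω s x₁ x τ' ≤
        boundaryWeight G x₂ s t x τ ^ m * realKernel G ω s x₁ x τ := fun x hx =>
    isCompact_Icc.exists_isMaxOn (nonempty_Icc.2 hsT)
      (ContinuousOn.mul (by unfold boundaryWeight; fun_prop)
        (continuousOn_realKernel hω hsT x₁ x (hmu x hx)))
  choose! T hT hTmax using hmax
  obtain ⟨x₀, hx₀, h₀⟩ := B.exists_max_image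
    (fun x => boundaryWeight G x₂ s t x (T x) ^ m * realKernel G ω s x₁ x (T x)) hB
  exact ⟨x₀, hx₀, T x₀, hT x₀ hx₀, fun x hx τ hτ => (hTmax x hx τ hτ).trans (h₀ x hx)⟩

/-- The barrier cylinder around a maximum point of the weighted kernel. -/
theorem exists_barrierSetup (hG : G.Connected) (hω : IsWeight G ω) {s t : ℝ} (ht : 0 < t)
    (x₁ x₂ : V) (hmu : ∀ x ∈ ball G x₂ √t, IntegrableOn (fun v => mu G ω v x) (Ioc s (s + t)))
    (m : ℕ) {x₀ : V} (hx₀ : x₀ ∈ ball G x₂ √t) {τ₀ : ℝ} (hτ₀ : τ₀ ∈ Icc s (s + t))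
    (hmax : ∀ x ∈ ball G x₂ √t, ∀ τ ∈ Icc s (s + t),
      boundaryWeight G x₂ s t x τ ^ m * realKernel G ω s x₁ x τ ≤
        boundaryWeight G x₂ s t x₀ τ₀ ^ m * realKernel G ω s x₁ x₀ τ₀)
    {φ : ℝ} (hφ : φ = boundaryWeight G x₂ s t x₀ τ₀) (hφ8 : 8 ≤ √t * φ) {M : ℝ}
    (hM : M = realKernel G ω s x₁ x₀ τ₀) :
    ∃ (D : Finset V) (b : V → ℝ) (τ₁ c L H : ℝ),
      BarrierSetup G ω (ball G x₂ √t) D (fun x => realKernel G ω s x₁ x) b s t τ₁ τ₀ c L H ∧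
      x₀ ∈ D ∧ b x₀ = 0 ∧ (L ^ 2 / 2 + c * H) * t ≤ 34 * 4 ^ m / φ ^ 2 * M ^ 2 := by
  classical
  set n := √t with hn
  have hn0 : 0 < n := Real.sqrt_pos.2 ht
  have hn2 : n ^ 2 = t := Real.sq_sqrt ht.le
  have hφ0 : 0 < φ := by
    by_contra h
    nlinarith
  have hφmin : φ = min (1 - G.dist x₂ x₀ / n) ((τ₀ - s) / t) := by
    rw [boundaryWeight] at hφ
    rcases max_cases 0 (min (1 - G.dist x₂ x₀ / n) ((τ₀ - s) / t)) with h | h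
    · rw [← hn, h.1] at hφ; linarith
    · rw [hφ, ← hn, h.1]
  have hφdist : φ ≤ 1 - G.dist x₂ x₀ / n := hφmin ▸ min_le_left _ _
  have hφtime : φ ≤ (τ₀ - s) / t := hφmin ▸ min_le_right _ _
  have hφ1 : φ ≤ 1 := hφdist.trans (by
    have : (0 : ℝ) ≤ G.dist x₂ x₀ / n := by positivity
    linarith)
  have hdist0 : (G.dist x₂ x₀ : ℝ) ≤ n * (1 - φ) := by
    have : G.dist x₂ x₀ / n ≤ 1 - φ := by linarith
    rw [div_le_iff₀ hn0] at this
    linarith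
  have htime0 : t * φ ≤ τ₀ - s := by
    rw [le_div_iff₀ ht] at hφtime; linarith
  have hM0 : 0 ≤ M := hM ▸ realKernel_nonneg _ _ _ _
  -- Rounding down still leaves ℓ ≥ nφ/8, and here nφ ≥ 8 is used.
  set ℓ := ⌊n * φ / 4⌋₊ with hℓ
  have hℓle : (ℓ : ℝ) ≤ n * φ / 4 := Nat.floor_le (by positivity)
  have hℓge : n * φ / 8 ≤ ℓ := by
    have := Nat.lt_floor_add_one (n * φ / 4)
    rw [← hℓ] at this; linarith
  have hℓ0 : (0 : ℝ) < ℓ := by linarith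
  set H := 2 ^ m * M with hH
  have hH0 : 0 ≤ H := by positivity
  set τ₁ := τ₀ - t * φ / 2 with hτ₁
  have htφ : 0 < t * φ := by positivity
  -- Moving by at most nφ/4 in space and tφ/2 back in time keeps the boundary weight at least φ/2,
  -- so maximality costs a factor 2^m.
  have hregion : ∀ x, G.dist x₀ x ≤ ℓ → x ∈ ball G x₂ n ∧
      ∀ τ ∈ Icc τ₁ τ₀, realKernel G ω s x₁ x τ ≤ H := by
    intro x hx
    have htri : (G.dist x₂ x : ℝ) ≤ G.dist x₂ x₀ + G.dist x₀ x := by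
      exact_mod_cast hG.dist_triangle
    have hxℓ : (G.dist x₀ x : ℝ) ≤ ℓ := by exact_mod_cast hx
    have hd : (G.dist x₂ x : ℝ) ≤ n * (1 - φ / 2) := by nlinarith
    have hxB : x ∈ ball G x₂ n := by
      rw [mem_ball_iff hG]
      exact Nat.le_floor (hd.trans (by nlinarith))
    refine ⟨hxB, fun τ hτ => ?_⟩
    have hτ' : τ ∈ Icc s (s + t) := ⟨by linarith [hτ.1], hτ.2.trans hτ₀.2⟩
    have hw : φ / 2 ≤ boundaryWeight G x₂ s t x τ := by
      rw [boundaryWeight]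
      refine le_max_of_le_right (le_min ?_ ?_)
      · have : G.dist x₂ x / n ≤ 1 - φ / 2 := by
          rw [div_le_iff₀ hn0]; linarith
        linarith
      · rw [le_div_iff₀ ht]; linarith [hτ.1]
    have h1 := hmax x hxB τ hτ'
    rw [← hφ, ← hM] at h1
    have h2 : (φ / 2) ^ m * realKernel G ω s x₁ x τ ≤ φ ^ m * M :=
      (mul_le_mul_of_nonneg_right (pow_le_pow_left₀ (by positivity) hw m)
        (realKernel_nonneg _ _ _ _)).trans h1
    have h3 : φ ^ m * M = (φ / 2) ^ m * H := by
      rw [hH, ← mul_assoc, ← mul_pow]; congr 2; ring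
    rw [h3] at h2
    exact le_of_mul_le_mul_left h2 (by positivity)
  set D := (ball G x₂ n).filter fun x => G.dist x₀ x < ℓ with hD
  have hDmem : ∀ x, x ∈ D ↔ G.dist x₀ x < ℓ := fun x => by
    rw [hD, Finset.mem_filter]
    exact ⟨fun h => h.2, fun h => ⟨(hregion x h.le).1, h⟩⟩
  have hadjd : ∀ x y, G.Adj x y → G.dist x₀ y ≤ G.dist x₀ x + 1 := fun x y hxy => by
    have := hG.dist_triangle (u := x₀) (v := x) (w := y)
    rwa [SimpleGraph.dist_eq_one_iff_adj.2 hxy] at this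
  have hτ₁s : s ≤ τ₁ := by rw [hτ₁]; linarith
  have hτle : τ₁ ≤ τ₀ := by rw [hτ₁]; linarith
  have hcτ : ∀ τ ∈ Icc τ₁ τ₀, 0 ≤ 2 * H / (t * φ) * (τ₀ - τ) := fun τ hτ =>
    mul_nonneg (by positivity) (sub_nonneg.2 hτ.2)
  have hsub : ∀ x ∈ D, IntegrableOn (fun v => mu G ω v x) (Ioc τ₁ τ₀) := fun x hx =>
    (hmu x (Finset.mem_filter.1 hx).1).mono_set (Ioc_subset_Ioc hτ₁s hτ₀.2)
  -- The spatial part vanishes at x₀ and equals H at distance ℓ; the temporal part vanishes at τ₀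
  -- and equals H at τ₁. D is the open ball of radius ℓ, so its outer neighbours lie at distance
  -- exactly ℓ.
  refine ⟨D, fun x => H * G.dist x₀ x / ℓ, τ₁, 2 * H / (t * φ), H / ℓ, H, ?_, ?_, ?_, ?_⟩
  · refine
      { weight := hω
        nonempty := ⟨x₀, hx₀⟩
        subset := Finset.filter_subset _ _
        nbr := fun x hx y hxy => (hregion y ?_).1
        meas := fun x => hω.measurable_realKernel s x₁ x
        nonneg := fun x τ => realKernel_nonneg s x₁ x τ
        le_one := fun x τ => hω.realKernel_le_one s x₁ x τ
        intMu := hsub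
        sol := fun x hx τ hτ => hω.realKernel_eq_add_integral x₁ x
          (hmu x (Finset.mem_filter.1 hx).1) hτ₁s hτ.1 (hτ.2.trans hτ₀.2)
        c_nonneg := by positivity
        grad := fun x y hxy => ?_
        b_nonneg := fun x => by positivity
        H_nonneg := hH0
        le_H := fun x hx τ hτ => (hregion x ((hDmem x).1 hx).le).2 τ hτ
        out := fun x hx y hxy hy τ hτ => ?_
        start := fun x hx => ?_
        s_le := hτ₁s
        le := hτle
        le_end := hτ₀.2
        t_pos := ht }
    · have := hadjd x y hxy
      have := (hDmem x).1 hx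
      omega
    · have h1 : (G.dist x₀ y : ℝ) ≤ G.dist x₀ x + 1 := by exact_mod_cast hadjd x y hxy
      have h2 : (G.dist x₀ x : ℝ) ≤ G.dist x₀ y + 1 := by exact_mod_cast hadjd y x hxy.symm
      have h3 : H * G.dist x₀ x / ℓ - H * G.dist x₀ y / ℓ =
          H / ℓ * ((G.dist x₀ x : ℝ) - G.dist x₀ y) := by ring
      simp only [h3]
      rw [abs_mul, abs_of_nonneg (by positivity : 0 ≤ H / ℓ)]
      exact mul_le_of_le_one_right (by positivity) (abs_le.2 ⟨by linarith, by linarith⟩)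
    · have h1 := hadjd x y hxy
      have h2 := (hDmem x).1 hx
      have h3 := mt (hDmem y).2 hy
      have h4 : G.dist x₀ y = ℓ := by omega
      have h5 := (hregion y h4.le).2 τ hτ
      have h6 : H * G.dist x₀ y / ℓ = H := by rw [h4]; field_simp
      simp only [h6]
      linarith [hcτ τ hτ]
    · have h1 := (hregion x ((hDmem x).1 hx).le).2 τ₁ ⟨le_rfl, hτle⟩
      have h2 : 2 * H / (t * φ) * (τ₀ - τ₁) = H := by rw [hτ₁]; field_simp; ring
      have h3 : 0 ≤ H * G.dist x₀ x / ℓ := by positivity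
      simp only [h2]
      linarith
  · rw [hDmem, SimpleGraph.dist_self]
    exact_mod_cast hℓ0
  · simp
  · have h1 : H ^ 2 = 4 ^ m * M ^ 2 := by
      rw [hH, mul_pow, ← pow_mul, mul_comm m, pow_mul]; norm_num
    -- The constant 34 is 32 from the spatial slope, by ℓ ≥ nφ/8, plus 2 from the temporal slope,
    -- where φ ≤ 1 replaces 1/φ by 1/φ².
    have h2 : (H / ℓ) ^ 2 / 2 * t ≤ 32 * H ^ 2 / φ ^ 2 := by
      have h3 : t * φ ^ 2 ≤ 64 * (ℓ : ℝ) ^ 2 := by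
        rw [← hn2, ← mul_pow]; nlinarith [mul_pos hn0 hφ0]
      rw [div_pow, div_div, div_mul_eq_mul_div, div_le_div_iff₀ (by positivity) (by positivity)]
      nlinarith [mul_le_mul_of_nonneg_left h3 (sq_nonneg H)]
    have h3 : 2 * H / (t * φ) * H * t ≤ 2 * H ^ 2 / φ ^ 2 := by
      have : 2 * H / (t * φ) * H * t = 2 * H ^ 2 / φ := by field_simp
      rw [this]
      refine div_le_div_of_nonneg_left (by positivity) (by positivity) ?_
      nlinarith
    calc ((H / ℓ) ^ 2 / 2 + 2 * H / (t * φ) * H) * t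
        = (H / ℓ) ^ 2 / 2 * t + 2 * H / (t * φ) * H * t := by ring
      _ ≤ 32 * H ^ 2 / φ ^ 2 + 2 * H ^ 2 / φ ^ 2 := add_le_add h2 h3
      _ = _ := by rw [h1]; ring

/-- The local maximal inequality for the heat kernel, with finite integrability exponents. -/
theorem realKernel_le_of_exponents (hG : G.Connected) (hω : IsWeight G ω) {s t : ℝ} (ht : 0 < t)
    (x₁ x₂ : V) (hmu : ∀ x ∈ ball G x₂ √t, IntegrableOn (fun v => mu G ω v x) (Ioc s (s + t)))
    {d' CS : ℝ} (hCS : 0 < CS) (hSob : SobolevOn G (ball G x₂ √t) ⌊√t⌋₊ d' CS)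
    {p p' q q' a σ r e g : ℝ} (hx : IterationExponents p p' q q' d' a σ r e g)
    {Aμ Aν : ℝ≥0∞} (hAμ : Aμ = spaceTimeNorm s (s + t) (ball G x₂ √t) (ENNReal.ofReal p)
      (ENNReal.ofReal p') (fun v x => max 1 (mu G ω v x)))
    (hAν : Aν = spaceTimeNorm s (s + t) (ball G x₂ √t) (ENNReal.ofReal q) (ENNReal.ofReal q')
      (fun v x => max 1 (nu G ω v x)))
    (hAt : Aμ * Aν ≠ ∞) (hAν1 : 1 ≤ Aν) {η κ : ℝ} (hη : η = (1 - 1 / p') * g - σ)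
    (hκ : κ = g / (a * η)) {m : ℕ} (hm : 2 * κ ≤ m) {y : V} (hy : y ∈ ball G x₂ (√t / 2)) :
    realKernel G ω s x₁ y (s + t) ≤ 2 ^ m * ((8 / √t) ^ m +
      4 * (256 * max 1 (CS ^ 2) * (34 * 4 ^ m) * (Aμ * Aν).toReal * 4 ^ (1 / η)) ^ κ /
        (ball G x₂ √t).card) := by
  set n := √t with hn
  have hn0 : 0 < n := Real.sqrt_pos.2 ht
  have hn2 : n ^ 2 = t := Real.sq_sqrt ht.le
  have hdy : (G.dist x₂ y : ℝ) ≤ n / 2 := by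
    rw [mem_ball_iff hG] at hy
    exact (Nat.cast_le.2 hy).trans (Nat.floor_le (by positivity))
  have hyB : y ∈ ball G x₂ n := (mem_ball_iff hG).2 (Nat.le_floor (by linarith))
  have hcard : (0 : ℝ) < (ball G x₂ n).card := by exact_mod_cast Finset.card_pos.2 ⟨y, hyB⟩
  obtain ⟨x₀, hx₀, τ₀, hτ₀, hmax⟩ := exists_isMax_boundaryWeight hω ht x₁ x₂ ⟨y, hyB⟩ hmu m
  obtain ⟨φ, hφ⟩ : ∃ φ, φ = boundaryWeight G x₂ s t x₀ τ₀ := ⟨_, rfl⟩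
  obtain ⟨M, hM⟩ : ∃ M, M = realKernel G ω s x₁ x₀ τ₀ := ⟨_, rfl⟩
  have hφ0 : 0 ≤ φ := hφ ▸ le_max_left _ _
  have hM0 : 0 ≤ M := hM ▸ realKernel_nonneg _ _ _ _
  have hM1 : M ≤ 1 := hM ▸ hω.realKernel_le_one _ _ _ _
  have hφ1 : φ ≤ 1 := by
    rw [hφ, boundaryWeight]
    refine max_le zero_le_one ((min_le_left _ _).trans ?_)
    have : (0 : ℝ) ≤ G.dist x₂ x₀ / √t := by positivity
    linarith
  have hW0 : 0 ≤ 256 * max 1 (CS ^ 2) * (34 * 4 ^ m) * (Aμ * Aν).toReal * 4 ^ (1 / η) := by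
    have : 0 ≤ (Aμ * Aν).toReal := ENNReal.toReal_nonneg
    positivity
  -- On the half ball at the final time the boundary weight is at least 1/2.
  have hyle : realKernel G ω s x₁ y (s + t) ≤ 2 ^ m * (φ ^ m * M) := by
    have h1 := hmax y hyB (s + t) ⟨by linarith, le_rfl⟩
    rw [← hφ, ← hM] at h1
    have hw : 1 / 2 ≤ boundaryWeight G x₂ s t y (s + t) := by
      rw [boundaryWeight, ← hn]
      refine le_max_of_le_right (le_min ?_ ?_)
      · have : G.dist x₂ y / n ≤ 1 / 2 := by rw [div_le_iff₀ hn0]; linarith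
        linarith
      · rw [add_sub_cancel_left, div_self ht.ne']; norm_num
    have h2 := (mul_le_mul_of_nonneg_right (pow_le_pow_left₀ (by norm_num) hw m)
      (realKernel_nonneg s x₁ y (s + t))).trans h1
    have h3 : (2 : ℝ) ^ m * (1 / 2) ^ m = 1 := by rw [← mul_pow]; norm_num
    calc realKernel G ω s x₁ y (s + t)
        = 2 ^ m * ((1 / 2) ^ m * realKernel G ω s x₁ y (s + t)) := by rw [← mul_assoc, h3, one_mul]
      _ ≤ _ := mul_le_mul_of_nonneg_left h2 (by positivity)
  refine hyle.trans (mul_le_mul_of_nonneg_left ?_ (by positivity))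
  have hterm : 0 ≤ 4 * (256 * max 1 (CS ^ 2) * (34 * 4 ^ m) * (Aμ * Aν).toReal * 4 ^ (1 / η)) ^ κ /
        (ball G x₂ n).card := by
    have := Real.rpow_nonneg hW0 κ
    positivity
  -- Too close to the parabolic boundary for a cylinder to fit; the trivial bound M ≤ 1 is enough.
  rcases lt_or_ge (n * φ) 8 with hsmall | hφ8
  · have h1 : φ ≤ 8 / n := by rw [le_div_iff₀ hn0]; linarith
    have h2 : φ ^ m * M ≤ (8 / n) ^ m :=
      (mul_le_of_le_one_right (by positivity) hM1).trans (pow_le_pow_left₀ hφ0 h1 m)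
    linarith
  have h8 : 0 ≤ (8 / n) ^ m := by positivity
  rcases hM0.eq_or_lt with hMz | hMpos
  · rw [← hMz, mul_zero]; linarith
  have hφpos : 0 < φ := by
    by_contra h
    nlinarith
  obtain ⟨D, b, τ₁, c, L, H, hset, hxD, hb, hΓ⟩ :=
    exists_barrierSetup hG hω ht x₁ x₂ hmu m hx₀ hτ₀ hmax hφ hφ8 hM
  have hN : ((⌊√t⌋₊ : ℕ) : ℝ) ^ 2 ≤ t := by
    exact (pow_le_pow_left₀ (by positivity) (Nat.floor_le hn0.le) 2).trans_eq hn2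
  have hpk := hset.peak_mul_card_le hCS hSob hN hx hAμ hAν hAt hAν1
    (fun v => hω.sum_realKernel_le_one _ s x₁ v) hxD hb hMpos hM.symm (by positivity) hΓ
  rw [← hη, ← hκ] at hpk
  have hη0 : 0 < η := by rw [hη]; linarith [hx.gain_pos]
  have hg0 : 0 ≤ g := by
    rw [hx.g_eq]; have := mul_pos hx.σ_pos hx.r_pos; linarith [hx.e_nonneg]
  have hκ0 : 0 ≤ κ := by rw [hκ]; have := hx.a_pos; positivity
  set W := 256 * max 1 (CS ^ 2) * (34 * 4 ^ m) * (Aμ * Aν).toReal * 4 ^ (1 / η) with hW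
  have hWφ : 256 * max 1 (CS ^ 2) * (34 * 4 ^ m / φ ^ 2) * (Aμ * Aν).toReal * 4 ^ (1 / η) =
      W * (φ ^ 2)⁻¹ := by rw [hW]; ring
  rw [hWφ, Real.mul_rpow hW0 (by positivity)] at hpk
  -- The loss φ^{-2κ} from the small cylinder is absorbed by the weight, as φ ≤ 1 and m ≥ 2κ.
  have hφm : φ ^ m * ((φ ^ 2)⁻¹) ^ κ ≤ 1 := by
    rw [Real.inv_rpow (by positivity), ← div_eq_mul_inv, div_le_one (by positivity),
      ← Real.rpow_natCast φ 2, ← Real.rpow_mul hφ0, ← Real.rpow_natCast φ m]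
    exact Real.rpow_le_rpow_of_exponent_ge hφpos hφ1 (by push_cast; exact hm)
  have h5 : φ ^ m * M ≤ 4 * W ^ κ / (ball G x₂ n).card := by
    rw [le_div_iff₀ hcard]
    calc φ ^ m * M * (ball G x₂ n).card = φ ^ m * (M * (ball G x₂ n).card) := by ring
      _ ≤ φ ^ m * (4 * (W ^ κ * ((φ ^ 2)⁻¹) ^ κ)) := by gcongr
      _ = 4 * W ^ κ * (φ ^ m * ((φ ^ 2)⁻¹) ^ κ) := by ring
      _ ≤ 4 * W ^ κ * 1 := by
          have := Real.rpow_nonneg hW0 κ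
          gcongr
      _ = _ := mul_one _
  linarith

end Local

/-! ### Monotonicity of averaged norms in the exponents -/

section Monotonicity

variable {V : Type*}

/-- Hölder against the constant 1, which costs nothing for a probability measure. -/
theorem lintegral_rpow_mono_exponent {m : Measure ℝ} (hm : m univ = 1) {F : ℝ → ℝ≥0∞}
    (hF : Measurable F) {r p : ℝ} (hr : 0 < r) (hrp : r ≤ p) :
    (∫⁻ v, F v ^ r ∂m) ^ (1 / r) ≤ (∫⁻ v, F v ^ p ∂m) ^ (1 / p) := by
  have hp : 0 < p := hr.trans_le hrp
  have h := ENNReal.lintegral_mul_norm_pow_le (μ := m) (hF.pow_const p).aemeasurable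
    (g := fun _ => 1) aemeasurable_const (p := r / p) (q := 1 - r / p) (by positivity)
    (sub_nonneg.2 ((div_le_one hp).2 hrp)) (by ring)
  simp only [ENNReal.one_rpow, mul_one, lintegral_one, hm, ← ENNReal.rpow_mul,
    mul_div_cancel₀ r hp.ne'] at h
  calc (∫⁻ v, F v ^ r ∂m) ^ (1 / r) ≤ ((∫⁻ v, F v ^ p ∂m) ^ (r / p)) ^ (1 / r) := by gcongr
    _ = _ := by rw [← ENNReal.rpow_mul]; congr 1; field_simp

theorem spaceNorm_mono {B : Finset V} (hB : B.Nonempty) {r : ℝ} (hr : 0 < r) {p : ℝ≥0∞}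
    (hrp : ENNReal.ofReal r ≤ p) (f : V → ℝ) :
    spaceNorm B (ENNReal.ofReal r) f ≤ spaceNorm B p f := by
  have hc0 : (B.card : ℝ≥0∞) ≠ 0 := by simpa using hB.ne_empty
  have hct : (B.card : ℝ≥0∞) ≠ ∞ := ENNReal.natCast_ne_top _
  rw [spaceNorm_ofReal B hr.le]
  by_cases hp : p = ∞
  · rw [spaceNorm, if_pos hp, one_div, ENNReal.rpow_inv_le_iff hr]
    refine ENNReal.div_le_of_le_mul ?_
    rw [mul_comm, ← nsmul_eq_mul]
    refine Finset.sum_le_card_nsmul _ _ _ fun x hx => ?_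
    gcongr
    exact le_iSup₂ (f := fun x (_ : x ∈ B) => ‖f x‖ₑ) x hx
  · have hrp' : r ≤ p.toReal := (ENNReal.ofReal_le_iff_le_toReal hp).1 hrp
    have hp0 : 0 < p.toReal := hr.trans_le hrp'
    rw [spaceNorm, if_neg hp]
    have h := ENNReal.rpow_arith_mean_le_arith_mean_rpow B (fun _ => (B.card : ℝ≥0∞)⁻¹)
      (fun x => ‖f x‖ₑ ^ r) (by simp [ENNReal.mul_inv_cancel hc0 hct]) (p := p.toReal / r)
      ((one_le_div hr).2 hrp')
    simp only [← Finset.mul_sum, ← ENNReal.rpow_mul, mul_div_cancel₀ p.toReal hr.ne'] at h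
    rw [mul_comm, ← div_eq_mul_inv, mul_comm, ← div_eq_mul_inv] at h
    calc ((∑ x ∈ B, ‖f x‖ₑ ^ r) / (B.card : ℝ≥0∞)) ^ (1 / r)
        = (((∑ x ∈ B, ‖f x‖ₑ ^ r) / (B.card : ℝ≥0∞)) ^ (p.toReal / r)) ^ (1 / p.toReal) := by
          rw [← ENNReal.rpow_mul]; congr 1; field_simp
      _ ≤ _ := by gcongr

theorem spaceTimeNorm_mono {B : Finset V} (hB : B.Nonempty) {s t : ℝ} (ht : 0 < t) {r r' : ℝ}
    (hr : 0 < r) (hr' : 0 < r') {p p' : ℝ≥0∞} (hrp : ENNReal.ofReal r ≤ p)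
    (hrp' : ENNReal.ofReal r' ≤ p') {f : ℝ → V → ℝ} (hf : ∀ x ∈ B, Measurable fun v => f v x) :
    spaceTimeNorm s (s + t) B (ENNReal.ofReal r) (ENNReal.ofReal r') f ≤
      spaceTimeNorm s (s + t) B p p' f := by
  have h1 : spaceTimeNorm s (s + t) B (ENNReal.ofReal r) (ENNReal.ofReal r') f ≤
      spaceTimeNorm s (s + t) B p (ENNReal.ofReal r') f := by
    rw [spaceTimeNorm_ofReal ht B _ hr'.le, spaceTimeNorm_ofReal ht B _ hr'.le]
    gcongr
    exact spaceNorm_mono hB hr hrp _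
  refine h1.trans ?_
  by_cases hp' : p' = ∞
  · rw [spaceTimeNorm_ofReal ht B _ hr'.le, spaceTimeNorm, if_pos hp', one_div,
      ENNReal.rpow_inv_le_iff hr', meanTime, lintegral_smul_measure, smul_eq_mul, mul_comm,
      ← div_eq_mul_inv]
    refine ENNReal.div_le_of_le_mul ?_
    calc ∫⁻ v in Icc s (s + t), spaceNorm B p (f v) ^ r'
        ≤ ∫⁻ _ in Icc s (s + t), (⨆ v ∈ Icc s (s + t), spaceNorm B p (f v)) ^ r' := by
          refine setLIntegral_mono measurable_const fun v hv => ?_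
          gcongr
          exact le_iSup₂ (f := fun v (_ : v ∈ Icc s (s + t)) => spaceNorm B p (f v)) v hv
      _ = _ := by simp [Real.volume_Icc]
  · have hrp'' : r' ≤ p'.toReal := (ENNReal.ofReal_le_iff_le_toReal hp').1 hrp'
    rw [← ENNReal.ofReal_toReal hp', spaceTimeNorm_ofReal ht B _ hr'.le,
      spaceTimeNorm_ofReal ht B _ ENNReal.toReal_nonneg]
    exact lintegral_rpow_mono_exponent (meanTime_univ ht) (measurable_spaceNorm B p hf) hr' hrp''

theorem one_le_spaceTimeNorm {B : Finset V} (hB : B.Nonempty) {s t : ℝ} (ht : 0 < t) {r r' : ℝ}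
    (hr : 0 < r) (hr' : 0 < r') {f : ℝ → V → ℝ} (hf : ∀ v x, 1 ≤ f v x) :
    1 ≤ spaceTimeNorm s (s + t) B (ENNReal.ofReal r) (ENNReal.ofReal r') f := by
  have hc0 : (B.card : ℝ≥0∞) ≠ 0 := by simpa using hB.ne_empty
  have hct : (B.card : ℝ≥0∞) ≠ ∞ := ENNReal.natCast_ne_top _
  have h1 : ∀ v, 1 ≤ spaceNorm B (ENNReal.ofReal r) (f v) := fun v => by
    rw [spaceNorm_ofReal B hr.le]
    refine ENNReal.one_le_rpow ?_ (by positivity)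
    rw [ENNReal.le_div_iff_mul_le (Or.inl hc0) (Or.inl hct), one_mul]
    have : (B.card : ℝ≥0∞) = ∑ x ∈ B, 1 := by simp
    rw [this]
    refine Finset.sum_le_sum fun x _ => ENNReal.one_le_rpow ?_ hr
    rw [Real.enorm_eq_ofReal (zero_le_one.trans (hf v x))]
    exact ENNReal.one_le_ofReal.2 (hf v x)
  rw [spaceTimeNorm_ofReal ht B _ hr'.le]
  refine ENNReal.one_le_rpow ?_ (by positivity)
  calc (1 : ℝ≥0∞) = ∫⁻ _, 1 ∂meanTime s t := by rw [lintegral_one, meanTime_univ ht]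
    _ ≤ _ := lintegral_mono fun v => ENNReal.one_le_rpow (h1 v) hr'

/-- Finiteness of the averaged norm gives integrability in time at each vertex. -/
theorem integrableOn_of_spaceTimeNorm_ne_top {B : Finset V} {s t : ℝ} (ht : 0 < t)
    {r r' : ℝ} (hr : 1 < r) (hr' : 1 < r') {f : ℝ → V → ℝ}
    (hf : ∀ x ∈ B, Measurable fun v => f v x)
    (hfin : spaceTimeNorm s (s + t) B (ENNReal.ofReal r) (ENNReal.ofReal r') f ≠ ∞) {x : V}
    (hx : x ∈ B) : IntegrableOn (fun v => f v x) (Icc s (s + t)) := by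
  refine ⟨(hf x hx).aestronglyMeasurable, ?_⟩
  have hB : B.Nonempty := ⟨x, hx⟩
  have hc0 : (B.card : ℝ≥0∞) ≠ 0 := by simpa using hB.ne_empty
  have hct : (B.card : ℝ≥0∞) ≠ ∞ := ENNReal.natCast_ne_top _
  have hm := measurable_spaceNorm B (ENNReal.ofReal r) hf
  have h1 := lintegral_rpow_mono_exponent (meanTime_univ (s := s) ht) hm one_pos hr'.le
  rw [← spaceTimeNorm_ofReal (p' := r') ht B _ (by linarith)] at h1
  simp only [ENNReal.rpow_one, div_one] at h1
  rw [HasFiniteIntegral, lintegral_Icc_eq_mul_meanTime ht]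
  refine ENNReal.mul_lt_top ENNReal.ofReal_lt_top ?_
  calc ∫⁻ v, ‖f v x‖ₑ ∂meanTime s t
      ≤ ∫⁻ v, B.card * spaceNorm B (ENNReal.ofReal r) (f v) ∂meanTime s t := by
        refine lintegral_mono fun v => ?_
        have h2 := sum_div_card_le_spaceNorm_mul (Finset.Subset.refl B) hB hr (f v)
        rw [ENNReal.div_self hc0 hct, ENNReal.one_rpow, mul_one, ENNReal.div_le_iff hc0 hct] at h2
        rw [mul_comm]
        exact (Finset.single_le_sum (f := fun x => ‖f v x‖ₑ) (fun _ _ => zero_le) hx).trans h2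
    _ = B.card * ∫⁻ v, spaceNorm B (ENNReal.ofReal r) (f v) ∂meanTime s t :=
        lintegral_const_mul' _ _ hct
    _ < ∞ := ENNReal.mul_lt_top hct.lt_top (h1.trans_lt hfin.lt_top)

end Monotonicity

/-! ### Reduction to finite exponents -/

section Reduction

theorem ofReal_one_div_le {p : ℝ≥0∞} {α : ℝ} (hα : 0 < α) (hp : p⁻¹.toReal ≤ α)
    (hp' : p⁻¹ ≠ ∞) : ENNReal.ofReal (1 / α) ≤ p := by
  rw [one_div, ENNReal.ofReal_inv_of_pos hα, ENNReal.inv_le_iff_inv_le]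
  exact (ENNReal.le_ofReal_iff_toReal_le hp' hα.le).2 hp

/-- The exponents may be lowered to finite ones without leaving the admissible range. -/
theorem ExponentCondition.exists_real {p p' q q' : ℝ≥0∞} {d' : ℝ} (hd' : 2 ≤ d')
    (h : ExponentCondition p p' q q' d') :
    ∃ r r' l l' : ℝ, 1 < r ∧ 1 < r' ∧ 1 < l ∧ 0 < l' ∧ ENNReal.ofReal r ≤ p ∧
      ENNReal.ofReal r' ≤ p' ∧ ENNReal.ofReal l ≤ q ∧ ENNReal.ofReal l' ≤ q' ∧
      1 / r * (1 - 1 / r')⁻¹ * (1 + 1 / l') + 1 / l < 2 / d' := by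
  obtain ⟨hp, hp', hq, hq', hcond⟩ := h
  have hpi : p⁻¹ ≠ ∞ := ne_top_of_le_ne_top ENNReal.one_ne_top (ENNReal.inv_le_one.2 hp)
  have hpi' : p'⁻¹ < 1 := ENNReal.inv_lt_one.2 hp'
  have hpt' : p'⁻¹ ≠ ∞ := (hpi'.trans ENNReal.one_lt_top).ne
  have hqi : q⁻¹ ≠ ∞ := ne_top_of_le_ne_top ENNReal.one_ne_top (ENNReal.inv_le_one.2 hq)
  have hqi' : q'⁻¹ ≠ ∞ := ne_top_of_le_ne_top ENNReal.one_ne_top (ENNReal.inv_le_one.2 hq')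
  set α := p⁻¹.toReal with hα
  set b := p'⁻¹.toReal with hb
  set c := q⁻¹.toReal with hc
  set ε := q'⁻¹.toReal with hε
  have hα0 : 0 ≤ α := ENNReal.toReal_nonneg
  have hb0 : 0 ≤ b := ENNReal.toReal_nonneg
  have hc0 : 0 ≤ c := ENNReal.toReal_nonneg
  have hε0 : 0 ≤ ε := ENNReal.toReal_nonneg
  have hb1 : b < 1 := by
    have := (ENNReal.toReal_lt_toReal hpt' ENNReal.one_ne_top).2 hpi'
    rwa [ENNReal.toReal_one] at this
  have hreal : α * (1 - b)⁻¹ * (1 + ε) + c < 2 / d' := by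
    have h1 := (ENNReal.lt_ofReal_iff_toReal_lt (ne_top_of_lt hcond)).1 hcond
    have hsub : (1 - p'⁻¹)⁻¹ ≠ ∞ := ENNReal.inv_ne_top.2 (tsub_pos_of_lt hpi').ne'
    rw [ENNReal.toReal_add (ENNReal.mul_ne_top (ENNReal.mul_ne_top hpi hsub)
      (ENNReal.add_ne_top.2 ⟨ENNReal.one_ne_top, hqi'⟩)) hqi, ENNReal.toReal_mul,
      ENNReal.toReal_mul, ENNReal.toReal_inv (1 - p'⁻¹),
      ENNReal.toReal_sub_of_le hpi'.le ENNReal.one_ne_top,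
      ENNReal.toReal_add ENNReal.one_ne_top hqi', ENNReal.toReal_one] at h1
    exact h1
  -- Every inverse exponent is raised to at least δ > 0, making all exponents finite. The condition
  -- is strict and F is continuous at 0, so a small δ preserves it.
  set F : ℝ → ℝ := fun δ => max α δ * (1 - max b δ)⁻¹ * (1 + max ε δ) + max c δ with hF
  have hF0 : F 0 < 2 / d' := by
    simp only [hF, max_eq_left hα0, max_eq_left hb0, max_eq_left hc0, max_eq_left hε0]
    exact hreal
  have hFc : ContinuousAt F 0 := by
    have : 1 - max b 0 ≠ 0 := by rw [max_eq_left hb0]; linarith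
    fun_prop (disch := assumption)
  have hev : ∀ᶠ δ in nhdsWithin (0 : ℝ) (Ioi 0), F δ < 2 / d' ∧ δ < 1 ∧ 0 < δ := by
    have h1 := (hFc.eventually_lt continuousAt_const hF0).filter_mono
      (nhdsWithin_le_nhds (s := Ioi 0))
    have h2 : ∀ᶠ δ in nhdsWithin (0 : ℝ) (Ioi 0), δ < 1 :=
      nhdsWithin_le_nhds (Iio_mem_nhds one_pos)
    filter_upwards [h1, h2, self_mem_nhdsWithin] with δ h1 h2 h3 using ⟨h1, h2, h3⟩
  obtain ⟨δ, hδF, hδ1, hδ0⟩ := hev.exists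
  have hD : 2 / d' ≤ 1 := (div_le_one (by linarith)).2 hd'
  have hα' : 0 < max α δ := lt_max_of_lt_right hδ0
  have hb' : 0 < max b δ := lt_max_of_lt_right hδ0
  have hc' : 0 < max c δ := lt_max_of_lt_right hδ0
  have hε' : 0 < max ε δ := lt_max_of_lt_right hδ0
  have hb1' : max b δ < 1 := max_lt hb1 hδ1
  have hinv : 1 ≤ (1 - max b δ)⁻¹ := (one_le_inv₀ (by linarith)).2 (by linarith)
  -- As 2/d' ≤ 1, the condition itself keeps the lowered p and q strictly above 1.
  have hmul : max α δ ≤ max α δ * (1 - max b δ)⁻¹ * (1 + max ε δ) := by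
    rw [mul_assoc]
    exact le_mul_of_one_le_right hα'.le (one_le_mul_of_one_le_of_one_le hinv (by linarith))
  have hlt : max α δ * (1 - max b δ)⁻¹ * (1 + max ε δ) + max c δ < 1 := hδF.trans_le hD
  refine ⟨1 / max α δ, 1 / max b δ, 1 / max c δ, 1 / max ε δ, ?_, ?_, ?_, by positivity,
    ofReal_one_div_le hα' (le_max_left _ _) hpi, ofReal_one_div_le hb' (le_max_left _ _) hpt',
    ofReal_one_div_le hc' (le_max_left _ _) hqi, ofReal_one_div_le hε' (le_max_left _ _) hqi', ?_⟩
  · rw [one_lt_div hα']; linarith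
  · rw [one_lt_div hb']; exact hb1'
  · rw [one_lt_div hc']; linarith
  · simp only [one_div_one_div]; exact hδF

end Reduction

/-! ### Assembling the heat kernel bound -/

section Final

universe v

theorem ball_floor {V : Type*} (G : SimpleGraph V) [G.LocallyFinite] (x : V) (r : ℝ) :
    ball G x (⌊r⌋₊ : ℕ) = ball G x r := by
  ext y
  simp only [ball, Set.Finite.mem_toFinset, ballSet, Nat.floor_natCast]

/-- The bound with constants given in terms of the exponents and of the regularity data. -/
theorem exists_heatKernel_le (p p' q q' : ℝ≥0∞) (d' : ℝ) (hd' : 2 ≤ d')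
    (hexp : ExponentCondition p p' q q' d') :
    ∃ κ : ℝ, 0 < κ ∧ ∀ (d : ℕ) (creg CS : ℝ), 0 < creg → 0 < CS → ∃ C : ℝ, 0 < C ∧
      ∀ (V : Type v) (G : SimpleGraph V) [G.LocallyFinite], G.Connected →
      ∀ (x₂ : V) (t : ℝ), 0 < t → 8 ≤ √t →
      creg * (⌊√t⌋₊ : ℝ) ^ d ≤ (ball G x₂ √t).card → SobolevOn G (ball G x₂ √t) ⌊√t⌋₊ d' CS →
      ∀ ω : ℝ → Sym2 V → ℝ, IsWeight G ω → ∀ (x₁ : V) (s : ℝ), ∀ y ∈ ball G x₂ (√t / 2),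
        heatKernel G ω s x₁ (s + t) y ≤ ENNReal.ofReal C *
          (spaceTimeNorm s (s + t) (ball G x₂ √t) p p' (fun τ x => max 1 (mu G ω τ x)) *
            spaceTimeNorm s (s + t) (ball G x₂ √t) q q' (fun τ x => max 1 (nu G ω τ x))) ^ κ *
          ENNReal.ofReal (t ^ (-(d : ℝ) / 2)) := by
  obtain ⟨r, r', l, l', hr, hr', hl, hl', hrp, hrp', hlq, hlq', hcond⟩ := hexp.exists_real hd'
  obtain ⟨a, σ, ρ, e, g, hx⟩ := exists_iteration_exponents hr hr' hl hl' hd' hcond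
  obtain ⟨η, hη⟩ : ∃ η, η = (1 - 1 / r') * g - σ := ⟨_, rfl⟩
  obtain ⟨κ, hκ⟩ : ∃ κ, κ = g / (a * η) := ⟨_, rfl⟩
  have hη0 : 0 < η := by rw [hη]; linarith [hx.gain_pos]
  have hg0 : 0 < g := by
    rw [hx.g_eq]; have := mul_pos hx.σ_pos hx.r_pos; linarith [hx.e_nonneg]
  have hκ0 : 0 < κ := by rw [hκ]; have := hx.a_pos; positivity
  refine ⟨κ, hκ0, fun d creg CS hcreg hCS => ?_⟩
  -- The bound 2κ serves the absorption of the weight; the bound d turns (8/√t)^m into at most a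
  -- multiple of t^{-d/2}. The power κ is fixed before d, so it does not depend on it.
  obtain ⟨m, hm⟩ := exists_nat_ge (max (2 * κ) d)
  have hmκ : 2 * κ ≤ m := (le_max_left _ _).trans hm
  have hmd : d ≤ m := by exact_mod_cast (le_max_right _ _).trans hm
  obtain ⟨W, hW⟩ : ∃ W : ℝ, W = 256 * max 1 (CS ^ 2) * (34 * 4 ^ m) * 4 ^ (1 / η) := ⟨_, rfl⟩
  have hW0 : 0 < W := by rw [hW]; positivity
  refine ⟨2 ^ m * (8 ^ d + 4 * W ^ κ * 2 ^ d / creg), by positivity, ?_⟩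
  intro V G _ hG x₂ t ht ht8 hvol hSob ω hω x₁ s y hy
  set n := √t with hn
  have hn0 : 0 < n := Real.sqrt_pos.2 ht
  set B := ball G x₂ n with hBdef
  have hyB : y ∈ B := by
    rw [hBdef, mem_ball_iff hG]
    rw [mem_ball_iff hG] at hy
    exact hy.trans (Nat.floor_le_floor (by linarith))
  have hB : B.Nonempty := ⟨y, hyB⟩
  have hmum : ∀ x ∈ B, Measurable fun v => max 1 (mu G ω v x) := fun x _ =>
    measurable_const.max (hω.measurable_mu x)
  have hnum : ∀ x ∈ B, Measurable fun v => max 1 (nu G ω v x) := fun x _ =>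
    measurable_const.max (hω.measurable_nu x)
  have hr0 : 0 < r := by linarith
  have hr0' : 0 < r' := by linarith
  have hl0 : 0 < l := by linarith
  obtain ⟨Aμ, hAμ⟩ : ∃ Aμ, Aμ = spaceTimeNorm s (s + t) B (ENNReal.ofReal r) (ENNReal.ofReal r')
    (fun v x => max 1 (mu G ω v x)) := ⟨_, rfl⟩
  obtain ⟨Aν, hAν⟩ : ∃ Aν, Aν = spaceTimeNorm s (s + t) B (ENNReal.ofReal l) (ENNReal.ofReal l')
    (fun v x => max 1 (nu G ω v x)) := ⟨_, rfl⟩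
  have hμle := spaceTimeNorm_mono hB (s := s) ht hr0 hr0' hrp hrp' hmum
  have hνle := spaceTimeNorm_mono hB (s := s) ht hl0 hl' hlq hlq' hnum
  have hAμ1 : 1 ≤ Aμ := hAμ ▸ one_le_spaceTimeNorm hB ht hr0 hr0' fun v x => le_max_left _ _
  have hAν1 : 1 ≤ Aν := hAν ▸ one_le_spaceTimeNorm hB ht hl0 hl' fun v x => le_max_left _ _
  rw [← hAμ] at hμle
  rw [← hAν] at hνle
  refine le_trans ?_ (mul_le_mul_left (mul_le_mul_right
    (ENNReal.rpow_le_rpow (mul_le_mul' hμle hνle) hκ0.le) _) _)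
  have htd : 0 < t ^ (-(d : ℝ) / 2) := Real.rpow_pos_of_pos ht _
  -- With an infinite product the right-hand side is infinite. Otherwise, as the ν norm is at least
  -- 1, the μ norm is finite, which gives the time integrability behind the forward equation.
  by_cases hAt : Aμ * Aν = ∞
  · rw [hAt, ENNReal.top_rpow_of_pos hκ0, ENNReal.mul_top (by
      rw [Ne, ENNReal.ofReal_eq_zero, not_le]; positivity), ENNReal.top_mul (by
      rw [Ne, ENNReal.ofReal_eq_zero, not_le]; exact htd)]
    exact le_top
  have hAμt : Aμ ≠ ∞ := fun h => hAt (by rw [h, ENNReal.top_mul (one_pos.trans_le hAν1).ne'])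
  have hmu : ∀ x ∈ B, IntegrableOn (fun v => mu G ω v x) (Ioc s (s + t)) := fun x hxB => by
    have h1 := integrableOn_of_spaceTimeNorm_ne_top ht hr hr' hmum (hAμ ▸ hAμt) hxB
    refine Integrable.mono' (h1.mono_set Ioc_subset_Icc_self)
      (hω.measurable_mu x).aestronglyMeasurable (Filter.Eventually.of_forall fun v => ?_)
    rw [Real.norm_eq_abs, abs_of_nonneg (hω.mu_nonneg v x)]
    exact le_max_right _ _
  have key := realKernel_le_of_exponents hG hω ht x₁ x₂ hmu hCS hSob hx hAμ hAν hAt hAν1 hη hκ hmκ hy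
  set A := (Aμ * Aν).toReal with hA
  have hAeq : Aμ * Aν = ENNReal.ofReal A := (ENNReal.ofReal_toReal hAt).symm
  have hA1 : 1 ≤ A := by
    rw [hA, ← ENNReal.toReal_one]
    exact ENNReal.toReal_mono hAt (one_le_mul hAμ1 hAν1)
  have hA0 : 0 < A := by linarith
  have hntd : t ^ (-(d : ℝ) / 2) = (n ^ d)⁻¹ := by
    rw [hn, Real.sqrt_eq_rpow, ← Real.rpow_natCast, ← Real.rpow_mul ht.le, ← Real.rpow_neg ht.le]
    congr 1; ring
  have hAκ : 1 ≤ A ^ κ := Real.one_le_rpow hA1 hκ0.le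
  have hfirst : (8 / n) ^ m ≤ 8 ^ d * A ^ κ * (n ^ d)⁻¹ := by
    calc (8 / n) ^ m ≤ (8 / n) ^ d :=
          pow_le_pow_of_le_one (by positivity) ((div_le_one hn0).2 ht8) hmd
      _ = 8 ^ d * 1 * (n ^ d)⁻¹ := by rw [div_pow, mul_one, div_eq_mul_inv]
      _ ≤ _ := by gcongr
  -- Volume regularity holds at integer radii; ⌊n⌋ ≥ n/2 because n ≥ 8.
  have hcard : creg * (n / 2) ^ d ≤ B.card := by
    refine le_trans ?_ hvol
    have h1 : n / 2 ≤ ⌊n⌋₊ := by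
      have := Nat.lt_floor_add_one n
      linarith
    gcongr
  have hsecond : 4 * (256 * max 1 (CS ^ 2) * (34 * 4 ^ m) * A * 4 ^ (1 / η)) ^ κ / B.card ≤
      4 * W ^ κ * 2 ^ d / creg * A ^ κ * (n ^ d)⁻¹ := by
    have h1 : 256 * max 1 (CS ^ 2) * (34 * 4 ^ m) * A * 4 ^ (1 / η) = W * A := by rw [hW]; ring
    rw [h1, Real.mul_rpow hW0.le hA0.le]
    calc 4 * (W ^ κ * A ^ κ) / B.card ≤ 4 * (W ^ κ * A ^ κ) / (creg * (n / 2) ^ d) := by gcongr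
      _ = _ := by rw [div_pow]; field_simp
  have hfinal : realKernel G ω s x₁ y (s + t) ≤
      2 ^ m * (8 ^ d + 4 * W ^ κ * 2 ^ d / creg) * A ^ κ * t ^ (-(d : ℝ) / 2) := by
    refine key.trans ?_
    rw [hntd]
    calc _ ≤ 2 ^ m * (8 ^ d * A ^ κ * (n ^ d)⁻¹ +
          4 * W ^ κ * 2 ^ d / creg * A ^ κ * (n ^ d)⁻¹) := by gcongr
      _ = _ := by ring
  rw [← hω.ofReal_realKernel, hAeq, ENNReal.ofReal_rpow_of_nonneg hA0.le hκ0.le,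
    ← ENNReal.ofReal_mul (by positivity), ← ENNReal.ofReal_mul (by positivity)]
  exact ENNReal.ofReal_le_ofReal hfinal

end Final

end DynRCM

theorem corollary2p10 :
    ∃ (κ' : ℝ≥0∞ → ℝ≥0∞ → ℝ≥0∞ → ℝ≥0∞ → ℝ → ℝ)
      (C₃ : ℝ≥0∞ → ℝ≥0∞ → ℝ≥0∞ → ℝ≥0∞ → ℝ → ℕ → ℝ → ℝ → ℝ → ℝ),
      (∀ p p' q q' d', 0 < κ' p p' q q' d') ∧
      (∀ p p' q q' d' d creg Creg CS, 0 < C₃ p p' q q' d' d creg Creg CS) ∧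
      ∀ (V : Type*) [Infinite V] (G : SimpleGraph V) [G.LocallyFinite], G.Connected →
      ∀ (d : ℕ) (d' creg Creg CS : ℝ), 2 ≤ d → (d : ℝ) ≤ d' → 0 < creg → 0 < Creg → 0 < CS →
      DynRCM.VolumeRegularity G d creg Creg → DynRCM.SobolevInequality G d' CS →
      ∃ N₆ : V → ℝ,
      ∀ p p' q q' : ℝ≥0∞, DynRCM.ExponentCondition p p' q q' d' →
      ∀ ω : ℝ → Sym2 V → ℝ, DynRCM.IsWeight G ω →
      ∀ (x₁ x₂ : V) (s t : ℝ), 0 ≤ s → 0 < t → N₆ x₂ ≤ √t →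
      ∀ y ∈ DynRCM.ball G x₂ (√t / 2),
        DynRCM.heatKernel G ω s x₁ (s + t) y ≤
          ENNReal.ofReal (C₃ p p' q q' d' d creg Creg CS) *
            (DynRCM.spaceTimeNorm s (s + t) (DynRCM.ball G x₂ √t) p p'
                (fun τ x => max 1 (DynRCM.mu G ω τ x)) *
              DynRCM.spaceTimeNorm s (s + t) (DynRCM.ball G x₂ √t) q q'
                (fun τ x => max 1 (DynRCM.nu G ω τ x))) ^ κ' p p' q q' d' *
            ENNReal.ofReal (t ^ (-(d : ℝ) / 2)) := by
  classical
  -- The constants must be total positive functions of the parameters, so the value 1 is used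
  -- outside the admissible range. The order of quantifiers fixes what each constant may depend on.
  have key : ∀ (p p' q q' : ℝ≥0∞) (d' : ℝ), ∃ κ : ℝ, 0 < κ ∧
      ∀ (d : ℕ) (creg CS : ℝ), ∃ C : ℝ, 0 < C ∧
      (2 ≤ d' → DynRCM.ExponentCondition p p' q q' d' → 0 < creg → 0 < CS →
      ∀ (V : Type u_1) (G : SimpleGraph V) [G.LocallyFinite], G.Connected →
      ∀ (x₂ : V) (t : ℝ), 0 < t → 8 ≤ √t →
      creg * (⌊√t⌋₊ : ℝ) ^ d ≤ (DynRCM.ball G x₂ √t).card →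
      DynRCM.SobolevOn G (DynRCM.ball G x₂ √t) ⌊√t⌋₊ d' CS →
      ∀ ω : ℝ → Sym2 V → ℝ, DynRCM.IsWeight G ω → ∀ (x₁ : V) (s : ℝ),
      ∀ y ∈ DynRCM.ball G x₂ (√t / 2),
        DynRCM.heatKernel G ω s x₁ (s + t) y ≤ ENNReal.ofReal C *
          (DynRCM.spaceTimeNorm s (s + t) (DynRCM.ball G x₂ √t) p p'
              (fun τ x => max 1 (DynRCM.mu G ω τ x)) *
            DynRCM.spaceTimeNorm s (s + t) (DynRCM.ball G x₂ √t) q q'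
              (fun τ x => max 1 (DynRCM.nu G ω τ x))) ^ κ *
          ENNReal.ofReal (t ^ (-(d : ℝ) / 2))) := by
    intro p p' q q' d'
    by_cases h : 2 ≤ d' ∧ DynRCM.ExponentCondition p p' q q' d'
    · obtain ⟨κ, hκ, hC⟩ := DynRCM.exists_heatKernel_le p p' q q' d' h.1 h.2
      refine ⟨κ, hκ, fun d creg CS => ?_⟩
      by_cases h' : 0 < creg ∧ 0 < CS
      · obtain ⟨C, hC0, hC⟩ := hC d creg CS h'.1 h'.2
        exact ⟨C, hC0, fun _ _ _ _ => hC⟩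
      · exact ⟨1, one_pos, fun _ _ h1 h2 => absurd ⟨h1, h2⟩ h'⟩
    · exact ⟨1, one_pos, fun _ _ _ => ⟨1, one_pos, fun h1 h2 => absurd ⟨h1, h2⟩ h⟩⟩
  choose κ hκ C hC0 hC using key
  refine ⟨κ, fun p p' q q' d' d creg _ CS => C p p' q q' d' d creg CS, hκ,
    fun p p' q q' d' d creg _ CS => hC0 p p' q q' d' d creg CS, ?_⟩
  intro V _ G _ hG d d' creg Creg CS hd hdd' hcreg _ hCS hvol hsob
  choose N₁ hN₁ using hvol
  choose N₂ hN₂ using hsob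
  -- Both hypotheses are applied at the single radius ⌊√t⌋ around x₂, whose ball is the one of
  -- radius √t; the 8 is the graph scale of the localization.
  refine ⟨fun x => max 8 (max (N₁ x) (N₂ x)), ?_⟩
  intro p p' q q' hexp ω hω x₁ x₂ s t _ ht hN y hy
  have h2d : (2 : ℝ) ≤ d' := le_trans (by exact_mod_cast hd) hdd'
  have hn1 : N₁ x₂ ≤ ⌊√t⌋₊ := Nat.le_floor (((le_max_left _ _).trans (le_max_right _ _)).trans hN)
  have hn2 : N₂ x₂ ≤ ⌊√t⌋₊ := Nat.le_floor (((le_max_right _ _).trans (le_max_right _ _)).trans hN)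
  refine hC p p' q q' d' d creg CS h2d hexp hcreg hCS V G hG x₂ t ht ((le_max_left _ _).trans hN)
    ?_ ?_ ω hω x₁ s y hy
  · rw [← DynRCM.ball_floor]
    exact (hN₁ x₂ _ hn1).1
  · rw [← DynRCM.ball_floor]
    exact hN₂ x₂ _ hn2
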